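/- Let $n\ge 0$ be an integer. All algebras are over $\mathbb C$. **Notation.** Let $\mathrm{Diff}(n)$ be the algebra generated by $x^i,\partial_i$ ($1\le i\le n$) with relations $[x^i,x^j]=[\partial_i,\partial_j]=0$, $[\partial_i,x^j]=\delta_i^j$. Let $e_{ij}$ be the standard generators of $\mathfrak{gl}_n$, and put $\mathcal A=\mathrm{Diff}(n)\otimes \mathrm U(\mathfrak{gl}_n)$. Then $\mathfrak{gl}_n$ is embedded diagonally into $\mathcal A$ by $e_{ij}\mapsto x^i\partial_j\otimes 1+1\otimes e_{ij}$. Let $\mathfrak n_+$, $\mathfrak n_-$ be the spans of the diagonally embedded $e_{ij}$ with $i<j$, resp. $i>j$. Write $h_i$ for $e_{ii}$, $\mathring h_i=h_i-i$ and $\mathring h_{ij}=\mathring h_i-\mathring h_j$. Let $\bar{\mathrm U}(\mathfrak h)$ be the localization of $\mathrm U(\mathfrak h)=\mathbb C[h_1,\dots,h_n]$ at the multiplicative set generated by all $h_i-h_j+k$ with $i\ne j$ and $k\in\mathbb Z$, and let $\bar{\mathcal A}$ be the localization of $\mathcal A$ at the same (diagonally embedded) elements. Put $\bar{\mathrm J}_+=\bar{\mathcal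 A}\,\mathfrak n_+$ and $\bar{\mathrm J}_-=\mathfrak n_-\bar{\mathcal A}$. The reduction algebra of $\mathfrak h$-differential operators $\overline{\mathrm{Diff}}_{\mathfrak h}(n)$ is the double coset space $\bar{\mathcal A}/(\bar{\mathrm J}_-+\bar{\mathrm J}_+)$ with the product $\diamond$ under which $u\diamond v$ is the class of $ab$, for representatives $a$ of $u$ and $b$ of $v$ such that $b$ lies in the normalizer of $\bar{\mathrm J}_+$ or $a$ lies in the normalizer of $\bar{\mathrm J}_-$. For $D\in\mathrm{Diff}(n)$ let $:\!D\!:$ be the class of $D\otimes 1$; the classes of $x^i$ and $\partial_i$ are denoted by the same letters. Let $\varepsilon$ be the anti-involution of $\overline{\mathrm{Diff}}_{\mathfrak h}(n)$ induced by $x^i\mapsto\partial_i$, $\partial_i\mapsto x^i$, $e_{ij}\mapsto e_{ji}$. Let $\mathrm I_\partial$ be the left ideal generated by $\partial_1,\dots,\partial_n$ and $\mathrm I_x$ the right ideal generated by $x^1,\dots,x^n$. For $y\in\overline{\mathrm{Diff}}_{\mathfrak h}(n)$ let $y^{(0)}\in\bar{\mathrm U}(\mathfrak h)$ be the unique element with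 $y-y^{(0)}\in \mathrm I_\partial+\mathrm I_x$. The contravariant form on the left module $\mathcal P_{\mathfrak h}(n)=\overline{\mathrm{Diff}}_{\mathfrak h}(n)/\mathrm I_\partial$ is the $\bar{\mathrm U}(\mathfrak h)$-valued form $(u,v)=(\varepsilon(u)\diamond v)^{(0)}$. Finally, $a^{\uparrow m}=a(a+1)\cdots(a+m-1)$. **Proposition.** For all multi-indices $\nu,\nu'\in\mathbb Z_{\ge0}^n$, the images in $\mathcal P_{\mathfrak h}(n)$ of the monomials $:\!x^\nu\!:\;=\;:\!(x^1)^{\nu_1}\cdots(x^n)^{\nu_n}\!:$ and $:\!x^{\nu'}\!:$ satisfy $$(:\!x^\nu\!:,:\!x^{\nu'}\!:)=\delta_{\nu,\nu'}\prod_{k=1}^n\nu_k!\cdot\prod_{i<j}\frac{(\mathring h_{ij}-\nu_j)^{\uparrow \nu_i+1}}{\mathring h_{ij}^{\uparrow \nu_i+1}} =\delta_{\nu,\nu'}\prod_{k=1}^n\nu_k!\cdot\prod_{i<j}\frac{\Gamma(\mathring h_{ij}-\nu_j+\nu_i+1)\,\Gamma(\mathring h_{ij})}{\Gamma(\mathring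 h_{ij}-\nu_j)\,\Gamma(\mathring h_{ij}+\nu_i+1)} .$$ The first equality holds in $\bar{\mathrm U}(\mathfrak h)$. The second means that the values of both sides agree at every generic $\mu\in\mathfrak h^*$, that is, at every $\mu$ with $\mu(h_i)-\mu(h_j)\notin\mathbb Z$ for all $i\neq j$. -/

import Mathlib

open scoped TensorProduct

noncomputable section

namespace HDiff

/-! ### The ring of polynomial differential operators -/

/-- The free algebra on symbols `xⁱ` (left summand) and `∂ᵢ` (right summand). -/
abbrev FreeXD (n : ℕ) := FreeAlgebra ℂ (Fin n ⊕ Fin n)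

/-- The defining relations `[xⁱ, xʲ] = [∂ᵢ, ∂ⱼ] = 0` and `[∂ᵢ, xʲ] = δᵢʲ`. -/
inductive WeylRel (n : ℕ) : FreeXD n → FreeXD n → Prop
  | xx (i j : Fin n) : WeylRel n
      (FreeAlgebra.ι ℂ (Sum.inl i) * FreeAlgebra.ι ℂ (Sum.inl j))
      (FreeAlgebra.ι ℂ (Sum.inl j) * FreeAlgebra.ι ℂ (Sum.inl i))
  | dd (i j : Fin n) : WeylRel n
      (FreeAlgebra.ι ℂ (Sum.inr i) * FreeAlgebra.ι ℂ (Sum.inr j))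
      (FreeAlgebra.ι ℂ (Sum.inr j) * FreeAlgebra.ι ℂ (Sum.inr i))
  | dx (i j : Fin n) : WeylRel n
      (FreeAlgebra.ι ℂ (Sum.inr i) * FreeAlgebra.ι ℂ (Sum.inl j))
      (FreeAlgebra.ι ℂ (Sum.inl j) * FreeAlgebra.ι ℂ (Sum.inr i) + if i = j then 1 else 0)

/-- `Diff(n)`: the ring of polynomial differential operators in `n` variables over `ℂ`. -/
abbrev Diff (n : ℕ) := RingQuot (WeylRel n)

variable {n : ℕ}

/-- The variable `xⁱ` in `Diff(n)`. -/
def x (i : Fin n) : Diff n := RingQuot.mkAlgHom ℂ (WeylRel n) (FreeAlgebra.ι ℂ (Sum.inl i))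

/-- The derivation `∂ᵢ` in `Diff(n)`. -/
def d (i : Fin n) : Diff n := RingQuot.mkAlgHom ℂ (WeylRel n) (FreeAlgebra.ι ℂ (Sum.inr i))

theorem x_mul_x (i j : Fin n) : x i * x j = x j * x i := by
  simpa [x] using RingQuot.mkAlgHom_rel ℂ (WeylRel.xx i j)

theorem d_mul_d (i j : Fin n) : d i * d j = d j * d i := by
  simpa [d] using RingQuot.mkAlgHom_rel ℂ (WeylRel.dd i j)

theorem d_mul_x (i j : Fin n) : d i * x j = x j * d i + if i = j then 1 else 0 := by
  have h := RingQuot.mkAlgHom_rel ℂ (WeylRel.dx i j)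
  split_ifs at h ⊢ <;> simpa [x, d] using h

/-! ### The algebra `𝒜 = Diff(n) ⊗ U(gl_n)` -/

attribute [local instance] LieRing.ofAssociativeRing

/-- The Lie algebra `gl_n` over `ℂ`. -/
abbrev Gl (n : ℕ) := Matrix (Fin n) (Fin n) ℂ

/-- The universal enveloping algebra `U(gl_n)`. -/
abbrev Ugl (n : ℕ) := UniversalEnvelopingAlgebra ℂ (Gl n)

/-- `𝒜 = Diff(n) ⊗ U(gl_n)`. -/
abbrev A (n : ℕ) := Diff n ⊗[ℂ] Ugl n

/-- The standard generator `e_ij` of `gl_n` in `U(gl_n)`. -/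
def e (i j : Fin n) : Ugl n := UniversalEnvelopingAlgebra.ι ℂ (Matrix.single i j (1 : ℂ) : Gl n)

/-- The diagonally embedded `e_ij`, that is, `xⁱ ∂ⱼ ⊗ 1 + 1 ⊗ e_ij`. -/
def diagE (i j : Fin n) : A n := (x i * d j) ⊗ₜ[ℂ] (1 : Ugl n) + (1 : Diff n) ⊗ₜ[ℂ] e i j

/-- The elements `h_α + k` (`α` a root, `k ∈ ℤ`) of the diagonally embedded Cartan subalgebra,
that is, `h_i - h_j + k` with `i ≠ j`. -/
def denoms (n : ℕ) : Set (A n) :=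
  {a | ∃ (i j : Fin n) (k : ℤ), i ≠ j ∧ a = diagE i i - diagE j j + algebraMap ℂ (A n) (k : ℂ)}

/-! ### Localization of a noncommutative algebra -/

section Loc

variable {B : Type*} [Ring B] [Algebra ℂ B]

/-- The relations of the universal `S`-inverting algebra: the symbols `inl b` multiply and add as
in `B`, and the symbol `inr s` is a two-sided inverse of `inl s`. -/
inductive LocRel (S : Set B) : FreeAlgebra ℂ (B ⊕ S) → FreeAlgebra ℂ (B ⊕ S) → Prop
  | add (a b : B) : LocRel S (FreeAlgebra.ι ℂ (Sum.inl (a + b)))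
      (FreeAlgebra.ι ℂ (Sum.inl a) + FreeAlgebra.ι ℂ (Sum.inl b))
  | mul (a b : B) : LocRel S (FreeAlgebra.ι ℂ (Sum.inl (a * b)))
      (FreeAlgebra.ι ℂ (Sum.inl a) * FreeAlgebra.ι ℂ (Sum.inl b))
  | scalar (c : ℂ) : LocRel S (FreeAlgebra.ι ℂ (Sum.inl (algebraMap ℂ B c))) (algebraMap ℂ _ c)
  | mul_inv (s : S) : LocRel S
      (FreeAlgebra.ι ℂ (Sum.inl (s : B)) * FreeAlgebra.ι ℂ (Sum.inr s)) 1
  | inv_mul (s : S) : LocRel S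
      (FreeAlgebra.ι ℂ (Sum.inr s) * FreeAlgebra.ι ℂ (Sum.inl (s : B))) 1

/-- The localization `B[S⁻¹]`: the universal algebra under `B` in which the elements of `S` are
invertible. (If the multiplicative set generated by `S` satisfies the Ore conditions, as it does
below, this is the ring of fractions, which has the same universal property.) -/
abbrev Loc (S : Set B) := RingQuot (LocRel S)

/-- The canonical homomorphism `B → B[S⁻¹]`. -/
def locMap (S : Set B) : B →ₐ[ℂ] Loc S :=
  { toFun := fun b => RingQuot.mkAlgHom ℂ (LocRel S) (FreeAlgebra.ι ℂ (Sum.inl b))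
    map_one' := by
      have h := RingQuot.mkAlgHom_rel ℂ (LocRel.scalar (S := S) 1)
      simpa only [map_one] using h
    map_mul' := fun a b => by
      simpa only [map_mul] using RingQuot.mkAlgHom_rel ℂ (LocRel.mul (S := S) a b)
    map_zero' := by
      have h := RingQuot.mkAlgHom_rel ℂ (LocRel.scalar (S := S) 0)
      simpa only [map_zero] using h
    map_add' := fun a b => by
      simpa only [map_add] using RingQuot.mkAlgHom_rel ℂ (LocRel.add (S := S) a b)
    commutes' := fun c => by
      have h := RingQuot.mkAlgHom_rel ℂ (LocRel.scalar (S := S) c)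
      simpa only [AlgHom.commutes] using h }

/-- The adjoined inverse of `s ∈ S`. -/
def locInv (S : Set B) (s : S) : Loc S :=
  RingQuot.mkAlgHom ℂ (LocRel S) (FreeAlgebra.ι ℂ (Sum.inr s))

theorem locMap_mul_locInv (S : Set B) (s : S) : locMap S s * locInv S s = 1 := by
  have h := RingQuot.mkAlgHom_rel ℂ (LocRel.mul_inv s)
  rwa [map_mul, map_one] at h

theorem locInv_mul_locMap (S : Set B) (s : S) : locInv S s * locMap S s = 1 := by
  have h := RingQuot.mkAlgHom_rel ℂ (LocRel.inv_mul s)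
  rwa [map_mul, map_one] at h

/-- The universal property of `B[S⁻¹]`. -/
def locLift (S : Set B) {C : Type*} [Ring C] [Algebra ℂ C] (f : B →ₐ[ℂ] C) (g : S → C)
    (h₁ : ∀ s : S, f s * g s = 1) (h₂ : ∀ s : S, g s * f s = 1) : Loc S →ₐ[ℂ] C :=
  RingQuot.liftAlgHom ℂ ⟨FreeAlgebra.lift ℂ (Sum.elim f g), by
    intro a b hab
    cases hab <;> simp [h₁, h₂]⟩

theorem locLift_locMap (S : Set B) {C : Type*} [Ring C] [Algebra ℂ C] (f : B →ₐ[ℂ] C) (g : S → C)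
    (h₁ : ∀ s : S, f s * g s = 1) (h₂ : ∀ s : S, g s * f s = 1) (b : B) :
    locLift S f g h₁ h₂ (locMap S b) = f b := by
  change locLift S f g h₁ h₂ (RingQuot.mkAlgHom ℂ (LocRel S) _) = _
  rw [locLift, RingQuot.liftAlgHom_mkAlgHom_apply]
  simp

end Loc

/-- `𝒜̄`: the localization of `𝒜` at the elements `h_α + k` of the diagonal Cartan subalgebra. -/
abbrev Abar (n : ℕ) := Loc (denoms n)

/-- The canonical homomorphism `𝒜 → 𝒜̄`. -/
abbrev toAbar (n : ℕ) : A n →ₐ[ℂ] Abar n := locMap (denoms n)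

/-- The diagonally embedded `e_ij` in `𝒜̄`. -/
def E (i j : Fin n) : Abar n := toAbar n (diagE i j)

/-! ### The localized Cartan algebra `Ū(h)` -/

/-- `U(h) = ℂ[h_1, …, h_n]`, where the variable `X i` is `h_i = e_ii`. -/
abbrev Uh (n : ℕ) := MvPolynomial (Fin n) ℂ

/-- `h̊_i = h_i - i` (the indices of `Fin n` start at `0`, whence the shift by `1`). -/
def hring (i : Fin n) : Uh n := MvPolynomial.X i - MvPolynomial.C (((i : ℕ) : ℂ) + 1)

/-- The multiplicative set generated by `h_α + k = h_i - h_j + k`, for `i ≠ j` and `k ∈ ℤ`. -/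
def K (n : ℕ) : Submonoid (Uh n) :=
  Submonoid.closure {p | ∃ (i j : Fin n) (k : ℤ), i ≠ j ∧
    p = MvPolynomial.X i - MvPolynomial.X j + MvPolynomial.C (k : ℂ)}

/-- `Ū(h)`: the ring of fractions of `U(h)` with denominators in `K`. -/
abbrev UhBar (n : ℕ) := Localization (K n)

theorem diagE_comm (i j : Fin n) : diagE i i * diagE j j = diagE j j * diagE i i := by
  have hw : (x i * d i) * (x j * d j) = (x j * d j) * (x i * d i) := by
    by_cases hij : i = j
    · rw [hij]
    · have h1 : d i * x j = x j * d i := by simpa [hij] using d_mul_x i j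
      have h2 : d j * x i = x i * d j := by simpa [Ne.symm hij] using d_mul_x j i
      calc (x i * d i) * (x j * d j) = x i * (d i * x j) * d j := by noncomm_ring
        _ = (x i * x j) * (d i * d j) := by rw [h1]; noncomm_ring
        _ = x j * (x i * d j) * d i := by rw [x_mul_x i j, d_mul_d i j]; noncomm_ring
        _ = (x j * d j) * (x i * d i) := by rw [← h2]; noncomm_ring
  have hu : e i i * e j j = e j j * e i i := by
    have h0 : ⁅(Matrix.single i i (1 : ℂ) : Gl n), (Matrix.single j j (1 : ℂ) : Gl n)⁆ = 0 := by
      rw [Ring.lie_def]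
      by_cases hij : i = j
      · subst hij; simp
      · simp [Matrix.single_mul_single_of_ne, hij, Ne.symm hij]
    have h1 := (UniversalEnvelopingAlgebra.ι ℂ : Gl n →ₗ⁅ℂ⁆ Ugl n).map_lie
      (Matrix.single i i (1 : ℂ)) (Matrix.single j j (1 : ℂ))
    rw [h0, map_zero, Ring.lie_def] at h1
    exact sub_eq_zero.mp h1.symm
  simp only [diagE, add_mul, mul_add, Algebra.TensorProduct.tmul_mul_tmul, one_mul, mul_one,
    hw, hu]
  abel

/-- The double commutant of the diagonal `h_1, …, h_n` in `𝒜̄`: a commutative subalgebra that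
contains the `h_i` and the inverses of all `h_α + k`. It is only used to construct `uhMap`. -/
def cartan (n : ℕ) : Subalgebra ℂ (Abar n) :=
  Subalgebra.centralizer ℂ (Set.centralizer (Set.range fun i : Fin n => E i i))

instance cartanCommRing (n : ℕ) : CommRing (cartan n) :=
  { (inferInstance : Ring (cartan n)) with
    mul_comm := fun a b => Subtype.ext <| by
      refine Set.centralizer_centralizer_comm_of_comm
        (S := Set.range fun i : Fin n => (E i i : Abar n)) ?_ a a.2 b b.2
      rintro _ ⟨i, rfl⟩ _ ⟨j, rfl⟩
      change E i i * E j j = E j j * E i i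
      rw [E, E, ← map_mul, ← map_mul, diagE_comm] }

/-- `h_i` as an element of the commutative subalgebra `cartan n`. -/
def cartanH (i : Fin n) : cartan n :=
  ⟨E i i, Set.subset_centralizer_centralizer ⟨i, rfl⟩⟩

/-- `U(h) → 𝒜̄`, `h_i ↦ e_ii`, corestricted to `cartan n`. -/
def uhToCartan (n : ℕ) : Uh n →ₐ[ℂ] cartan n :=
  @MvPolynomial.aeval ℂ (cartan n) (Fin n) _ _ (cartan n).algebra cartanH

theorem isUnit_uhToCartan (n : ℕ) (p : K n) : IsUnit (uhToCartan n p) := by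
  obtain ⟨p, hp⟩ := p
  change IsUnit (uhToCartan n p)
  unfold K at hp
  induction hp using Submonoid.closure_induction with
  | one => rw [map_one]; exact isUnit_one
  | mul a b _ _ ha hb => rw [map_mul]; exact ha.mul hb
  | mem p hp =>
    obtain ⟨i, j, k, hij, rfl⟩ := hp
    have hs : diagE i i - diagE j j + algebraMap ℂ (A n) (k : ℂ) ∈ denoms n :=
      ⟨i, j, k, hij, rfl⟩
    have hval : ((uhToCartan n (MvPolynomial.X i - MvPolynomial.X j + MvPolynomial.C (k : ℂ)) :
        cartan n) : Abar n) = locMap (denoms n) (⟨_, hs⟩ : denoms n) := by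
      have h3 : uhToCartan n (MvPolynomial.C (k : ℂ)) = algebraMap ℂ (cartan n) (k : ℂ) :=
        (uhToCartan n).commutes (k : ℂ)
      have h4 : ∀ l, uhToCartan n (MvPolynomial.X l) = cartanH l := fun l =>
        @MvPolynomial.aeval_X ℂ (cartan n) (Fin n) _ _ (cartan n).algebra cartanH l
      rw [map_add, map_sub, h3, h4, h4, map_add, map_sub, AlgHom.commutes]
      rfl
    have h1 := locMap_mul_locInv (denoms n) ⟨_, hs⟩
    have h2 := locInv_mul_locMap (denoms n) ⟨_, hs⟩
    rw [← hval] at h1 h2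
    set a := uhToCartan n (MvPolynomial.X i - MvPolynomial.X j + MvPolynomial.C (k : ℂ))
    set b := locInv (denoms n) ⟨_, hs⟩
    have hb : b ∈ cartan n := by
      change b ∈ Set.centralizer _
      intro c hc
      have hac : c * (a : Abar n) = a * c := a.2 c hc
      calc c * b = b * a * (c * b) := by rw [h2, one_mul]
        _ = b * (a * c) * b := by noncomm_ring
        _ = b * c * (a * b) := by rw [← hac]; noncomm_ring
        _ = b * c := by rw [h1, mul_one]
    exact isUnit_iff_exists_inv.mpr ⟨⟨b, hb⟩, Subtype.ext h1⟩

/-- The natural homomorphism `Ū(h) → 𝒜̄`, `h_i ↦ e_ii` (diagonally embedded). -/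
def uhMap (n : ℕ) : UhBar n →+* Abar n :=
  (cartan n).val.toRingHom.comp (IsLocalization.lift (isUnit_uhToCartan n))

theorem uhMap_X (i : Fin n) :
    uhMap n (algebraMap (Uh n) (UhBar n) (MvPolynomial.X i)) = E i i := by
  change ((IsLocalization.lift (isUnit_uhToCartan n) _ : cartan n) : Abar n) = _
  rw [IsLocalization.lift_eq]
  exact congrArg Subtype.val
    (@MvPolynomial.aeval_X ℂ (cartan n) (Fin n) _ _ (cartan n).algebra cartanH i)

/-! ### The anti-involution `ε` -/

open MulOpposite in
/-- `ε(xⁱ) = ∂ᵢ`, `ε(∂ᵢ) = xⁱ` on `Diff(n)`, as a homomorphism to the opposite algebra. -/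
def epsDiff (n : ℕ) : Diff n →ₐ[ℂ] (Diff n)ᵐᵒᵖ :=
  RingQuot.liftAlgHom ℂ
    ⟨FreeAlgebra.lift ℂ (Sum.elim (fun i => op (d i)) (fun i => op (x i))), by
      intro a b hab
      cases hab with
      | xx i j => simp [← op_mul, d_mul_d i j]
      | dd i j => simp [← op_mul, x_mul_x i j]
      | dx i j =>
        have h := d_mul_x j i
        by_cases hij : i = j
        · subst hij
          simp only [if_true] at h
          simp [← op_mul, h]
        · rw [if_neg (Ne.symm hij)] at h
          simp [← op_mul, h, hij]⟩

theorem epsDiff_x (i : Fin n) : epsDiff n (x i) = MulOpposite.op (d i) := by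
  rw [epsDiff, x, RingQuot.liftAlgHom_mkAlgHom_apply]; simp

theorem epsDiff_d (i : Fin n) : epsDiff n (d i) = MulOpposite.op (x i) := by
  rw [epsDiff, d, RingQuot.liftAlgHom_mkAlgHom_apply]; simp

open MulOpposite in
/-- The Cartan anti-involution `ε(e_ij) = e_ji` of `U(gl_n)`. -/
def epsU (n : ℕ) : Ugl n →ₐ[ℂ] (Ugl n)ᵐᵒᵖ :=
  UniversalEnvelopingAlgebra.lift ℂ
    { toFun := fun M => op (UniversalEnvelopingAlgebra.ι ℂ (M.transpose : Gl n))
      map_add' := fun M N => by simp [Matrix.transpose_add]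
      map_smul' := fun c M => by simp [Matrix.transpose_smul]
      map_lie' := fun {M N} => by
        have h : (⁅M, N⁆ : Gl n).transpose = ⁅N.transpose, M.transpose⁆ := by
          simp [Ring.lie_def, Matrix.transpose_mul, Matrix.transpose_sub]
        rw [h, LieHom.map_lie, Ring.lie_def, Ring.lie_def, op_sub, op_mul, op_mul] }

theorem epsU_e (i j : Fin n) : epsU n (e i j) = MulOpposite.op (e j i) := by
  rw [epsU, e, UniversalEnvelopingAlgebra.lift_ι_apply]
  simp [e]

/-- The anti-involution `ε` of `𝒜 = Diff(n) ⊗ U(gl_n)`. -/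
def epsA (n : ℕ) : A n →ₐ[ℂ] (A n)ᵐᵒᵖ :=
  (Algebra.TensorProduct.opAlgEquiv ℂ ℂ (Diff n) (Ugl n)).toAlgHom.comp
    (Algebra.TensorProduct.map (epsDiff n) (epsU n))

theorem epsA_diagE (i j : Fin n) : epsA n (diagE i j) = MulOpposite.op (diagE j i) := by
  simp [epsA, diagE, epsDiff_x, epsDiff_d, epsU_e, ← MulOpposite.op_mul]

theorem epsA_denoms (s : denoms n) : epsA n s = MulOpposite.op (s : A n) := by
  obtain ⟨_, i, j, k, _, rfl⟩ := s
  rw [map_add, map_sub, epsA_diagE, epsA_diagE, AlgHom.commutes]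
  rfl

open MulOpposite in
/-- The anti-involution `ε` of `𝒜̄`, as a homomorphism to the opposite algebra. -/
def epsAbarOp (n : ℕ) : Abar n →ₐ[ℂ] (Abar n)ᵐᵒᵖ :=
  locLift (denoms n) ((AlgHom.op (toAbar n)).comp (epsA n))
    (fun s => op (locInv (denoms n) s))
    (fun s => by
      have h : (AlgHom.op (toAbar n)).comp (epsA n) s = op (locMap (denoms n) s) := by
        simp [epsA_denoms]
      rw [h, ← op_mul, locInv_mul_locMap, op_one])
    (fun s => by
      have h : (AlgHom.op (toAbar n)).comp (epsA n) s = op (locMap (denoms n) s) := by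
        simp [epsA_denoms]
      rw [h, ← op_mul, locMap_mul_locInv, op_one])

/-- The anti-involution `ε` of `𝒜̄`, as a linear map. -/
def eps (n : ℕ) : Abar n →ₗ[ℂ] Abar n :=
  (MulOpposite.opLinearEquiv ℂ).symm.toLinearMap ∘ₗ (epsAbarOp n).toLinearMap

theorem eps_mul (a b : Abar n) : eps n (a * b) = eps n b * eps n a := by
  simp [eps]

theorem eps_E (i j : Fin n) : eps n (E i j) = E j i := by
  simp [eps, epsAbarOp, E, toAbar, locLift_locMap, epsA_diagE]

/-! ### The double coset algebra -/

/-- The left ideal `J̄₊ = 𝒜̄ n₊`; `n₊` is spanned by the diagonal `e_ij`, `i < j`. -/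
def Jplus (n : ℕ) : Submodule ℂ (Abar n) :=
  Submodule.span ℂ {b | ∃ (a : Abar n) (i j : Fin n), i < j ∧ b = a * E i j}

/-- The right ideal `J̄₋ = n₋ 𝒜̄`; `n₋` is spanned by the diagonal `e_ij`, `i > j`. -/
def Jminus (n : ℕ) : Submodule ℂ (Abar n) :=
  Submodule.span ℂ {b | ∃ (a : Abar n) (i j : Fin n), j < i ∧ b = E i j * a}

/-- The double coset space `Z̄ = 𝒜̄ / (J̄₋ + J̄₊)`; with the product `dia` below it is the algebra of
`h`-differential operators. -/
abbrev Zbar (n : ℕ) := Abar n ⧸ (Jminus n ⊔ Jplus n)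

/-- The projection `𝒜̄ → Z̄`. -/
def toZ (n : ℕ) : Abar n →ₗ[ℂ] Zbar n := (Jminus n ⊔ Jplus n).mkQ

/-- `b` lies in the normalizer of the left ideal `J̄₊`. -/
def NormPlus (b : Abar n) : Prop := ∀ c ∈ Jplus n, c * b ∈ Jplus n

/-- `a` lies in the normalizer of the right ideal `J̄₋`. -/
def NormMinus (a : Abar n) : Prop := ∀ c ∈ Jminus n, a * c ∈ Jminus n

/-- `IsDia u v w`: the double coset `w` is the product `u ⋄ v`, computed as the class of `a * b`
for representatives `a`, `b` of `u`, `v` such that `b` normalizes `J̄₊` or `a` normalizes `J̄₋`.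
With the extremal projector `P`, this is the class of `a P b`, because `P b ≡ b` modulo `J̄₊` for `b`
in the normalizer of `J̄₊`, and `a P ≡ a` modulo `J̄₋` for `a` in the normalizer of `J̄₋`. -/
def IsDia (u v w : Zbar n) : Prop :=
  ∃ a b : Abar n, toZ n a = u ∧ toZ n b = v ∧ (NormPlus b ∨ NormMinus a) ∧ toZ n (a * b) = w

open Classical in
/-- The multiplication `⋄` of `Z̄`. (Every double coset has representatives in both normalizers, and
the product does not depend on their choice, so the second branch never occurs.) -/
def dia (u v : Zbar n) : Zbar n := if h : ∃ w, IsDia u v w then h.choose else 0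

theorem eps_mem (a : Abar n) (ha : a ∈ Jminus n ⊔ Jplus n) : eps n a ∈ Jminus n ⊔ Jplus n := by
  have h1 : Jminus n ≤ (Jplus n).comap (eps n) := by
    refine Submodule.span_le.mpr ?_
    rintro _ ⟨b, i, j, hij, rfl⟩
    refine Submodule.subset_span ⟨eps n b, j, i, hij, ?_⟩
    rw [eps_mul, eps_E]
  have h2 : Jplus n ≤ (Jminus n).comap (eps n) := by
    refine Submodule.span_le.mpr ?_
    rintro _ ⟨b, i, j, hij, rfl⟩
    refine Submodule.subset_span ⟨eps n b, j, i, hij, ?_⟩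
    rw [eps_mul, eps_E]
  have h3 : Jminus n ⊔ Jplus n ≤ (Jminus n ⊔ Jplus n).comap (eps n) :=
    sup_le (h1.trans (Submodule.comap_mono le_sup_right))
      (h2.trans (Submodule.comap_mono le_sup_left))
  exact h3 ha

/-- The anti-involution `ε` of `Z̄`. -/
def epsZ (n : ℕ) : Zbar n →ₗ[ℂ] Zbar n :=
  (Jminus n ⊔ Jplus n).mapQ (Jminus n ⊔ Jplus n) (eps n) eps_mem

/-- `:D:`, the image in `Z̄` of a polynomial differential operator `D`. -/
def colon (D : Diff n) : Zbar n := toZ n (toAbar n (D ⊗ₜ[ℂ] (1 : Ugl n)))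

/-- The natural map `Ū(h) → Z̄`. -/
def ofUh (c : UhBar n) : Zbar n := toZ n (uhMap n c)

/-- The left ideal `I_∂ = Z̄ ⋄ {∂_1, …, ∂_n}`. -/
def Idel (n : ℕ) : Submodule ℂ (Zbar n) :=
  Submodule.span ℂ {w | ∃ (z : Zbar n) (i : Fin n), w = dia z (colon (d i))}

/-- The right ideal `I_x = {x^1, …, x^n} ⋄ Z̄`. -/
def Ix (n : ℕ) : Submodule ℂ (Zbar n) :=
  Submodule.span ℂ {w | ∃ (z : Zbar n) (i : Fin n), w = dia (colon (x i)) z}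

/-! ### The module `P_h(n)` and its contravariant form -/

/-- `P_h(n) = Z̄ / I_∂`. -/
abbrev Ph (n : ℕ) := Zbar n ⧸ Idel n

/-- The projection `Z̄ → P_h(n)`. -/
def toPh (n : ℕ) : Zbar n →ₗ[ℂ] Ph n := (Idel n).mkQ

/-- `IsFormValue u v c`: `c = (ε(z) ⋄ w)⁽⁰⁾` for some representatives `z`, `w` of `u`, `v`, where
`y⁽⁰⁾`, the Harish-Chandra image of `y`, is the element of `Ū(h)` with `y - y⁽⁰⁾ ∈ I_∂ + I_x`. -/
def IsFormValue (u v : Ph n) (c : UhBar n) : Prop :=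
  ∃ z w : Zbar n, toPh n z = u ∧ toPh n w = v ∧ dia (epsZ n z) w - ofUh c ∈ Idel n ⊔ Ix n

open Classical in
/-- The `Ū(h)`-valued contravariant form `(u, v) = (ε(u) ⋄ v)⁽⁰⁾` on `P_h(n)`. (The value exists and
does not depend on the representatives, so the second branch never occurs.) -/
def form (u v : Ph n) : UhBar n := if h : ∃ c, IsFormValue u v c then h.choose else 0

/-- The monomial `(x^1)^{ν_1} ⋯ (x^n)^{ν_n}` in `Diff(n)`. -/
def mono (ν : Fin n → ℕ) : Diff n := (List.ofFn fun i => x i ^ ν i).prod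

/-- The image of `:x^ν:` in `P_h(n)`. -/
def monoPh (ν : Fin n → ℕ) : Ph n := toPh n (colon (mono ν))

/-! ### The scalar products -/

/-- The rising factorial `p^{↑m} = p (p + 1) ⋯ (p + m - 1)` in `U(h)`. -/
def rise (p : Uh n) (m : ℕ) : Uh n := (ascPochhammer (Uh n) m).eval p

theorem rise_mem_K {i j : Fin n} (hij : i ≠ j) (m : ℕ) : rise (hring i - hring j) m ∈ K n := by
  induction m with
  | zero => simp [rise]
  | succ m ih =>
    have h : rise (hring i - hring j) (m + 1)
        = rise (hring i - hring j) m * (hring i - hring j + (m : Uh n)) := by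
      simp [rise, ascPochhammer_succ_eval]
    rw [h]
    refine (K n).mul_mem ih (Submonoid.subset_closure ⟨i, j, (j : ℤ) - (i : ℤ) + m, hij, ?_⟩)
    simp only [hring]
    push_cast
    simp only [map_add, map_sub, map_natCast, map_one]
    ring

/-- The pairs `i < j`. -/
abbrev Pairs (n : ℕ) := {p : Fin n × Fin n // p.1 < p.2}

/-- The fraction `(h̊_ij - ν_j)^{↑ ν_i + 1} / h̊_ij^{↑ ν_i + 1}` of `Ū(h)`, for `i < j`. -/
def factor (ν : Fin n → ℕ) (p : Pairs n) : UhBar n :=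
  Localization.mk
    (rise (hring p.1.1 - hring p.1.2 - (ν p.1.2 : Uh n)) (ν p.1.1 + 1))
    ⟨rise (hring p.1.1 - hring p.1.2) (ν p.1.1 + 1), rise_mem_K p.2.ne _⟩

/-- `μ ∈ h*`, given by `μ i = μ(h_i)`, is generic: `μ(h_α) ∉ ℤ` for every root `α`. -/
def Generic (μ : Fin n → ℂ) : Prop := ∀ i j : Fin n, i ≠ j → ∀ k : ℤ, μ i - μ j ≠ (k : ℂ)

theorem isUnit_eval {μ : Fin n → ℂ} (hμ : Generic μ) (p : K n) :
    IsUnit (MvPolynomial.eval μ (p : Uh n)) := by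
  obtain ⟨p, hp⟩ := p
  change IsUnit (MvPolynomial.eval μ p)
  unfold K at hp
  induction hp using Submonoid.closure_induction with
  | one => simp
  | mul a b _ _ ha hb => rw [map_mul]; exact ha.mul hb
  | mem p hp =>
    obtain ⟨i, j, k, hij, rfl⟩ := hp
    simp only [map_add, map_sub, MvPolynomial.eval_X, MvPolynomial.eval_C, isUnit_iff_ne_zero]
    intro h
    refine hμ i j hij (-k) ?_
    push_cast
    linear_combination h

/-- The evaluation `f ↦ f(μ)` of elements of `Ū(h)` at a generic point `μ ∈ h*`. -/
def evalAt {μ : Fin n → ℂ} (hμ : Generic μ) : UhBar n →+* ℂ :=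
  IsLocalization.lift (M := K n) (isUnit_eval hμ)

end HDiff

end

open scoped TensorProduct

noncomputable section

namespace HDiff

attribute [local instance] LieRing.ofAssociativeRing

variable {n : ℕ}

/-! ### Relations in the localized algebra -/

/-! The proof rests on explicit representatives in the normalizers, a vacuum functional, and a
one-step recursion for the norms.

Normalizers. The `∂_k` form a covector for `gl_n`, and so do the contractions `(∂ Eᵐ)_k` with the
matrix `E = (E_ij)`. Modulo `J̄₋`, contraction with `E` is triangular with diagonal entries `t_q =
h_q + n - q` (`q` counted from 0). By a triangular form of Cayley-Hamilton, the product of the `E -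
t_j` over `j < k` sends all components below `k` into `J̄₋`. The `k`-th component, divided by
`∏_{j<k} (t_k - t_j)`, therefore normalizes `J̄₋`, and it is congruent to `∂_k` modulo `J̄₋ + J̄₊`
(`covNorm`). The vector `x` becomes a covector after the automorphism `E_ij ↦ -E_{j'i'}`, with
primes reversing the order of the indices, and `ε` carries everything over to `J̄₊`. Since `𝒜̄` is
spanned by `J̄₋`, `J̄₊` and `Diff(n) Ū(h)`, every double coset has representatives in both
normalizers. Hence `⋄` is well defined, bilinear and associative, and no extremal projector is
needed.

Vacuum functional. `𝒜̄` acts on polynomials in `xⁱ` and in the coordinates of a unipotent upper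
triangular matrix: a dual Verma module with universal highest weight, tensored with the polynomial
representation of `Diff(n)`. The constant coefficient of `a · 1` is zero on `J̄₋`, `J̄₊` and on the
preimages of `I_∂`, `I_x`, and it recovers `c` from the image of `c ∈ Ū(h)`. Normal ordering gives
the existence of `y⁽⁰⁾` and this functional computes it, so the form is the vacuum value of `ε(u) ⋄
v` (`form_toPh`).

Norms. Monomials of different weights are orthogonal. If `σ` vanishes beyond `k`, then `xᵏ ⋄ :x^σ: =
:x^{σ+e_k}:`, so by adjointness the norm of `x^{σ+e_k}` is obtained from `∂_k ⋄ :x^{σ+e_k}:`. On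
monomials the covectors `∂ Eᵐ` act by scalars with a triangular linear recursion. An explicit
eigenvector solves it and yields the coefficient `(σ_k+1) ∏_{i<k} (1 + (σ_i+1)/(t_k - t_i))` of
`:x^σ:` modulo `I_∂`. Under the shift `h ↦ h + σ` the `i`-th factor becomes `(h̊_ik - σ_k -
1)/(h̊_ik + σ_i - σ_k)`, which is the quotient of the two corresponding factors in the asserted
product. -/

/-- The variable `xⁱ` in `𝒜̄`. -/
def xb (i : Fin n) : Abar n := toAbar n (x i ⊗ₜ[ℂ] (1 : Ugl n))

/-- The derivation `∂ᵢ` in `𝒜̄`. -/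
def db (i : Fin n) : Abar n := toAbar n (d i ⊗ₜ[ℂ] (1 : Ugl n))

theorem e_lie (i j k l : Fin n) : e i j * e k l - e k l * e i j
    = (if j = k then e i l else 0) - (if i = l then e k j else 0) := by
  have h := (UniversalEnvelopingAlgebra.ι ℂ : Gl n →ₗ⁅ℂ⁆ Ugl n).map_lie
    (Matrix.single i j (1 : ℂ)) (Matrix.single k l (1 : ℂ))
  rw [Ring.lie_def, Ring.lie_def, map_sub] at h
  have h1 : ∀ a b c f : Fin n, (UniversalEnvelopingAlgebra.ι ℂ : Gl n →ₗ⁅ℂ⁆ Ugl n)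
      (Matrix.single a b (1 : ℂ) * Matrix.single c f (1 : ℂ)) = if b = c then e a f else 0 := by
    intro a b c f
    split_ifs with hbc
    · subst hbc; simp [e]
    · rw [Matrix.single_mul_single_of_ne (h := hbc), map_zero]
  rw [h1, h1] at h
  rw [e, e, ← h]
  simp [eq_comm]

theorem weyl_lie (i j k l : Fin n) : (x i * d j) * (x k * d l) - (x k * d l) * (x i * d j)
    = (if j = k then x i * d l else 0) - (if i = l then x k * d j else 0) := by
  have h1 : (x i * d j) * (x k * d l) = x i * (d j * x k) * d l := by simp only [mul_assoc]
  have h2 : (x k * d l) * (x i * d j) = x k * (d l * x i) * d j := by simp only [mul_assoc]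
  have h3 : x i * (x k * d j) * d l = x k * (x i * d l) * d j := by
    simp only [mul_assoc]
    rw [← mul_assoc, x_mul_x, d_mul_d, mul_assoc]
  rw [h1, h2, d_mul_x, d_mul_x, mul_add, add_mul, mul_add, add_mul, h3]
  simp only [@eq_comm _ i l]
  by_cases hjk : j = k <;> by_cases hli : l = i <;> simp [hjk, hli]

theorem diagE_lie (i j k l : Fin n) : diagE i j * diagE k l - diagE k l * diagE i j
    = (if j = k then diagE i l else 0) - (if i = l then diagE k j else 0) := by
  have h : diagE i j * diagE k l - diagE k l * diagE i j
      = ((x i * d j) * (x k * d l) - (x k * d l) * (x i * d j)) ⊗ₜ[ℂ] (1 : Ugl n)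
        + (1 : Diff n) ⊗ₜ[ℂ] (e i j * e k l - e k l * e i j) := by
    simp only [diagE, add_mul, mul_add, Algebra.TensorProduct.tmul_mul_tmul, one_mul, mul_one,
      TensorProduct.sub_tmul, TensorProduct.tmul_sub]
    abel
  rw [h, weyl_lie, e_lie]
  split_ifs <;> simp [diagE, TensorProduct.sub_tmul, TensorProduct.tmul_sub,
    TensorProduct.neg_tmul, TensorProduct.tmul_neg] <;> abel

theorem E_lie (i j k l : Fin n) : E i j * E k l - E k l * E i j
    = (if j = k then E i l else 0) - (if i = l then E k j else 0) := by
  have h := congrArg (toAbar n) (diagE_lie i j k l)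
  simp only [map_sub, map_mul] at h
  rw [E, E, h]
  split_ifs <;> simp [E]

theorem E_mul_xb (i j k : Fin n) :
    E i j * xb k = xb k * E i j + if j = k then xb i else 0 := by
  have h : diagE i j * (x k ⊗ₜ[ℂ] (1 : Ugl n))
      = (x k ⊗ₜ[ℂ] (1 : Ugl n)) * diagE i j + if j = k then x i ⊗ₜ[ℂ] (1 : Ugl n) else 0 := by
    simp only [diagE, add_mul, mul_add, Algebra.TensorProduct.tmul_mul_tmul, one_mul, mul_one]
    rw [mul_assoc, d_mul_x, mul_add, ← mul_assoc, x_mul_x, mul_assoc]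
    split_ifs <;> simp [TensorProduct.add_tmul] ; abel
  have h' := congrArg (toAbar n) h
  rw [map_mul, map_add, map_mul] at h'
  rw [E, xb, h']
  split_ifs <;> simp [xb]

theorem E_mul_db (i j k : Fin n) :
    E i j * db k = db k * E i j - if i = k then db j else 0 := by
  have h : diagE i j * (d k ⊗ₜ[ℂ] (1 : Ugl n))
      = (d k ⊗ₜ[ℂ] (1 : Ugl n)) * diagE i j - if i = k then d j ⊗ₜ[ℂ] (1 : Ugl n) else 0 := by
    simp only [diagE, add_mul, mul_add, Algebra.TensorProduct.tmul_mul_tmul, one_mul, mul_one]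
    rw [← mul_assoc, d_mul_x, add_mul, mul_assoc, mul_assoc, d_mul_d]
    by_cases hik : i = k
    · subst hik; simp [TensorProduct.add_tmul]; abel
    · simp [hik, Ne.symm hik]
  have h' := congrArg (toAbar n) h
  rw [map_mul, map_sub, map_mul] at h'
  rw [E, db, h']
  split_ifs <;> simp [db]

theorem xb_mul_xb (i j : Fin n) : xb i * xb j = xb j * xb i := by
  simp only [xb, ← map_mul, Algebra.TensorProduct.tmul_mul_tmul, x_mul_x i j]

theorem db_mul_xb (i j : Fin n) : db i * xb j = xb j * db i + if i = j then 1 else 0 := by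
  simp only [xb, db, ← map_mul, Algebra.TensorProduct.tmul_mul_tmul, d_mul_x i j, mul_one,
    TensorProduct.add_tmul, map_add]
  split_ifs
  · rw [← Algebra.TensorProduct.one_def, map_one]
  · simp

/-! ### The image of `Ū(h)` -/

theorem uhMap_C (c : ℂ) :
    uhMap n (algebraMap (Uh n) (UhBar n) (MvPolynomial.C c)) = algebraMap ℂ (Abar n) c := by
  change ((IsLocalization.lift (isUnit_uhToCartan n) _ : cartan n) : Abar n) = _
  rw [IsLocalization.lift_eq]
  exact congrArg Subtype.val ((uhToCartan n).commutes c)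

theorem uhMap_algebraMap (c : ℂ) : uhMap n (algebraMap ℂ (UhBar n) c) = algebraMap ℂ _ c := by
  rw [← uhMap_C]; rfl

theorem uhMap_comm (a b : UhBar n) : uhMap n a * uhMap n b = uhMap n b * uhMap n a := by
  rw [← map_mul, mul_comm, map_mul]

/-- The elements `h_i - h_j + k` are units of `Ū(h)`. -/
theorem isUnit_root {i j : Fin n} (hij : i ≠ j) (k : ℤ) :
    IsUnit (algebraMap (Uh n) (UhBar n) (MvPolynomial.X i) - algebraMap (Uh n) (UhBar n)
      (MvPolynomial.X j) + (k : UhBar n)) := by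
  have h : MvPolynomial.X i - MvPolynomial.X j + MvPolynomial.C (k : ℂ) ∈ K n :=
    Submonoid.subset_closure ⟨i, j, k, hij, rfl⟩
  have h2 := IsLocalization.map_units (UhBar n) (⟨_, h⟩ : K n)
  simpa using h2

/-- The denominator is already invertible in `Ū(h)`, and inverses are unique. Hence `Ū(h)` supplies
all the adjoined inverses among the generators of `𝒜̄`. -/
theorem locInv_mem_range (s : denoms n) : ∃ c, uhMap n c = locInv (denoms n) s := by
  obtain ⟨_, i, j, k, hij, rfl⟩ := s
  obtain ⟨c, hc⟩ := (isUnit_root hij k).exists_left_inv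
  refine ⟨c, ?_⟩
  have h := congrArg (uhMap n) hc
  rw [map_mul, map_add, map_sub, uhMap_X, uhMap_X, map_one] at h
  have h2 : uhMap n c * locMap (denoms n) (diagE i i - diagE j j + algebraMap ℂ (A n) (k : ℂ))
      = 1 := by
    rw [← h]; simp [E, map_sub, map_add]
  refine left_inv_eq_right_inv h2 (locMap_mul_locInv (denoms n) ⟨_, i, j, k, hij, rfl⟩)

/-! ### Generation -/

theorem Diff_adjoin : Algebra.adjoin ℂ (Set.range x ∪ Set.range d : Set (Diff n)) = ⊤ := by
  rw [eq_top_iff]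
  rintro a -
  obtain ⟨a, rfl⟩ := RingQuot.mkAlgHom_surjective ℂ (WeylRel n) a
  induction a using FreeAlgebra.induction with
  | grade0 r => rw [AlgHom.commutes]; exact Subalgebra.algebraMap_mem _ _
  | grade1 y =>
    rcases y with i | i
    · exact Algebra.subset_adjoin (Or.inl ⟨i, rfl⟩)
    · exact Algebra.subset_adjoin (Or.inr ⟨i, rfl⟩)
  | mul a b ha hb => rw [map_mul]; exact mul_mem ha hb
  | add a b ha hb => rw [map_add]; exact add_mem ha hb

/-- The map from `gl_n` into `S` lifts to `U(gl_n)`, and the lift followed by the inclusion of `S`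
agrees with the identity on `gl_n`, hence everywhere. -/
theorem Ugl_mem {S : Subalgebra ℂ (Ugl n)} (h : ∀ i j, e i j ∈ S) (u : Ugl n) : u ∈ S := by
  have hι : ∀ M : Gl n, UniversalEnvelopingAlgebra.ι ℂ M ∈ S := by
    intro M
    rw [Matrix.matrix_eq_sum_single M, map_sum]
    refine sum_mem fun i _ => ?_
    rw [map_sum]
    refine sum_mem fun j _ => ?_
    have : Matrix.single i j (M i j) = M i j • (Matrix.single i j (1 : ℂ) : Gl n) := by simp
    rw [this, map_smul]
    exact S.smul_mem (h i j) _
  let f : Gl n →ₗ⁅ℂ⁆ S :=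
    { toFun := fun M => ⟨_, hι M⟩
      map_add' := fun M N => by ext; simp
      map_smul' := fun c M => by ext; simp
      map_lie' := fun {M N} => by
        ext; exact LieHom.map_lie _ M N }
  have hf : S.val.comp (UniversalEnvelopingAlgebra.lift ℂ f) = AlgHom.id ℂ _ := by
    apply UniversalEnvelopingAlgebra.hom_ext
    ext M
    simp [f]
  have := congrArg (fun g => g u) hf
  simp only [AlgHom.comp_apply, AlgHom.id_apply] at this
  rw [← this]
  exact Subtype.property _

/-- `𝒜̄` is generated by `xⁱ`, `∂ᵢ`, the diagonal `e_ij` and `Ū(h)`. -/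
theorem Abar_mem {S : Subalgebra ℂ (Abar n)} (hx : ∀ i, xb i ∈ S) (hd : ∀ i, db i ∈ S)
    (hE : ∀ i j, E i j ∈ S) (hc : ∀ c, uhMap n c ∈ S) (a : Abar n) : a ∈ S := by
  have hD : ∀ D : Diff n, toAbar n (D ⊗ₜ[ℂ] (1 : Ugl n)) ∈ S := by
    intro D
    have : D ∈ Algebra.adjoin ℂ (Set.range x ∪ Set.range d : Set (Diff n)) := by
      rw [Diff_adjoin]; trivial
    refine (Algebra.adjoin_le (S := S.comap ((toAbar n).comp
      (Algebra.TensorProduct.includeLeft : Diff n →ₐ[ℂ] A n))) ?_) this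
    rintro _ (⟨i, rfl⟩ | ⟨i, rfl⟩)
    · exact hx i
    · exact hd i
  have hU : ∀ u : Ugl n, toAbar n ((1 : Diff n) ⊗ₜ[ℂ] u) ∈ S := by
    refine Ugl_mem (S := S.comap ((toAbar n).comp
      (Algebra.TensorProduct.includeRight : Ugl n →ₐ[ℂ] A n))) fun i j => ?_
    have h : toAbar n ((1 : Diff n) ⊗ₜ[ℂ] e i j) = E i j - xb i * db j := by
      rw [E, diagE, xb, db, ← map_mul, Algebra.TensorProduct.tmul_mul_tmul, mul_one, map_add]
      abel
    change toAbar n ((1 : Diff n) ⊗ₜ[ℂ] e i j) ∈ S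
    rw [h]; exact sub_mem (hE i j) (mul_mem (hx i) (hd j))
  have hA : ∀ b : A n, toAbar n b ∈ S := by
    intro b
    induction b using TensorProduct.induction_on with
    | zero => rw [map_zero]; exact zero_mem _
    | tmul D u =>
      have : D ⊗ₜ[ℂ] u = (D ⊗ₜ[ℂ] (1 : Ugl n)) * ((1 : Diff n) ⊗ₜ[ℂ] u) := by simp
      rw [this, map_mul]; exact mul_mem (hD D) (hU u)
    | add a b ha hb => rw [map_add]; exact add_mem ha hb
  obtain ⟨a, rfl⟩ := RingQuot.mkAlgHom_surjective ℂ (LocRel (denoms n)) a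
  induction a using FreeAlgebra.induction with
  | grade0 r => rw [AlgHom.commutes]; exact Subalgebra.algebraMap_mem _ _
  | grade1 y =>
    rcases y with b | s
    · exact hA b
    · obtain ⟨c, hs⟩ := locInv_mem_range s
      change locInv (denoms n) s ∈ S
      rw [← hs]; exact hc c
  | mul a b ha hb => rw [map_mul]; exact mul_mem ha hb
  | add a b ha hb => rw [map_add]; exact add_mem ha hb

/-! ### The anti-involution -/

theorem eps_xb (i : Fin n) : eps n (xb i) = db i := by
  simp [eps, epsAbarOp, xb, db, toAbar, locLift_locMap, epsA, epsDiff_x]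

theorem eps_db (i : Fin n) : eps n (db i) = xb i := by
  simp [eps, epsAbarOp, xb, db, toAbar, locLift_locMap, epsA, epsDiff_d]

theorem eps_algebraMap (c : ℂ) : eps n (algebraMap ℂ _ c) = algebraMap ℂ _ c := by
  simp [eps]

theorem eps_uhMap (c : UhBar n) : eps n (uhMap n c) = uhMap n c := by
  have h : (epsAbarOp n).toRingHom.comp (uhMap n)
      = (uhMap n).toOpposite (fun a b => uhMap_comm a b) := by
    refine IsLocalization.ringHom_ext (K n) (MvPolynomial.ringHom_ext (fun c => ?_) fun i => ?_)
    · have := eps_algebraMap (n := n) c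
      rw [← uhMap_C] at this
      exact MulOpposite.unop_injective this
    · have := eps_E i i
      rw [← uhMap_X] at this
      exact MulOpposite.unop_injective this
  exact congrArg MulOpposite.unop (RingHom.congr_fun h c)

theorem eps_one : eps n 1 = 1 := by simp [eps]

/-- The fixed points of `ε²` form a subalgebra, and it contains the generators. -/
theorem eps_eps (a : Abar n) : eps n (eps n a) = a := by
  let S : Subalgebra ℂ (Abar n) :=
    { carrier := {a | eps n (eps n a) = a}
      mul_mem' := fun {a b} ha hb => by
        simp only [Set.mem_ofPred_eq] at *; rw [eps_mul, eps_mul, ha, hb]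
      add_mem' := fun {a b} ha hb => by
        simp only [Set.mem_ofPred_eq] at *; rw [map_add, map_add, ha, hb]
      algebraMap_mem' := fun c => by
        simp only [Set.mem_ofPred_eq, eps_algebraMap] }
  refine Abar_mem (S := S) (fun i => ?_) (fun i => ?_) (fun i j => ?_) (fun c => ?_) a
  · change eps n (eps n _) = _; rw [eps_xb, eps_db]
  · change eps n (eps n _) = _; rw [eps_db, eps_xb]
  · change eps n (eps n _) = _; rw [eps_E, eps_E]
  · change eps n (eps n _) = _; rw [eps_uhMap, eps_uhMap]

/-! ### Weights -/

/-- `a` has weight `κ` under the adjoint action of the diagonal Cartan subalgebra. -/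
def HasWt (κ : Fin n → ℤ) (a : Abar n) : Prop := ∀ i, E i i * a = a * (E i i + (κ i : Abar n))

/-- The shift `h_i ↦ h_i + κ_i` of `U(h)`. -/
def shiftUh (κ : Fin n → ℤ) : Uh n →+* Uh n :=
  (MvPolynomial.aeval fun i => (MvPolynomial.X i + (κ i : Uh n))).toRingHom

theorem shiftUh_K (κ : Fin n → ℤ) : K n ≤ (K n).comap (shiftUh κ) := by
  refine Submonoid.closure_le.mpr ?_
  rintro _ ⟨i, j, k, hij, rfl⟩
  refine Submonoid.subset_closure ⟨i, j, k + κ i - κ j, hij, ?_⟩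
  simp only [shiftUh]
  simp
  ring

/-- The shift `h_i ↦ h_i + κ_i` of `Ū(h)`. -/
def shift (κ : Fin n → ℤ) : UhBar n →+* UhBar n :=
  IsLocalization.map (UhBar n) (shiftUh κ) (shiftUh_K κ)

theorem shift_X (κ : Fin n → ℤ) (i : Fin n) :
    shift κ (algebraMap (Uh n) (UhBar n) (MvPolynomial.X i))
      = algebraMap (Uh n) (UhBar n) (MvPolynomial.X i) + (κ i : UhBar n) := by
  rw [shift, IsLocalization.map_eq]
  simp [shiftUh]

theorem shift_C (κ : Fin n → ℤ) (c : ℂ) :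
    shift κ (algebraMap (Uh n) (UhBar n) (MvPolynomial.C c))
      = algebraMap (Uh n) (UhBar n) (MvPolynomial.C c) := by
  rw [shift, IsLocalization.map_eq]
  simp [shiftUh]

/-- Induction over `Ū(h)`. -/
theorem UhBar_induction {P : UhBar n → Prop} (hC : ∀ c, P (algebraMap (Uh n) _ (MvPolynomial.C c)))
    (hX : ∀ i, P (algebraMap (Uh n) _ (MvPolynomial.X i))) (hadd : ∀ a b, P a → P b → P (a + b))
    (hmul : ∀ a b, P a → P b → P (a * b))
    (hinv : ∀ a b, a * b = 1 → P a → P b) (c : UhBar n) : P c := by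
  have hp : ∀ p : Uh n, P (algebraMap (Uh n) (UhBar n) p) := by
    intro p
    induction p using MvPolynomial.induction_on with
    | C c => exact hC c
    | add p q hp hq => rw [map_add]; exact hadd _ _ hp hq
    | mul_X p i hp => rw [map_mul]; exact hmul _ _ hp (hX i)
  obtain ⟨p, q, rfl⟩ := IsLocalization.exists_mk'_eq (K n) c
  rw [IsLocalization.mk'_eq_mul_mk'_one]
  refine hmul _ _ (hp p) (hinv (algebraMap _ _ (q : Uh n)) _ ?_ (hp q))
  rw [mul_comm, IsLocalization.mk'_spec, map_one]

/-- The weight condition is the case `c = h_i`. It passes to an inverse by multiplying the relation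
for the original element with the inverse on the left and with the shifted inverse on the right. -/
theorem HasWt.uhMap_mul {κ : Fin n → ℤ} {a : Abar n} (h : HasWt κ a) (c : UhBar n) :
    uhMap n c * a = a * uhMap n (shift κ c) := by
  induction c using UhBar_induction with
  | hC c => rw [shift_C, uhMap_C]; exact Algebra.commutes c a
  | hX i => rw [shift_X, map_add, uhMap_X, map_intCast]; exact h i
  | hadd b c hb hc => rw [map_add, map_add, map_add, add_mul, mul_add, hb, hc]
  | hmul b c hb hc => rw [map_mul, map_mul, map_mul, mul_assoc, hc, ← mul_assoc, hb, mul_assoc]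
  | hinv b c hbc hb =>
    have h1 : uhMap n c * uhMap n b = 1 := by rw [← map_mul, mul_comm, hbc, map_one]
    have h2 : uhMap n (shift κ b) * uhMap n (shift κ c) = 1 := by
      rw [← map_mul, ← map_mul, hbc, map_one, map_one]
    calc uhMap n c * a = uhMap n c * (a * (uhMap n (shift κ b) * uhMap n (shift κ c))) := by
          rw [h2, mul_one]
      _ = uhMap n c * (uhMap n b * a) * uhMap n (shift κ c) := by rw [hb]; simp only [mul_assoc]
      _ = _ := by rw [← mul_assoc, h1, one_mul]

theorem hasWt_E (i j : Fin n) : HasWt (Pi.single i 1 - Pi.single j 1) (E i j) := by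
  intro k
  have h := E_lie k k i j
  rw [sub_eq_iff_eq_add] at h
  rw [h, mul_add, add_comm]
  congr 1
  rw [Pi.sub_apply, Int.cast_sub, mul_sub]
  congr 1
  · by_cases h1 : k = i
    · subst h1; rw [if_pos rfl, Pi.single_eq_same, Int.cast_one, mul_one]
    · rw [if_neg h1, Pi.single_eq_of_ne h1, Int.cast_zero, mul_zero]
  · by_cases h1 : k = j
    · subst h1; rw [if_pos rfl, Pi.single_eq_same, Int.cast_one, mul_one]
    · rw [if_neg h1, Pi.single_eq_of_ne h1, Int.cast_zero, mul_zero]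

theorem hasWt_xb (i : Fin n) : HasWt (Pi.single i 1) (xb i) := by
  intro k
  rw [E_mul_xb, mul_add]
  by_cases h1 : k = i <;> simp [h1]

theorem hasWt_db (i : Fin n) : HasWt (-Pi.single i 1) (db i) := by
  intro k
  rw [E_mul_db, mul_add, sub_eq_add_neg]
  congr 1
  rw [Pi.neg_apply]
  by_cases h1 : k = i
  · subst h1; rw [if_pos rfl, Pi.single_eq_same, Int.cast_neg, Int.cast_one]
    exact (mul_neg_one (db k)).symm
  · rw [if_neg h1, Pi.single_eq_of_ne h1, neg_zero, neg_zero, Int.cast_zero, mul_zero]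

theorem HasWt.mul {κ κ' : Fin n → ℤ} {a b : Abar n} (ha : HasWt κ a) (hb : HasWt κ' b) :
    HasWt (κ + κ') (a * b) := by
  intro i
  rw [← mul_assoc, ha i, mul_assoc, add_mul, hb i, (Int.cast_commute (κ i) b).eq, mul_assoc,
    ← mul_add]
  simp only [Pi.add_apply, Int.cast_add]
  congr 2; abel

theorem hasWt_one : HasWt (0 : Fin n → ℤ) 1 := by intro i; simp

/-! ### The ideals -/

theorem Jminus_mul {a : Abar n} (ha : a ∈ Jminus n) (b : Abar n) : a * b ∈ Jminus n := by
  have : Jminus n ≤ (Jminus n).comap (LinearMap.mulRight ℂ b) := by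
    refine Submodule.span_le.mpr ?_
    rintro _ ⟨a, i, j, hij, rfl⟩
    exact Submodule.subset_span ⟨a * b, i, j, hij, by simp [mul_assoc]⟩
  exact this ha

theorem mul_Jplus {a : Abar n} (ha : a ∈ Jplus n) (b : Abar n) : b * a ∈ Jplus n := by
  have : Jplus n ≤ (Jplus n).comap (LinearMap.mulLeft ℂ b) := by
    refine Submodule.span_le.mpr ?_
    rintro _ ⟨a, i, j, hij, rfl⟩
    exact Submodule.subset_span ⟨b * a, i, j, hij, by simp [mul_assoc]⟩
  exact this ha

theorem E_mul_mem_Jminus {i j : Fin n} (h : j < i) (a : Abar n) : E i j * a ∈ Jminus n :=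
  Submodule.subset_span ⟨a, i, j, h, rfl⟩

theorem mul_E_mem_Jplus {i j : Fin n} (h : i < j) (a : Abar n) : a * E i j ∈ Jplus n :=
  Submodule.subset_span ⟨a, i, j, h, rfl⟩

theorem uhMap_mul_Jminus {a : Abar n} (ha : a ∈ Jminus n) (c : UhBar n) :
    uhMap n c * a ∈ Jminus n := by
  have : Jminus n ≤ (Jminus n).comap (LinearMap.mulLeft ℂ (uhMap n c)) := by
    refine Submodule.span_le.mpr ?_
    rintro _ ⟨a, i, j, hij, rfl⟩
    change uhMap n c * (E i j * a) ∈ Jminus n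
    rw [← mul_assoc, (hasWt_E i j).uhMap_mul, mul_assoc]
    exact E_mul_mem_Jminus hij _
  exact this ha

theorem eps_Jplus {a : Abar n} (ha : a ∈ Jplus n) : eps n a ∈ Jminus n := by
  have : Jplus n ≤ (Jminus n).comap (eps n) := by
    refine Submodule.span_le.mpr ?_
    rintro _ ⟨b, i, j, hij, rfl⟩
    refine Submodule.subset_span ⟨eps n b, j, i, hij, ?_⟩
    rw [eps_mul, eps_E]
  exact this ha

theorem eps_Jminus {a : Abar n} (ha : a ∈ Jminus n) : eps n a ∈ Jplus n := by
  have : Jminus n ≤ (Jplus n).comap (eps n) := by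
    refine Submodule.span_le.mpr ?_
    rintro _ ⟨b, i, j, hij, rfl⟩
    refine Submodule.subset_span ⟨eps n b, j, i, hij, ?_⟩
    rw [eps_mul, eps_E]
  exact this ha

theorem Jplus_mul_uhMap {a : Abar n} (ha : a ∈ Jplus n) (c : UhBar n) :
    a * uhMap n c ∈ Jplus n := by
  have := eps_Jminus (uhMap_mul_Jminus (eps_Jplus ha) c)
  rwa [eps_mul, eps_eps, eps_uhMap] at this

/-! ### Normalizers of the two ideals -/

theorem NormPlus.eps {b : Abar n} (h : NormPlus b) : NormMinus (HDiff.eps n b) := by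
  intro c hc
  have := eps_Jplus (h _ (eps_Jminus hc))
  rwa [eps_mul, eps_eps] at this

theorem NormMinus.eps {b : Abar n} (h : NormMinus b) : NormPlus (HDiff.eps n b) := by
  intro c hc
  have := eps_Jminus (h _ (eps_Jplus hc))
  rwa [eps_mul, eps_eps] at this

theorem NormPlus.mul {a b : Abar n} (ha : NormPlus a) (hb : NormPlus b) :
    NormPlus (a * b) := by
  intro c hc
  rw [← mul_assoc]; exact hb _ (ha c hc)

theorem NormPlus.add {a b : Abar n} (ha : NormPlus a) (hb : NormPlus b) :
    NormPlus (a + b) := by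
  intro c hc
  rw [mul_add]; exact add_mem (ha c hc) (hb c hc)

theorem normMinus_uhMap (c : UhBar n) : NormMinus (uhMap n c) := fun _ h => uhMap_mul_Jminus h c

theorem normPlus_uhMap (c : UhBar n) : NormPlus (uhMap n c) := fun _ h => Jplus_mul_uhMap h c

/-- Only `J̄₋` needs the normalizer condition, since `J̄₊` is a left ideal. This is why `⋄` does not
depend on the representative of the other factor. -/
theorem NormMinus.mul_mem {a b : Abar n} (ha : NormMinus a) (hb : b ∈ Jminus n ⊔ Jplus n) :
    a * b ∈ Jminus n ⊔ Jplus n := by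
  obtain ⟨u, hu, v, hv, rfl⟩ := Submodule.mem_sup.mp hb
  rw [mul_add]
  exact Submodule.add_mem_sup (ha u hu) (mul_Jplus hv a)

theorem NormPlus.mul_mem {a b : Abar n} (ha : NormPlus a) (hb : b ∈ Jminus n ⊔ Jplus n) :
    b * a ∈ Jminus n ⊔ Jplus n := by
  obtain ⟨u, hu, v, hv, rfl⟩ := Submodule.mem_sup.mp hb
  rw [add_mul]
  exact Submodule.add_mem_sup (Jminus_mul hu a) (ha v hv)

theorem toZ_eq {a b : Abar n} : toZ n a = toZ n b ↔ a - b ∈ Jminus n ⊔ Jplus n :=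
  Submodule.Quotient.eq _

theorem toZ_eq_zero {a : Abar n} : toZ n a = 0 ↔ a ∈ Jminus n ⊔ Jplus n :=
  Submodule.Quotient.mk_eq_zero _

theorem toZ_surjective : Function.Surjective (toZ n) := Submodule.mkQ_surjective _

theorem epsZ_toZ (a : Abar n) : epsZ n (toZ n a) = toZ n (eps n a) := rfl

/-! ### Families that transform as covectors under `gl_n` -/

section Covector

variable {B R : Type*} [Ring B] [CommRing R]

/-- Elements `w_k` that transform as a covector under elements `F_ij` obeying the `gl_n` relations,
relative to a right ideal `Jm ∋ F_ij` (`i > j`) and a left ideal `Jp ∋ F_ij` (`i < j`); the `t_q`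
are the shifted Cartan elements, whose differences are invertible. -/
structure CovectorFamily (η : R →+* B) (Jm Jp : AddSubgroup B) (F : Fin n → Fin n → B)
    (w : Fin n → B) (t : Fin n → R) : Prop where
  lie : ∀ i j k l, F i j * F k l - F k l * F i j
    = (if j = k then F i l else 0) - (if i = l then F k j else 0)
  cov : ∀ i j k, F i j * w k - w k * F i j = -(if i = k then w j else 0)
  lower : ∀ i j a, j < i → F i j * a ∈ Jm
  upper : ∀ i j a, i < j → a * F i j ∈ Jp
  mul_right : ∀ a b, a ∈ Jm → a * b ∈ Jm
  mul_left : ∀ c a, a ∈ Jm → η c * a ∈ Jm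
  cart : ∀ q, η (t q) = F q q + ((n - q : ℕ) : B)
  unit : ∀ i k, i ≠ k → IsUnit (t k - t i)

/-- The covectors `w Fᵐ`. -/
def covPow (F : Fin n → Fin n → B) (w : Fin n → B) : ℕ → Fin n → B
  | 0, k => w k
  | m + 1, k => ∑ i, covPow F w m i * F i k

/-- The extension of a finite sequence by zero. -/
def extendZero (t : Fin n → R) (l : ℕ) : R := if h : l < n then t ⟨l, h⟩ else 0

theorem extendZero_val (t : Fin n → R) (k : Fin n) : extendZero t k = t k := by
  simp [extendZero]

/-- The covectors `w Fᵐ ∏_{j < l} (F - t_j)`, the `t_j` acting from the left. -/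
def covProd (η : R →+* B) (F : Fin n → Fin n → B) (w : Fin n → B) (t : Fin n → R) :
    ℕ → Fin n → ℕ → B
  | 0, k, m => covPow F w m k
  | l + 1, k, m => covProd η F w t l k (m + 1) - η (extendZero t l) * covProd η F w t l k m

/-- The product `∏_{j < l} (c - t_j)`. -/
def charProd (t : Fin n → R) (c : R) (l : ℕ) : R := ∏ j ∈ Finset.range l, (c - extendZero t j)

/-- The normalizer element attached to `w_k`. -/
def covNorm (η : R →+* B) (F : Fin n → Fin n → B) (w : Fin n → B) (t : Fin n → R) (k : Fin n) : B :=
  η (Ring.inverse (charProd t (t k) k)) * covProd η F w t k k 0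

namespace CovectorFamily

variable {η : R →+* B} {Jm Jp : AddSubgroup B} {F : Fin n → Fin n → B} {w : Fin n → B}
  {t : Fin n → R} (H : CovectorFamily η Jm Jp F w t)

include H

/-- Contraction with `F` is equivariant: in the sum over the contracted index, the variations of the
upper and of the lower index cancel, and only the free index `k` contributes. -/
theorem covPow_cov (m : ℕ) (i j k : Fin n) : F i j * covPow F w m k - covPow F w m k * F i j
    = -(if i = k then covPow F w m j else 0) := by
  induction m generalizing i j k with
  | zero => exact H.cov i j k
  | succ m ih =>
    simp only [covPow]
    rw [Finset.mul_sum, Finset.sum_mul, ← Finset.sum_sub_distrib]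
    have h : ∀ l, F i j * (covPow F w m l * F l k) - covPow F w m l * F l k * F i j
        = (if i = l then -(covPow F w m j * F l k) else 0)
          + (if j = l then covPow F w m l * F i k else 0)
          - (if i = k then covPow F w m l * F l j else 0) := by
      intro l
      have h1 : F i j * (covPow F w m l * F l k) - covPow F w m l * F l k * F i j
        = (F i j * covPow F w m l - covPow F w m l * F i j) * F l k
          + covPow F w m l * (F i j * F l k - F l k * F i j) := by noncomm_ring
      rw [h1, ih, H.lie]
      split_ifs <;> simp <;> noncomm_ring
    rw [Finset.sum_congr rfl fun l _ => h l, Finset.sum_sub_distrib, Finset.sum_add_distrib]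
    split_ifs with hik <;> simp

theorem covPow_mul_F (m : ℕ) (i j k : Fin n) : covPow F w m k * F i j
    = F i j * covPow F w m k + if i = k then covPow F w m j else 0 := by
  have h := H.covPow_cov m i j k
  rw [sub_eq_iff_eq_add] at h
  rw [h]; abel

/-- In the contraction, each term with `i > q` is reordered to put the lowering element `F_iq` on
the left, which leaves one extra copy of the `q`-th component. These `n - 1 - q` copies and the one
from reordering `F_qq` account for the shift `n - q` in `t_q`. -/
theorem covPow_succ_mod (m : ℕ) (q : Fin n) : covPow F w (m + 1) q - η (t q) * covPow F w m q
    - ∑ i ∈ Finset.Iio q, covPow F w m i * F i q ∈ Jm := by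
  have hsplit : covPow F w (m + 1) q = ∑ i ∈ Finset.Iio q, covPow F w m i * F i q
      + (covPow F w m q * F q q + ∑ i ∈ Finset.Ioi q, covPow F w m i * F i q) := by
    have h1 : (Finset.univ : Finset (Fin n)) = Finset.Iio q ∪ Finset.Ici q := by
      ext i; simp [lt_or_ge]
    have h2 : Disjoint (Finset.Iio q) (Finset.Ici q) := by
      rw [Finset.disjoint_left]; intro i hi hi'
      simp only [Finset.mem_Iio, Finset.mem_Ici] at hi hi'; exact absurd hi (not_lt.mpr hi')
    rw [covPow, h1, Finset.sum_union h2, ← Finset.Ioi_insert, Finset.sum_insert (by simp)]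
  have h3 : ∑ i ∈ Finset.Ioi q, covPow F w m i * F i q
      = ∑ i ∈ Finset.Ioi q, F i q * covPow F w m i + ((n - 1 - q : ℕ) : B) * covPow F w m q := by
    rw [Finset.sum_congr rfl fun i _ => H.covPow_mul_F m i q i, Finset.sum_add_distrib]
    simp [Fin.card_Ioi]
  have h4 : ((n - q : ℕ) : B) = ((n - 1 - q : ℕ) : B) + 1 := by
    rw [← Nat.cast_succ]; congr 1; have := q.2; omega
  have h5 : covPow F w (m + 1) q - η (t q) * covPow F w m q
      - ∑ i ∈ Finset.Iio q, covPow F w m i * F i q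
      = ∑ i ∈ Finset.Ioi q, F i q * covPow F w m i := by
    rw [hsplit, h3, H.cart, H.covPow_mul_F, if_pos rfl, h4]
    noncomm_ring
  rw [h5]
  exact sum_mem fun i hi => H.lower _ _ _ (Finset.mem_Ioi.mp hi)

theorem covProd_succ_mod (l : ℕ) (q : Fin n) (m : ℕ) :
    covProd η F w t l q (m + 1) - η (t q) * covProd η F w t l q m
      - ∑ i ∈ Finset.Iio q, covProd η F w t l i m * F i q ∈ Jm := by
  induction l generalizing m with
  | zero => exact H.covPow_succ_mod m q
  | succ l ih =>
    have h := sub_mem (ih (m + 1)) (H.mul_left (extendZero t l) _ (ih m))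
    convert h using 1
    have hc : η (t q) * η (extendZero t l) = η (extendZero t l) * η (t q) := by
      rw [← map_mul, mul_comm, map_mul]
    simp only [covProd, sub_mul, Finset.sum_sub_distrib, mul_sub, Finset.mul_sum, ← mul_assoc, hc]
    abel

/-- Triangular Cayley-Hamilton: the factor `F - t_l` removes the diagonal part of the `l`-th
component, and what remains starts with components below `l`, which already lie in the right ideal
`Jm`. -/
theorem covProd_mem (l : ℕ) (q : Fin n) (hq : (q : ℕ) < l) (m : ℕ) :
    covProd η F w t l q m ∈ Jm := by
  induction l generalizing q m with
  | zero => omega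
  | succ l ih =>
    rcases Nat.lt_succ_iff_lt_or_eq.mp hq with h | h
    · exact sub_mem (ih q h _) (H.mul_left _ _ (ih q h _))
    · have h1 := H.covProd_succ_mod l q m
      have h2 : ∑ i ∈ Finset.Iio q, covProd η F w t l i m * F i q ∈ Jm :=
        sum_mem fun i hi => H.mul_right _ _ (ih i (by have := Finset.mem_Iio.mp hi; omega) m)
      have h3 := add_mem h1 h2
      rw [sub_add_cancel] at h3
      rwa [covProd, ← h, extendZero_val, h]

theorem covProd_mul_F (l : ℕ) (k p q : Fin n) (hpq : q < p) (m : ℕ) :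
    covProd η F w t l k m * F p q - (if p = k then covProd η F w t l q m else 0) ∈ Jm := by
  induction l generalizing m with
  | zero =>
    rw [covProd, covProd, H.covPow_mul_F, add_sub_cancel_right]
    exact H.lower _ _ _ hpq
  | succ l ih =>
    have h := sub_mem (ih (m + 1)) (H.mul_left (extendZero t l) _ (ih m))
    convert h using 1
    simp only [covProd]
    split_ifs <;> noncomm_ring

/-- Moving `F_pq` to the left costs only a term with `p = k`. That term is a component `q < k` of
the same product, so `covProd_mem` applies. -/
theorem covNorm_mul_F (k p q : Fin n) (hpq : q < p) : covNorm η F w t k * F p q ∈ Jm := by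
  rw [covNorm, mul_assoc]
  refine H.mul_left _ _ ?_
  have h := H.covProd_mul_F k k p q hpq 0
  by_cases hpk : p = k
  · rw [if_pos hpk] at h
    have := add_mem h (H.covProd_mem k q (hpk ▸ hpq) 0)
    rwa [sub_add_cancel] at this
  · rwa [if_neg hpk, sub_zero] at h

theorem isUnit_charProd (k : Fin n) : IsUnit (charProd t (t k) k) := by
  unfold charProd
  refine Submonoid.prod_mem (IsUnit.submonoid R) fun j hj => ?_
  have hj := Finset.mem_range.mp hj
  have hjn : j < n := hj.trans k.2
  have : extendZero t j = t ⟨j, hjn⟩ := by simp [extendZero, hjn]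
  rw [this]
  exact H.unit _ _ (by rintro rfl; simp at hj)

variable {G : AddSubgroup B} (hJ : Jm ≤ G)

include hJ

/-- When the terms with `i < k` vanish on `D` modulo `G`, the triangular relation of
`covPow_succ_mod` reduces to its diagonal part. -/
theorem covPow_mul_mod (D : B) (k : Fin n)
    (h : ∀ i, i < k → ∀ m, covPow F w m i * F i k * D ∈ G) (m : ℕ) :
    covPow F w (m + 1) k * D - η (t k) * (covPow F w m k * D) ∈ G := by
  have h1 := hJ (H.mul_right _ D (H.covPow_succ_mod m k))
  have h2 : (∑ i ∈ Finset.Iio k, covPow F w m i * F i k) * D ∈ G := by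
    rw [Finset.sum_mul]
    exact sum_mem fun i hi => h i (Finset.mem_Iio.mp hi) m
  have h3 := add_mem h1 h2
  rw [← add_mul, sub_add_cancel, sub_mul, mul_assoc] at h3
  exact h3

variable (hG : ∀ c a, a ∈ G → η c * a ∈ G)

include hG

/-- The element `covNorm k` acts like `w_k` on `D` modulo `G`. -/
theorem covNorm_mul_mod (D : B) (k : Fin n)
    (h : ∀ i, i < k → ∀ m, covPow F w m i * F i k * D ∈ G) :
    covNorm η F w t k * D - w k * D ∈ G := by
  have h1 : ∀ l m, covProd η F w t l k m * D - η (charProd t (t k) l) * (covPow F w m k * D)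
      ∈ G := by
    intro l
    induction l with
    | zero => intro m; simp [covProd, charProd, zero_mem]
    | succ l ih =>
      intro m
      have h2 := sub_mem (ih (m + 1)) (hG (extendZero t l) _ (ih m))
      have h3 := add_mem h2 (hG (charProd t (t k) l) _ (H.covPow_mul_mod hJ D k h m))
      convert h3 using 1
      have h4 : charProd t (t k) (l + 1) = charProd t (t k) l * t k
          - extendZero t l * charProd t (t k) l := by
        rw [charProd, charProd, Finset.prod_range_succ]; ring
      rw [h4, covProd]
      simp only [map_sub, map_mul, sub_mul, mul_sub, mul_assoc]
      abel
  have h5 := hG (Ring.inverse (charProd t (t k) k)) _ (h1 k 0)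
  rw [mul_sub, ← mul_assoc, ← mul_assoc, ← map_mul,
    Ring.inverse_mul_cancel _ (H.isUnit_charProd k), map_one, one_mul] at h5
  exact h5

/-- If `G` contains `covNorm k * D` for all `k` and all `D ∈ 𝒟`, and `F_ik` (`i < k`) preserves `𝒟`
modulo `G`, then `G` contains `w_k * D` for all `k` and all `D ∈ 𝒟`. -/
theorem covPow_mul_mem (𝒟 : Set B)
    (hD : ∀ D ∈ 𝒟, ∀ i k, i < k → ∃ D' ∈ 𝒟, ∀ b, b * (F i k * D - D') ∈ G)
    (hN : ∀ D ∈ 𝒟, ∀ k, covNorm η F w t k * D ∈ G) (k : Fin n) :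
    ∀ D ∈ 𝒟, ∀ m, covPow F w m k * D ∈ G := by
  induction k using WellFoundedLT.induction with
  | ind k ih =>
    intro D hDD m
    -- `F_ik D` is traded for an element of `𝒟`, to which the induction hypothesis for the smaller
    -- index `i` applies.
    have h : ∀ i, i < k → ∀ m, covPow F w m i * F i k * D ∈ G := by
      intro i hi m
      obtain ⟨D', hD', hb⟩ := hD D hDD i k hi
      have := add_mem (hb (covPow F w m i)) (ih i hi D' hD' m)
      rwa [mul_sub, sub_add_cancel, ← mul_assoc] at this
    induction m with
    | zero =>
      have := sub_mem (hN D hDD k) (H.covNorm_mul_mod hJ hG D k h)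
      rwa [sub_sub_cancel] at this
    | succ m ihm =>
      have := add_mem (H.covPow_mul_mod hJ D k h m) (hG (t k) _ ihm)
      rwa [sub_add_cancel] at this

end CovectorFamily

end Covector

/-! ### Ring identities -/

section Ring

variable {B : Type*} [Ring B]

theorem ring_neg_mul (a b : B) : -a * b = -(a * b) := neg_mul a b

theorem ring_mul_neg (a b : B) : a * -b = -(a * b) := mul_neg a b

theorem ring_neg_lie (a b : B) : -a * -b - -b * -a = a * b - b * a := by noncomm_ring

theorem ring_neg_comm (a b : B) : -a * b - b * -a = -(a * b - b * a) := by noncomm_ring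

theorem ring_lie_mul (a b c : B) :
    a * (b * c) - b * c * a = (a * b - b * a) * c + b * (a * c - c * a) := by noncomm_ring

theorem ring_mul_comm (a b c : B) : a * (b * c) = (a * b - b * a) * c + b * (a * c) := by
  noncomm_ring

/-- Two telescopings of a difference of products are needed, according to which factors are known to
normalize an ideal. -/
theorem ring_mul_sub_mul (a a' b b' : B) :
    a' * b' - a * b = (a' - a) * b' + a * (b' - b) := by noncomm_ring

theorem ring_mul_sub_mul' (a a' b b' : B) :
    a' * b' - a * b = (a' - a) * b + a' * (b' - b) := by noncomm_ring

end Ring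

/-! ### Representatives in the normalizers -/

theorem normMinus_of_simple {a : Abar n} (h : ∀ p q, q < p → a * E p q ∈ Jminus n) :
    NormMinus a := by
  intro c hc
  have : Jminus n ≤ (Jminus n).comap (LinearMap.mulLeft ℂ a) := by
    refine Submodule.span_le.mpr ?_
    rintro _ ⟨b, i, j, hij, rfl⟩
    change a * (E i j * b) ∈ Jminus n
    rw [← mul_assoc]
    exact Jminus_mul (h i j hij) b
  exact this hc

/-- The Cartan elements of the covector `∂`. -/
def cartD (q : Fin n) : UhBar n :=
  algebraMap (Uh n) (UhBar n) (MvPolynomial.X q) + ((n - q : ℕ) : UhBar n)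

/-- The right side is `-h̊_ik`, so for `i ≠ k` it is a unit of `Ū(h)`, and it is the source of the
`h̊_ij` in the final formula. -/
theorem cartD_sub (i k : Fin n) : cartD k - cartD i = algebraMap (Uh n) (UhBar n) (MvPolynomial.X k)
    - algebraMap (Uh n) (UhBar n) (MvPolynomial.X i) + (((i : ℤ) - k : ℤ) : UhBar n) := by
  simp only [cartD, Nat.cast_sub i.2.le, Nat.cast_sub k.2.le]
  push_cast
  ring

theorem covectorD : CovectorFamily (uhMap n) (Jminus n).toAddSubgroup (Jplus n).toAddSubgroup
    E db cartD where
  lie := E_lie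
  cov i j k := by rw [E_mul_db]; abel
  lower i j a h := E_mul_mem_Jminus h a
  upper i j a h := mul_E_mem_Jplus h a
  mul_right a b h := Jminus_mul h b
  mul_left c a h := uhMap_mul_Jminus h c
  cart q := by rw [cartD, map_add, uhMap_X, map_natCast]
  unit i k h := by rw [cartD_sub]; exact isUnit_root h.symm _

/-- The `gl_n`-elements for which the reversed `x` is a covector. -/
def Erev (i j : Fin n) : Abar n := -E j.rev i.rev

/-- The Cartan elements of the covector formed by the reversed `x`. -/
def cartX (q : Fin n) : UhBar n :=
  -algebraMap (Uh n) (UhBar n) (MvPolynomial.X q.rev) + ((n - q : ℕ) : UhBar n)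

/-- The negative transpose is an automorphism of `gl_n` that makes the vector `x` a covector but
exchanges raising and lowering elements. Reversing the indices exchanges them back, so the same two
ideals serve. -/
theorem covectorX : CovectorFamily (uhMap n) (Jminus n).toAddSubgroup (Jplus n).toAddSubgroup
    Erev (fun k => xb k.rev) cartX where
  lie i j k l := by
    have h := E_lie j.rev i.rev l.rev k.rev
    simp only [Fin.rev_inj] at h
    simp only [Erev]
    refine (ring_neg_lie _ _).trans (h.trans ?_)
    by_cases h1 : i = l <;> by_cases h2 : j = k <;> simp only [h1, h2, if_true, if_false] <;> abel
  cov i j k := by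
    rw [Erev]
    refine (ring_neg_comm _ _).trans ?_
    rw [E_mul_xb, add_sub_cancel_left]
    simp only [Fin.rev_inj]
  lower i j a h := by
    rw [Erev, ring_neg_mul]
    exact neg_mem (E_mul_mem_Jminus (Fin.rev_lt_rev.mpr h) a)
  upper i j a h := by
    rw [Erev, ring_mul_neg]
    exact neg_mem (mul_E_mem_Jplus (Fin.rev_lt_rev.mpr h) a)
  mul_right a b h := Jminus_mul h b
  mul_left c a h := uhMap_mul_Jminus h c
  cart q := by rw [cartX, map_add, map_neg, uhMap_X, map_natCast, Erev]
  unit i k h := by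
    have h1 : cartX k - cartX i = algebraMap (Uh n) (UhBar n) (MvPolynomial.X i.rev)
        - algebraMap (Uh n) (UhBar n) (MvPolynomial.X k.rev) + (((i : ℤ) - k : ℤ) : UhBar n) := by
      simp only [cartX, Nat.cast_sub i.2.le, Nat.cast_sub k.2.le]
      push_cast
      ring
    rw [h1]
    exact isUnit_root (fun h' => h (Fin.rev_inj.mp h')) _

/-- The representative of `∂_k` in the normalizer of `J̄₋`. -/
def dMinus (k : Fin n) : Abar n := covNorm (uhMap n) E db cartD k

/-- The representative of `xᵏ` in the normalizer of `J̄₋`. -/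
def xMinus (k : Fin n) : Abar n := covNorm (uhMap n) Erev (fun k => xb k.rev) cartX k.rev

theorem normMinus_dMinus (k : Fin n) : NormMinus (dMinus k) :=
  normMinus_of_simple fun p q h => covectorD.covNorm_mul_F k p q h

theorem normMinus_xMinus (k : Fin n) : NormMinus (xMinus k) :=
  normMinus_of_simple fun p q h => by
    have := covectorX.covNorm_mul_F k.rev q.rev p.rev (Fin.rev_lt_rev.mpr h)
    rw [Erev, Fin.rev_rev, Fin.rev_rev, ring_mul_neg] at this
    exact neg_mem_iff.mp this

theorem uhMap_mul_J {a : Abar n} (ha : a ∈ Jminus n ⊔ Jplus n) (c : UhBar n) :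
    uhMap n c * a ∈ Jminus n ⊔ Jplus n := (normMinus_uhMap c).mul_mem ha

/-- For `D = 1` the off-diagonal terms end in a raising element and lie in `J̄₊`, so
`covNorm_mul_mod` applies. -/
theorem dMinus_sub_mem (k : Fin n) : dMinus k - db k ∈ Jminus n ⊔ Jplus n := by
  have h := covectorD.covNorm_mul_mod (G := (Jminus n ⊔ Jplus n).toAddSubgroup)
    (fun a ha => (le_sup_left : Jminus n ≤ _) ha) (fun c a ha => uhMap_mul_J ha c) 1 k
    (fun i hi m => by
      rw [mul_one]
      exact (le_sup_right : Jplus n ≤ _) (mul_E_mem_Jplus hi _))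
  rwa [mul_one, mul_one] at h

theorem xMinus_sub_mem (k : Fin n) : xMinus k - xb k ∈ Jminus n ⊔ Jplus n := by
  have h := covectorX.covNorm_mul_mod (G := (Jminus n ⊔ Jplus n).toAddSubgroup)
    (fun a ha => (le_sup_left : Jminus n ≤ _) ha) (fun c a ha => uhMap_mul_J ha c) 1 k.rev
    (fun i hi m => by
      rw [mul_one]
      exact (le_sup_right : Jplus n ≤ _) (covectorX.upper _ _ _ hi))
  rw [mul_one, mul_one, Fin.rev_rev] at h
  exact h

/-- The representative of `∂_k` in the normalizer of `J̄₊`. -/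
def dPlus (k : Fin n) : Abar n := eps n (xMinus k)

/-- The representative of `xᵏ` in the normalizer of `J̄₊`. -/
def xPlus (k : Fin n) : Abar n := eps n (dMinus k)

theorem dPlus_sub_mem (k : Fin n) : dPlus k - db k ∈ Jminus n ⊔ Jplus n := by
  have := eps_mem _ (xMinus_sub_mem k)
  rwa [map_sub, eps_xb] at this

theorem xPlus_sub_mem (k : Fin n) : xPlus k - xb k ∈ Jminus n ⊔ Jplus n := by
  have := eps_mem _ (dMinus_sub_mem k)
  rwa [map_sub, eps_db] at this

/-! ### A spanning set of `𝒜̄` -/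

/-- The span of the `xⁱ` and `∂ᵢ`. -/
def gens (n : ℕ) : Submodule ℂ (Abar n) := Submodule.span ℂ (Set.range xb ∪ Set.range db)

theorem xb_mem_gens (i : Fin n) : xb i ∈ gens n := Submodule.subset_span (Or.inl ⟨i, rfl⟩)

theorem db_mem_gens (i : Fin n) : db i ∈ gens n := Submodule.subset_span (Or.inr ⟨i, rfl⟩)

theorem gens_pow_succ_le {m : ℕ} {G : Submodule ℂ (Abar n)}
    (hx : ∀ i, ∀ D ∈ gens n ^ m, xb i * D ∈ G) (hd : ∀ i, ∀ D ∈ gens n ^ m, db i * D ∈ G) :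
    gens n ^ (m + 1) ≤ G := by
  rw [pow_succ']
  refine Submodule.mul_le.mpr fun v hv D hD => ?_
  have : gens n ≤ G.comap (LinearMap.mulRight ℂ D) := by
    refine Submodule.span_le.mpr ?_
    rintro _ (⟨i, rfl⟩ | ⟨i, rfl⟩)
    · exact hx i D hD
    · exact hd i D hD
  exact this hv

/-- The commutator with `E_ij` is a derivation preserving the span of the `xⁱ` and `∂ᵢ`. -/
theorem E_comm_mem (i j : Fin n) (m : ℕ) : ∀ D ∈ gens n ^ m, E i j * D - D * E i j ∈ gens n ^ m := by
  induction m with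
  | zero =>
    intro D hD
    rw [pow_zero, Submodule.mem_one] at hD
    obtain ⟨c, rfl⟩ := hD
    rw [Algebra.commutes, sub_self]
    exact zero_mem _
  | succ m ih =>
    refine gens_pow_succ_le (G := (gens n ^ (m + 1)).comap
      (LinearMap.mulLeft ℂ (E i j) - LinearMap.mulRight ℂ (E i j))) ?_ ?_
    · intro k D hD
      change E i j * (xb k * D) - xb k * D * E i j ∈ gens n ^ (m + 1)
      rw [ring_lie_mul, pow_succ', E_mul_xb, add_sub_cancel_left]
      refine add_mem (Submodule.mul_mem_mul ?_ hD)
        (Submodule.mul_mem_mul (xb_mem_gens k) (ih D hD))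
      split_ifs
      exacts [xb_mem_gens i, zero_mem _]
    · intro k D hD
      change E i j * (db k * D) - db k * D * E i j ∈ gens n ^ (m + 1)
      rw [ring_lie_mul, pow_succ', E_mul_db, sub_sub_cancel_left]
      refine add_mem (Submodule.mul_mem_mul ?_ hD)
        (Submodule.mul_mem_mul (db_mem_gens k) (ih D hD))
      split_ifs
      exacts [neg_mem (db_mem_gens j), neg_mem (zero_mem _)]

theorem uhMap_mul_gens_pow (m : ℕ) : ∀ D ∈ gens n ^ m, ∀ c, uhMap n c * D ∈
    Submodule.span ℂ {a | ∃ D' ∈ gens n ^ m, ∃ c', a = D' * uhMap n c'} := by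
  induction m with
  | zero =>
    intro D hD c
    rw [pow_zero, Submodule.mem_one] at hD
    obtain ⟨r, rfl⟩ := hD
    rw [← Algebra.commutes]
    refine Submodule.subset_span ⟨_, ?_, c, rfl⟩
    rw [pow_zero, Submodule.mem_one]
    exact ⟨r, rfl⟩
  | succ m ih =>
    have key : ∀ v ∈ gens n, ∀ κ, HasWt κ v → ∀ D ∈ gens n ^ m, ∀ c, uhMap n c * (v * D) ∈
        Submodule.span ℂ {a | ∃ D' ∈ gens n ^ (m + 1), ∃ c', a = D' * uhMap n c'} := by
      intro v hv κ hκ D hD c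
      rw [← mul_assoc, hκ.uhMap_mul, mul_assoc]
      have h := ih D hD (shift κ c)
      have hle : Submodule.span ℂ {a | ∃ D' ∈ gens n ^ m, ∃ c', a = D' * uhMap n c'}
          ≤ (Submodule.span ℂ {a | ∃ D' ∈ gens n ^ (m + 1), ∃ c', a = D' * uhMap n c'}).comap
            (LinearMap.mulLeft ℂ v) := by
        refine Submodule.span_le.mpr ?_
        rintro _ ⟨D', hD', c', rfl⟩
        refine Submodule.subset_span ⟨v * D', ?_, c', (mul_assoc _ _ _).symm⟩
        rw [pow_succ']
        exact Submodule.mul_mem_mul hv hD'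
      exact hle h
    intro D hD c
    exact gens_pow_succ_le (G := (Submodule.span ℂ
      {a | ∃ D' ∈ gens n ^ (m + 1), ∃ c', a = D' * uhMap n c'}).comap
        (LinearMap.mulLeft ℂ (uhMap n c)))
      (fun i D hD => key _ (xb_mem_gens i) _ (hasWt_xb i) D hD c)
      (fun i D hD => key _ (db_mem_gens i) _ (hasWt_db i) D hD c) hD

/-- Ordered products of lowering operators, differential operators and Cartan elements. -/
inductive Ordered : Abar n → Prop
  | base (m : ℕ) (D : Abar n) (hD : D ∈ gens n ^ m) (c : UhBar n) : Ordered (D * uhMap n c)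
  | lower (i j : Fin n) (h : j < i) (a : Abar n) (ha : Ordered a) : Ordered (E i j * a)

/-- The span of the ordered products together with `J̄₊`. -/
def orderedSpan (n : ℕ) : Submodule ℂ (Abar n) := Submodule.span ℂ {a | Ordered a} ⊔ Jplus n

theorem orderedSpan_mul {g : Abar n} (h : ∀ a, Ordered a → g * a ∈ orderedSpan n)
    {a : Abar n} (ha : a ∈ orderedSpan n) : g * a ∈ orderedSpan n := by
  have : orderedSpan n ≤ (orderedSpan n).comap (LinearMap.mulLeft ℂ g) := by
    refine sup_le (Submodule.span_le.mpr h) fun a ha => ?_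
    exact (le_sup_right : Jplus n ≤ _) (mul_Jplus ha g)
  exact this ha

theorem Ordered.mem {a : Abar n} (h : Ordered a) : a ∈ orderedSpan n :=
  (le_sup_left : Submodule.span ℂ {a | Ordered a} ≤ _) (Submodule.subset_span h)

/-- Half of a Poincaré-Birkhoff-Witt argument. A generator is moved to the right past each lowering
operator, and the commutator is a combination of generators applied to a shorter product. Once it
has passed the differential operators as well, a raising element falls into `J̄₊` and a Cartan
element joins the coefficient. -/
theorem Ordered.mul_mem {a : Abar n} (ha : Ordered a) :
    (∀ i, xb i * a ∈ orderedSpan n) ∧ (∀ i, db i * a ∈ orderedSpan n) ∧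
    (∀ i j, E i j * a ∈ orderedSpan n) ∧ ∀ c, uhMap n c * a ∈ orderedSpan n := by
  induction ha with
  | base m D hD c =>
    refine ⟨fun i => ?_, fun i => ?_, fun i j => ?_, fun c' => ?_⟩
    · rw [← mul_assoc]
      refine (Ordered.base (m + 1) _ ?_ c).mem
      rw [pow_succ']; exact Submodule.mul_mem_mul (xb_mem_gens i) hD
    · rw [← mul_assoc]
      refine (Ordered.base (m + 1) _ ?_ c).mem
      rw [pow_succ']; exact Submodule.mul_mem_mul (db_mem_gens i) hD
    · by_cases hij : j < i
      · exact (Ordered.lower i j hij _ (Ordered.base m D hD c)).mem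
      rw [ring_mul_comm]
      refine add_mem (Ordered.base m _ (E_comm_mem i j m D hD) c).mem ?_
      rcases (not_lt.mp hij).eq_or_lt with rfl | hij
      · rw [← uhMap_X, ← map_mul]
        exact (Ordered.base m D hD _).mem
      · refine (le_sup_right : Jplus n ≤ _) (mul_Jplus (Jplus_mul_uhMap ?_ c) D)
        rw [← one_mul (E i j)]
        exact mul_E_mem_Jplus hij 1
    · rw [← mul_assoc]
      have h := uhMap_mul_gens_pow m D hD c'
      have hle : Submodule.span ℂ {a | ∃ D' ∈ gens n ^ m, ∃ c', a = D' * uhMap n c'}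
          ≤ (orderedSpan n).comap (LinearMap.mulRight ℂ (uhMap n c)) := by
        refine Submodule.span_le.mpr ?_
        rintro _ ⟨D', hD', c', rfl⟩
        change D' * uhMap n c' * uhMap n c ∈ orderedSpan n
        rw [mul_assoc, ← map_mul]
        exact (Ordered.base m D' hD' _).mem
      exact hle h
  | lower i j hij a ha ih =>
    have hlow : ∀ b ∈ orderedSpan n, E i j * b ∈ orderedSpan n := fun b hb =>
      orderedSpan_mul (fun a ha => (Ordered.lower i j hij a ha).mem) hb
    refine ⟨fun k => ?_, fun k => ?_, fun k l => ?_, fun c => ?_⟩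
    · have h := E_mul_xb i j k
      have h1 : xb k * (E i j * a) = E i j * (xb k * a) - (if j = k then xb i else 0) * a := by
        rw [← mul_assoc, ← mul_assoc, h]; noncomm_ring
      rw [h1]
      refine sub_mem (hlow _ (ih.1 k)) ?_
      split_ifs
      · exact ih.1 i
      · rw [zero_mul]; exact zero_mem _
    · have h := E_mul_db i j k
      have h1 : db k * (E i j * a) = E i j * (db k * a) + (if i = k then db j else 0) * a := by
        rw [← mul_assoc, ← mul_assoc, h, sub_mul, sub_add_cancel]
      rw [h1]
      refine add_mem (hlow _ (ih.2.1 k)) ?_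
      split_ifs
      · exact ih.2.1 j
      · rw [zero_mul]; exact zero_mem _
    · have h := E_lie k l i j
      rw [ring_mul_comm, h, sub_mul]
      refine add_mem (sub_mem ?_ ?_) (hlow _ (ih.2.2.1 k l))
      · split_ifs
        · exact ih.2.2.1 _ _
        · rw [zero_mul]; exact zero_mem _
      · split_ifs
        · exact ih.2.2.1 _ _
        · rw [zero_mul]; exact zero_mem _
    · rw [← mul_assoc, (hasWt_E i j).uhMap_mul, mul_assoc]
      exact hlow _ (ih.2.2.2 _)

/-- The left multipliers that preserve `orderedSpan n` form a subalgebra containing the generators,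
hence all of `𝒜̄`; they are then applied to `1`. -/
theorem mem_orderedSpan (a : Abar n) : a ∈ orderedSpan n := by
  let S : Subalgebra ℂ (Abar n) :=
    { carrier := {g | ∀ b ∈ orderedSpan n, g * b ∈ orderedSpan n}
      mul_mem' := fun {g h} hg hh b hb => by rw [mul_assoc]; exact hg _ (hh b hb)
      add_mem' := fun {g h} hg hh b hb => by rw [add_mul]; exact add_mem (hg b hb) (hh b hb)
      algebraMap_mem' := fun c b hb => by
        rw [← Algebra.smul_def]; exact Submodule.smul_mem _ c hb }
  have hS : a ∈ S := Abar_mem (S := S)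
    (fun i _ hb => orderedSpan_mul (fun _ h => h.mul_mem.1 i) hb)
    (fun i _ hb => orderedSpan_mul (fun _ h => h.mul_mem.2.1 i) hb)
    (fun i j _ hb => orderedSpan_mul (fun _ h => h.mul_mem.2.2.1 i j) hb)
    (fun c _ hb => orderedSpan_mul (fun _ h => h.mul_mem.2.2.2 c) hb) a
  have h1 : (1 : Abar n) ∈ orderedSpan n := by
    have h := (Ordered.base 0 (1 : Abar n) (by rw [pow_zero]; exact Submodule.one_le.mp le_rfl)
      (1 : UhBar n)).mem
    rwa [map_one, mul_one] at h
  have := hS 1 h1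
  rwa [mul_one] at this

/-- `𝒜̄` is spanned by `J̄₋`, `J̄₊` and the products of differential operators and Cartan elements. -/
theorem mem_of_normalForm {G : Submodule ℂ (Abar n)} (hJ : Jminus n ⊔ Jplus n ≤ G)
    (h : ∀ m, ∀ D ∈ gens n ^ m, ∀ c, D * uhMap n c ∈ G) (a : Abar n) : a ∈ G := by
  have hle : orderedSpan n ≤ G := by
    refine sup_le (Submodule.span_le.mpr fun a ha => ?_) (le_sup_right.trans hJ)
    cases ha with
    | base m D hD c => exact h m D hD c
    | lower i j hij a ha => exact (le_sup_left.trans hJ) (E_mul_mem_Jminus hij a)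
  exact hle (mem_orderedSpan a)

/-- The elements whose double coset meets the normalizer of `J̄₊`. -/
def reach (n : ℕ) : Submodule ℂ (Abar n) where
  carrier := {a | ∃ b, NormPlus b ∧ b - a ∈ Jminus n ⊔ Jplus n}
  add_mem' := by
    rintro a a' ⟨b, hb, hab⟩ ⟨b', hb', hab'⟩
    exact ⟨b + b', hb.add hb', by rw [add_sub_add_comm]; exact add_mem hab hab'⟩
  zero_mem' := ⟨0, fun c _ => by rw [mul_zero]; exact zero_mem _, by rw [sub_zero]; exact zero_mem _⟩
  smul_mem' := by
    rintro r a ⟨b, hb, hab⟩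
    refine ⟨r • b, fun c hc => ?_, ?_⟩
    · rw [mul_smul_comm]; exact Submodule.smul_mem _ _ (hb c hc)
    · have := Submodule.smul_mem _ r hab
      rwa [smul_sub] at this

theorem J_le_reach : Jminus n ⊔ Jplus n ≤ reach n := fun a ha =>
  ⟨0, fun c _ => by rw [mul_zero]; exact zero_mem _, by rw [zero_sub]; exact neg_mem ha⟩

theorem uhMap_mul_reach (c : UhBar n) {a : Abar n} (ha : a ∈ reach n) : uhMap n c * a ∈ reach n := by
  obtain ⟨b, hb, hab⟩ := ha
  exact ⟨uhMap n c * b, (normPlus_uhMap c).mul hb, by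
    rw [← mul_sub]; exact uhMap_mul_J hab c⟩

theorem reach_mul_uhMap (c : UhBar n) {a : Abar n} (ha : a ∈ reach n) : a * uhMap n c ∈ reach n := by
  obtain ⟨b, hb, hab⟩ := ha
  exact ⟨b * uhMap n c, hb.mul (normPlus_uhMap c), by
    rw [← sub_mul]; exact (normPlus_uhMap c).mul_mem hab⟩

/-- If `b` represents `a` in the normalizer of `J̄₊`, then `g' b` represents `g a`: the error `(g' -
g) b` is harmless because `b` normalizes `J̄₊`, the error `g (b - a)` because `g` normalizes `J̄₋`.
-/
theorem mul_mem_reach {g g' a : Abar n} (hg : NormMinus g) (hg' : NormPlus g')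
    (h : g' - g ∈ Jminus n ⊔ Jplus n) (ha : a ∈ reach n) : g * a ∈ reach n := by
  obtain ⟨b, hb, hab⟩ := ha
  refine ⟨g' * b, hg'.mul hb, ?_⟩
  rw [ring_mul_sub_mul]
  exact add_mem (hb.mul_mem h) (hg.mul_mem hab)

/-- The products `xMinus k * D` and `dMinus k * D` are reached by `mul_mem_reach`, and
`covPow_mul_mem` passes from them to `xᵏ D` and `∂_k D`. -/
theorem gens_pow_le_reach (m : ℕ) : gens n ^ m ≤ reach n := by
  induction m with
  | zero =>
    intro D hD
    rw [pow_zero, Submodule.mem_one] at hD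
    obtain ⟨c, rfl⟩ := hD
    rw [← uhMap_algebraMap]
    exact ⟨_, normPlus_uhMap _, by rw [sub_self]; exact zero_mem _⟩
  | succ m ih =>
    refine gens_pow_succ_le (fun k D hD => ?_) (fun k D hD => ?_)
    · have := covectorX.covPow_mul_mem (G := (reach n).toAddSubgroup)
        (fun a ha => J_le_reach ((le_sup_left : Jminus n ≤ _) ha))
        (fun c a ha => uhMap_mul_reach c ha) (gens n ^ m : Submodule ℂ (Abar n))
        -- A raising element acts on `D` as a commutator, because `D * Erev i k` lies in the left
        -- ideal `J̄₊`.
        (fun D hD i k hik => ⟨Erev i k * D - D * Erev i k, ?_, fun b => ?_⟩)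
        (fun D hD k => ?_) k.rev D hD 0
      · rwa [covPow, Fin.rev_rev] at this
      · have := neg_mem (E_comm_mem k.rev i.rev m D hD)
        rwa [← ring_neg_comm] at this
      · rw [sub_sub_cancel, ← mul_assoc]
        exact J_le_reach ((le_sup_right : Jplus n ≤ _) (covectorX.upper _ _ _ hik))
      · have h2 := (xPlus_sub_mem k.rev)
        have h3 := (xMinus_sub_mem k.rev)
        have h4 := sub_mem h2 h3
        rw [sub_sub_sub_cancel_right] at h4
        have := mul_mem_reach (normMinus_xMinus k.rev) (normMinus_dMinus k.rev).eps h4 (ih hD)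
        rwa [xMinus, Fin.rev_rev] at this
    · have := covectorD.covPow_mul_mem (G := (reach n).toAddSubgroup)
        (fun a ha => J_le_reach ((le_sup_left : Jminus n ≤ _) ha))
        (fun c a ha => uhMap_mul_reach c ha) (gens n ^ m : Submodule ℂ (Abar n))
        (fun D hD i k hik => ⟨E i k * D - D * E i k, E_comm_mem i k m D hD, fun b => ?_⟩)
        (fun D hD k => ?_) k D hD 0
      · exact this
      · rw [sub_sub_cancel, ← mul_assoc]
        exact J_le_reach ((le_sup_right : Jplus n ≤ _) (mul_E_mem_Jplus hik _))
      · have h4 := sub_mem (dPlus_sub_mem k) (dMinus_sub_mem k)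
        rw [sub_sub_sub_cancel_right] at h4
        exact mul_mem_reach (normMinus_dMinus k) (normMinus_xMinus k).eps h4 (ih hD)

/-- This takes the place of the extremal projector. -/
theorem exists_normPlus (a : Abar n) : ∃ b, NormPlus b ∧ toZ n b = toZ n a := by
  obtain ⟨b, hb, h⟩ := mem_of_normalForm (G := reach n) J_le_reach
    (fun m D hD c => reach_mul_uhMap c (gens_pow_le_reach m hD)) a
  exact ⟨b, hb, toZ_eq.mpr h⟩

theorem exists_normMinus (a : Abar n) : ∃ b, NormMinus b ∧ toZ n b = toZ n a := by
  obtain ⟨b, hb, h⟩ := exists_normPlus (eps n a)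
  refine ⟨eps n b, hb.eps, ?_⟩
  rw [← epsZ_toZ, h, epsZ_toZ, eps_eps]

/-! ### The multiplication of double cosets -/

/-- Every admissible product is compared with one in which both factors normalize. One telescoping
works when the given right factor normalizes, the other when the given left factor does. -/
theorem IsDia.eq {u v w : Zbar n} (h : IsDia u v w) {a b : Abar n} (ha : NormMinus a)
    (hb : NormPlus b) (hu : toZ n a = u) (hv : toZ n b = v) : w = toZ n (a * b) := by
  obtain ⟨a', b', rfl, rfl, h1, rfl⟩ := h
  rw [toZ_eq] at hu hv ⊢
  rw [← neg_mem_iff, neg_sub]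
  rcases h1 with h1 | h1
  · rw [ring_mul_sub_mul']; exact add_mem (h1.mul_mem hu) (ha.mul_mem hv)
  · rw [ring_mul_sub_mul]; exact add_mem (hb.mul_mem hu) (h1.mul_mem hv)

theorem IsDia.dia_eq {u v w : Zbar n} (h : IsDia u v w) : dia u v = w := by
  have hex : ∃ w, IsDia u v w := ⟨w, h⟩
  rw [dia, dif_pos hex]
  obtain ⟨a, rfl⟩ := toZ_surjective u
  obtain ⟨b, rfl⟩ := toZ_surjective v
  obtain ⟨a', ha', hu⟩ := exists_normMinus a
  obtain ⟨b', hb', hv⟩ := exists_normPlus b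
  rw [hex.choose_spec.eq ha' hb' hu hv, h.eq ha' hb' hu hv]

theorem dia_of_normPlus (a : Abar n) {b : Abar n} (hb : NormPlus b) :
    dia (toZ n a) (toZ n b) = toZ n (a * b) :=
  IsDia.dia_eq ⟨a, b, rfl, rfl, Or.inl hb, rfl⟩

theorem dia_of_normMinus {a : Abar n} (ha : NormMinus a) (b : Abar n) :
    dia (toZ n a) (toZ n b) = toZ n (a * b) :=
  IsDia.dia_eq ⟨a, b, rfl, rfl, Or.inr ha, rfl⟩

theorem exists_toZ_normPlus (u : Zbar n) : ∃ b, NormPlus b ∧ toZ n b = u := by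
  obtain ⟨a, rfl⟩ := toZ_surjective u
  exact exists_normPlus a

theorem exists_toZ_normMinus (u : Zbar n) : ∃ b, NormMinus b ∧ toZ n b = u := by
  obtain ⟨a, rfl⟩ := toZ_surjective u
  exact exists_normMinus a

/-- With the two outer factors represented in the normalizers, the middle one may be arbitrary, and
both bracketings are the class of one triple product. -/
theorem dia_assoc (u v w : Zbar n) : dia (dia u v) w = dia u (dia v w) := by
  obtain ⟨a, ha, rfl⟩ := exists_toZ_normMinus u
  obtain ⟨c, hc, rfl⟩ := exists_toZ_normPlus w
  obtain ⟨b, rfl⟩ := toZ_surjective v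
  rw [dia_of_normMinus ha, dia_of_normPlus _ hc, dia_of_normPlus _ hc, dia_of_normMinus ha,
    mul_assoc]

/-- Multiplication as a bilinear map. -/
def diaLin (n : ℕ) : Zbar n →ₗ[ℂ] Zbar n →ₗ[ℂ] Zbar n :=
  LinearMap.mk₂ ℂ dia
    (fun u u' v => by
      obtain ⟨b, hb, rfl⟩ := exists_toZ_normPlus v
      obtain ⟨a, rfl⟩ := toZ_surjective u
      obtain ⟨a', rfl⟩ := toZ_surjective u'
      rw [← map_add, dia_of_normPlus _ hb, dia_of_normPlus _ hb, dia_of_normPlus _ hb, add_mul,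
        map_add])
    (fun r u v => by
      obtain ⟨b, hb, rfl⟩ := exists_toZ_normPlus v
      obtain ⟨a, rfl⟩ := toZ_surjective u
      rw [← map_smul, dia_of_normPlus _ hb, dia_of_normPlus _ hb, smul_mul_assoc, map_smul])
    (fun u v v' => by
      obtain ⟨a, ha, rfl⟩ := exists_toZ_normMinus u
      obtain ⟨b, rfl⟩ := toZ_surjective v
      obtain ⟨b', rfl⟩ := toZ_surjective v'
      rw [← map_add, dia_of_normMinus ha, dia_of_normMinus ha, dia_of_normMinus ha, mul_add,
        map_add])
    (fun r u v => by
      obtain ⟨a, ha, rfl⟩ := exists_toZ_normMinus u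
      obtain ⟨b, rfl⟩ := toZ_surjective v
      rw [← map_smul, dia_of_normMinus ha, dia_of_normMinus ha, mul_smul_comm, map_smul])

theorem diaLin_apply (u v : Zbar n) : diaLin n u v = dia u v := rfl

theorem epsZ_dia (u v : Zbar n) : epsZ n (dia u v) = dia (epsZ n v) (epsZ n u) := by
  obtain ⟨b, hb, rfl⟩ := exists_toZ_normPlus v
  obtain ⟨a, rfl⟩ := toZ_surjective u
  rw [dia_of_normPlus _ hb, epsZ_toZ, epsZ_toZ, epsZ_toZ, eps_mul, dia_of_normMinus hb.eps]

theorem toZ_dPlus (k : Fin n) : toZ n (dPlus k) = toZ n (db k) := toZ_eq.mpr (dPlus_sub_mem k)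

theorem toZ_dMinus (k : Fin n) : toZ n (dMinus k) = toZ n (db k) := toZ_eq.mpr (dMinus_sub_mem k)

theorem toZ_xMinus (k : Fin n) : toZ n (xMinus k) = toZ n (xb k) := toZ_eq.mpr (xMinus_sub_mem k)

theorem normPlus_dPlus (k : Fin n) : NormPlus (dPlus k) := (normMinus_xMinus k).eps

theorem uhMap_dia (c : UhBar n) (a : Abar n) :
    dia (ofUh c) (toZ n a) = toZ n (uhMap n c * a) := dia_of_normMinus (normMinus_uhMap c) a

theorem dia_uhMap (c : UhBar n) (a : Abar n) :
    dia (toZ n a) (ofUh c) = toZ n (a * uhMap n c) := dia_of_normPlus a (normPlus_uhMap c)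

/-- The universal property of the localization, for a homomorphism that inverts `S`. -/
def locLiftUnit {B C : Type*} [Ring B] [Algebra ℂ B] [Ring C] [Algebra ℂ C] (S : Set B)
    (f : B →ₐ[ℂ] C) (h : ∀ s : S, IsUnit (f s)) : Loc S →ₐ[ℂ] C :=
  locLift S f (fun s => Ring.inverse (f s)) (fun s => Ring.mul_inverse_cancel _ (h s))
    (fun s => Ring.inverse_mul_cancel _ (h s))

theorem locLiftUnit_locMap {B C : Type*} [Ring B] [Algebra ℂ B] [Ring C] [Algebra ℂ C] (S : Set B)
    (f : B →ₐ[ℂ] C) (h : ∀ s : S, IsUnit (f s)) (b : B) : locLiftUnit S f h (locMap S b) = f b :=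
  locLift_locMap _ _ _ _ _ _

/-! ### The dual Verma module

`gl_n` acts on the polynomial functions on the group of unipotent upper triangular matrices,
extended by the variables on which `Diff(n)` acts. -/

section DualVerma

variable {R : Type*} [CommRing R] [Algebra ℂ R]

/-- Polynomials in the variables `xⁱ` and the coordinates of a unipotent matrix. -/
abbrev Fock (n : ℕ) (R : Type*) [CommRing R] := MvPolynomial (Fin n ⊕ Pairs n) R

/-- Polynomial vector fields. -/
abbrev Vect (n : ℕ) (R : Type*) [CommRing R] := Derivation R (Fock n R) (Fock n R)

/-! ### Triangular parts of matrix products and commutators -/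

section Triangular

variable {C : Type*} [CommRing C]

/-- The strictly upper triangular part of a matrix. -/
def upper : Matrix (Fin n) (Fin n) C →ₗ[C] Matrix (Fin n) (Fin n) C where
  toFun M := Matrix.of fun i j => if i < j then M i j else 0
  map_add' M N := by ext i j; by_cases h : i < j <;> simp [h]
  map_smul' c M := by ext i j; by_cases h : i < j <;> simp [h]

theorem upper_apply (M : Matrix (Fin n) (Fin n) C) (i j : Fin n) :
    upper M i j = if i < j then M i j else 0 := rfl

theorem upper_upper_mul_upper (M N : Matrix (Fin n) (Fin n) C) :
    upper (upper M * upper N) = upper M * upper N := by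
  ext i j
  rw [upper_apply]
  split_ifs with h
  · rfl
  · rw [Matrix.mul_apply, Finset.sum_eq_zero]
    intro k _
    simp only [upper_apply]
    by_cases h1 : i < k
    · rw [if_neg (c := k < j) fun h2 => h (h1.trans h2), mul_zero]
    · rw [if_neg h1, zero_mul]

theorem upper_mul_upper_diag (M N : Matrix (Fin n) (Fin n) C) (k : Fin n) :
    (upper M * upper N) k k = 0 := by
  rw [← upper_upper_mul_upper, upper_apply, if_neg (lt_irrefl k)]

theorem lower_mul_lower {M N : Matrix (Fin n) (Fin n) C} (hM : ∀ i j, i < j → M i j = 0)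
    (hN : ∀ i j, i < j → N i j = 0) {i j : Fin n} (h : i ≤ j) :
    (M * N) i j = if i = j then M i i * N i i else 0 := by
  rw [Matrix.mul_apply]
  split_ifs with h1
  · subst h1
    refine Finset.sum_eq_single i (fun k _ hk => ?_) (by simp)
    rcases lt_or_gt_of_ne hk with h2 | h2
    · rw [hN _ _ h2, mul_zero]
    · rw [hM _ _ h2, zero_mul]
  · refine Finset.sum_eq_zero fun k _ => ?_
    have h' := lt_of_le_of_ne h h1
    rcases lt_or_ge i k with h2 | h2
    · rw [hM _ _ h2, zero_mul]
    · rw [hN _ _ (h2.trans_lt h'), mul_zero]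

theorem upper_mul_upper' {M N : Matrix (Fin n) (Fin n) C} (hM : ∀ i j, j < i → M i j = 0)
    (hN : ∀ i j, j < i → N i j = 0) {i j : Fin n} (h : j ≤ i) :
    (M * N) i j = if i = j then M i i * N i i else 0 := by
  have := lower_mul_lower (M := N.transpose) (N := M.transpose) (fun i j h => hN j i h)
    (fun i j h => hM j i h) h
  rw [← Matrix.transpose_mul, Matrix.transpose_apply] at this
  rw [this]
  by_cases h1 : j = i
  · subst h1; simp [mul_comm]
  · rw [if_neg h1, if_neg (Ne.symm h1)]

theorem sub_upper_lower (M : Matrix (Fin n) (Fin n) C) (i j : Fin n) (h : i < j) :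
    (M - upper M) i j = 0 := by
  rw [Matrix.sub_apply, upper_apply, if_pos h, sub_self]

/-- Each matrix is split into its strictly upper part and the rest. The last bracket is a commutator
of lower triangular matrices, so it has no entries on or above the diagonal. -/
theorem commutator_split (X Y : Matrix (Fin n) (Fin n) C) :
    X * Y - Y * X = ((upper X * Y - Y * upper X) - (upper Y * X - X * upper Y)
      + upper Y * upper X - upper X * upper Y)
      + ((X - upper X) * (Y - upper Y) - (Y - upper Y) * (X - upper X)) := by
  noncomm_ring

theorem upper_commutator (X Y : Matrix (Fin n) (Fin n) C) :
    upper (X * Y - Y * X) = upper (upper X * Y - Y * upper X) - upper (upper Y * X - X * upper Y)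
      + upper Y * upper X - upper X * upper Y := by
  have h : upper ((X - upper X) * (Y - upper Y) - (Y - upper Y) * (X - upper X)) = 0 := by
    ext i j
    rw [upper_apply]
    split_ifs with h
    · rw [Matrix.sub_apply, lower_mul_lower (sub_upper_lower X) (sub_upper_lower Y) h.le,
        lower_mul_lower (sub_upper_lower Y) (sub_upper_lower X) h.le, if_neg h.ne, if_neg h.ne,
        sub_self]; rfl
    · rfl
  rw [commutator_split, map_add, h, add_zero, map_sub, map_add, map_sub, upper_upper_mul_upper,
    upper_upper_mul_upper]

theorem diag_commutator (X Y : Matrix (Fin n) (Fin n) C) (k : Fin n) :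
    (X * Y - Y * X) k k = (upper X * Y - Y * upper X) k k - (upper Y * X - X * upper Y) k k := by
  rw [commutator_split]
  simp only [Matrix.add_apply, Matrix.sub_apply (_ + _) _, Matrix.sub_apply (_ * _) ((_ - _) * _),
    upper_mul_upper_diag]
  rw [lower_mul_lower (sub_upper_lower X) (sub_upper_lower Y) le_rfl,
        lower_mul_lower (sub_upper_lower Y) (sub_upper_lower X) le_rfl, if_pos rfl, if_pos rfl,
        Matrix.sub_apply (_ - _) (_ - _)]
  ring

omit [Algebra ℂ R] in
theorem derivation_map_mul {D : Vect n R}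
    (M N : Matrix (Fin n) (Fin n) (Fock n R)) :
    (M * N).map D = M.map D * N + M * N.map D := by
  ext1 i j
  simp only [Matrix.map_apply, Matrix.mul_apply, Matrix.add_apply, map_sum, Derivation.leibniz,
    smul_eq_mul, Finset.sum_add_distrib]
  rw [add_comm]
  congr 1
  exact Finset.sum_congr rfl fun k _ => mul_comm _ _

end Triangular

/-! ### Vector fields on the unipotent group -/

variable (n R) in
/-- The generic unipotent upper triangular matrix. -/
def unip : Matrix (Fin n) (Fin n) (Fock n R) := Matrix.of fun i j =>
  if h : i < j then MvPolynomial.X (Sum.inr ⟨(i, j), h⟩) else if i = j then 1 else 0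

omit [Algebra ℂ R] in
theorem unip_lower (i j : Fin n) (h : j < i) : unip n R i j = 0 := by
  simp [unip, not_lt.mpr h.le, h.ne']

omit [Algebra ℂ R] in
theorem unip_diag (i : Fin n) : unip n R i i = 1 := by simp [unip]

omit [Algebra ℂ R] in
theorem unip_pair (p : Pairs n) : unip n R p.1.1 p.1.2 = MvPolynomial.X (Sum.inr p) := by
  simp [unip, p.2]

omit [Algebra ℂ R] in
theorem unip_det : (unip n R).det = 1 := by
  rw [Matrix.det_of_isUpperTriangular (fun i j h => unip_lower i j h)]
  simp [unip_diag]

omit [Algebra ℂ R] in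
theorem unip_mul_inv : unip n R * (unip n R)⁻¹ = 1 :=
  Matrix.mul_nonsing_inv _ (by rw [unip_det]; exact isUnit_one)

omit [Algebra ℂ R] in
theorem unip_inv_mul : (unip n R)⁻¹ * unip n R = 1 :=
  Matrix.nonsing_inv_mul _ (by rw [unip_det]; exact isUnit_one)

omit [Algebra ℂ R] in
theorem unip_inv_lower (i j : Fin n) (h : j < i) : (unip n R)⁻¹ i j = 0 := by
  have : Invertible (unip n R) := ⟨_, unip_inv_mul, unip_mul_inv⟩
  have := Matrix.blockTriangular_inv_of_blockTriangular (M := unip n R) (b := id)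
    (fun i j h => unip_lower i j h)
  exact this h

omit [Algebra ℂ R] in
theorem unip_inv_diag (i : Fin n) : (unip n R)⁻¹ i i = 1 := by
  have h := congrFun (congrFun (unip_mul_inv (n := n) (R := R)) i) i
  rwa [upper_mul_upper' unip_lower unip_inv_lower le_rfl, if_pos rfl, unip_diag, one_mul,
    Matrix.one_apply_eq] at h

/-- The matrix with constant polynomial entries. -/
def constMat (n : ℕ) (R : Type*) [CommRing R] [Algebra ℂ R] :
    Gl n →ₐ[ℂ] Matrix (Fin n) (Fin n) (Fock n R) :=
  (Algebra.ofId ℂ (Fock n R)).mapMatrix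

theorem constMat_apply (M : Gl n) (i j : Fin n) :
    constMat n R M i j = MvPolynomial.C (algebraMap ℂ R (M i j)) := rfl

variable (n R) in
/-- The conjugate `u M u⁻¹`. -/
def conj : Gl n →ₗ[ℂ] Matrix (Fin n) (Fin n) (Fock n R) :=
  LinearMap.mulRight ℂ (unip n R)⁻¹ ∘ₗ LinearMap.mulLeft ℂ (unip n R) ∘ₗ (constMat n R).toLinearMap

theorem conj_apply (M : Gl n) : conj n R M = unip n R * constMat n R M * (unip n R)⁻¹ := rfl

theorem conj_mul (M N : Gl n) : conj n R (M * N) = conj n R M * conj n R N := by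
  rw [conj_apply, conj_apply, conj_apply, map_mul]
  calc _ = unip n R * constMat n R M * 1 * constMat n R N * (unip n R)⁻¹ := by
        rw [mul_one]; simp only [mul_assoc]
    _ = _ := by rw [← unip_inv_mul]; simp only [mul_assoc]

theorem conj_mul_unip (M : Gl n) : conj n R M * unip n R = unip n R * constMat n R M := by
  rw [conj_apply, mul_assoc, unip_inv_mul, mul_one]

theorem conj_lower {M : Gl n} (hM : ∀ i j, j < i → M i j = 0) {i j : Fin n} (h : j ≤ i) :
    conj n R M i j = if i = j then MvPolynomial.C (algebraMap ℂ R (M i i)) else 0 := by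
  have hc : ∀ i j, j < i → constMat n R M i j = 0 := fun i j h => by
    rw [constMat_apply, hM i j h, map_zero, map_zero]
  have h1 : ∀ i j, j < i → (unip n R * constMat n R M) i j = 0 := fun i j h => by
    rw [upper_mul_upper' unip_lower hc h.le, if_neg h.ne']
  rw [conj_apply, upper_mul_upper' h1 unip_inv_lower h,
    upper_mul_upper' unip_lower hc le_rfl, unip_inv_diag, unip_diag, if_pos rfl, mul_one, one_mul,
    constMat_apply]

/-- The vector field by which `M ∈ gl_n` acts. -/
def field (M : Gl n) : Vect n R :=
  MvPolynomial.mkDerivation R (Sum.elim 0 fun p => (upper (conj n R M) * unip n R) p.1.1 p.1.2)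

theorem field_inl (M : Gl n) (i : Fin n) :
    field M (MvPolynomial.X (Sum.inl i) : Fock n R) = 0 := by
  rw [field, MvPolynomial.mkDerivation_X]; rfl

theorem field_inr (M : Gl n) (p : Pairs n) : field M (MvPolynomial.X (Sum.inr p) : Fock n R)
    = (upper (conj n R M) * unip n R) p.1.1 p.1.2 := by
  rw [field, MvPolynomial.mkDerivation_X]; rfl

theorem field_unip (M : Gl n) : (unip n R).map (field M) = upper (conj n R M) * unip n R := by
  ext1 i j
  rw [Matrix.map_apply]
  by_cases h : i < j
  · have := field_inr (R := R) M ⟨(i, j), h⟩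
    rwa [← unip_pair] at this
  · have h0 : field M (unip n R i j) = 0 := by
      rcases (not_lt.mp h).eq_or_lt with rfl | h
      · rw [unip_diag, Derivation.map_one_eq_zero]
      · rw [unip_lower _ _ h, map_zero]
    rw [h0, upper_mul_upper' (fun i j h => by rw [upper_apply, if_neg (not_lt.mpr h.le)])
      unip_lower (not_lt.mp h), upper_apply, if_neg (lt_irrefl _), zero_mul, ite_self]

omit [Algebra ℂ R] in
theorem map_inv_of_derivation (D : Vect n R)
    (P : Matrix (Fin n) (Fin n) (Fock n R)) (h : (unip n R).map D = P * unip n R) :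
    ((unip n R)⁻¹).map D = -((unip n R)⁻¹ * P) := by
  have h1 : ((1 : Matrix (Fin n) (Fin n) (Fock n R))).map D = 0 := by
    ext1 i j
    rw [Matrix.map_apply, Matrix.one_apply]
    split_ifs <;> simp
  rw [← unip_mul_inv, derivation_map_mul, h, mul_assoc, unip_mul_inv, mul_one] at h1
  have h2 := congrArg (fun M => (unip n R)⁻¹ * M) h1
  simp only [mul_add, ← mul_assoc, unip_inv_mul, one_mul, mul_zero] at h2
  exact eq_neg_of_add_eq_zero_right h2

theorem constMat_map (D : Vect n R) (M : Gl n) :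
    (constMat n R M).map D = 0 := by
  ext1 i j
  rw [Matrix.map_apply, constMat_apply, MvPolynomial.derivation_C]; rfl

theorem conj_map_of_derivation (D : Vect n R)
    (P : Matrix (Fin n) (Fin n) (Fock n R)) (h : (unip n R).map D = P * unip n R) (M : Gl n) :
    (conj n R M).map D = P * conj n R M - conj n R M * P := by
  rw [conj_apply, derivation_map_mul, derivation_map_mul, h, map_inv_of_derivation D P h,
    constMat_map]
  noncomm_ring

theorem field_conj (M N : Gl n) : (conj n R N).map (field M)
    = upper (conj n R M) * conj n R N - conj n R N * upper (conj n R M) :=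
  conj_map_of_derivation _ _ (field_unip M) N

omit [Algebra ℂ R] in
theorem upper_map (D : Vect n R)
    (M : Matrix (Fin n) (Fin n) (Fock n R)) : (upper M).map D = upper (M.map D) := by
  ext1 i j
  simp only [Matrix.map_apply, upper_apply]
  split_ifs <;> simp

/-- `field M` is infinitesimal right translation, `u (1 + sM) = (1 + s uMu⁻¹) u`, with the lower
triangular part of `uMu⁻¹` divided out on the left. The effect of this division on brackets is
`upper_commutator`. -/
theorem field_lie (M N : Gl n) : (field (M * N - N * M) : Vect n R)
    = ⁅(field M : Vect n R), (field N : Vect n R)⁆ := by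
  refine MvPolynomial.derivation_ext fun v => ?_
  rcases v with i | p
  · rw [Derivation.commutator_apply, field_inl, field_inl, field_inl, map_zero, map_zero, sub_zero]
  · rw [Derivation.commutator_apply, field_inr, field_inr, field_inr]
    have h1 := congrFun (congrFun (derivation_map_mul (D := field M) (upper (conj n R N))
      (unip n R)) p.1.1) p.1.2
    have h2 := congrFun (congrFun (derivation_map_mul (D := field N) (upper (conj n R M))
      (unip n R)) p.1.1) p.1.2
    rw [Matrix.map_apply] at h1 h2
    rw [h1, h2, ← Matrix.sub_apply, upper_map, upper_map, field_conj, field_conj, field_unip,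
      field_unip, map_sub, conj_mul, conj_mul, upper_commutator]
    refine congrFun (congrFun ?_ _) _
    simp only [sub_mul, add_mul, mul_assoc]
    abel

/-! ### The weight cocycle and the action of `𝒜` -/

variable (lam : Fin n → R)

/-- The cocycle by which the highest weight `lam` twists the action. -/
def cocycle : Gl n →ₗ[ℂ] Fock n R where
  toFun M := ∑ k, MvPolynomial.C (lam k) * conj n R M k k
  map_add' M N := by simp [mul_add, Finset.sum_add_distrib]
  map_smul' c M := by simp [Finset.smul_sum]

theorem cocycle_apply (M : Gl n) :
    cocycle lam M = ∑ k, MvPolynomial.C (lam k) * conj n R M k k := rfl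

theorem derivation_cocycle (D : Vect n R) (M : Gl n) :
    D (cocycle lam M) = ∑ k, MvPolynomial.C (lam k) * (conj n R M).map D k k := by
  rw [cocycle_apply, map_sum]
  refine Finset.sum_congr rfl fun k _ => ?_
  rw [Derivation.leibniz, MvPolynomial.derivation_C, smul_zero, add_zero, smul_eq_mul,
    Matrix.map_apply]

/-- The lower triangular part divided out by `field` acts through the character `lam` of its
diagonal, so the cocycle property is `diag_commutator`, weighted by `lam`. -/
theorem cocycle_lie (M N : Gl n) : cocycle lam (M * N - N * M)
    = field M (cocycle lam N) - field N (cocycle lam M) := by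
  rw [derivation_cocycle, derivation_cocycle, cocycle_apply, field_conj, field_conj,
    ← Finset.sum_sub_distrib]
  refine Finset.sum_congr rfl fun k _ => ?_
  rw [map_sub, conj_mul, conj_mul, diag_commutator, mul_sub]

/-- The action of `gl_n` on the dual Verma module. -/
def glAct (M : Gl n) : Module.End R (Fock n R) :=
  (field M).toLinearMap + LinearMap.mulLeft R (cocycle lam M)

theorem glAct_apply (M : Gl n) (f : Fock n R) :
    glAct lam M f = field M f + cocycle lam M * f := rfl

theorem field_add (M N : Gl n) :
    (field (M + N) : Vect n R) = field M + field N := by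
  refine MvPolynomial.derivation_ext fun v => ?_
  rcases v with i | p
  · rw [Derivation.add_apply, field_inl, field_inl, field_inl, add_zero]
  · rw [Derivation.add_apply, field_inr, field_inr, field_inr, map_add, map_add, add_mul,
      Matrix.add_apply]

theorem field_smul (c : ℂ) (M : Gl n) :
    (field (c • M) : Vect n R) = algebraMap ℂ R c • field M := by
  refine MvPolynomial.derivation_ext fun v => ?_
  rcases v with i | p
  · rw [Derivation.smul_apply, field_inl, field_inl, smul_zero]
  · rw [Derivation.smul_apply, field_inr, field_inr, map_smul,
      ← algebraMap_smul (Fock n R) c (conj n R M), map_smul, Matrix.smul_mul, Matrix.smul_apply,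
      ← algebraMap_smul (Fock n R) (algebraMap ℂ R c), ← IsScalarTower.algebraMap_apply]

/-- The dual Verma module as a homomorphism of Lie algebras. -/
def glRep : Gl n →ₗ⁅ℂ⁆ Module.End R (Fock n R) where
  toFun := glAct lam
  map_add' M N := by
    refine LinearMap.ext fun f => ?_
    rw [LinearMap.add_apply, glAct_apply, glAct_apply, glAct_apply, field_add, map_add,
      Derivation.add_apply]
    ring
  map_smul' c M := by
    refine LinearMap.ext fun f => ?_
    rw [RingHom.id_apply, LinearMap.smul_apply, glAct_apply, glAct_apply, field_smul, map_smul,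
      Derivation.smul_apply, smul_add, algebraMap_smul, smul_mul_assoc]
  map_lie' {M N} := by
    refine LinearMap.ext fun f => ?_
    rw [Ring.lie_def, Ring.lie_def, LinearMap.sub_apply, Module.End.mul_apply,
      Module.End.mul_apply]
    simp only [glAct_apply]
    rw [field_lie, cocycle_lie, Derivation.commutator_apply, map_add, map_add, Derivation.leibniz,
      Derivation.leibniz]
    simp only [smul_eq_mul]
    ring

variable (R) in
/-- Multiplication by `xⁱ`. -/
def mulX (i : Fin n) : Module.End R (Fock n R) := LinearMap.mulLeft R (MvPolynomial.X (Sum.inl i))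

variable (R) in
/-- The partial derivative with respect to `xⁱ`. -/
def derX (i : Fin n) : Module.End R (Fock n R) :=
  (MvPolynomial.pderiv (Sum.inl i) : Vect n R).toLinearMap

omit [Algebra ℂ R] in
theorem mulX_apply (i : Fin n) (f : Fock n R) : mulX R i f = MvPolynomial.X (Sum.inl i) * f := rfl

omit [Algebra ℂ R] in
theorem derX_apply (i : Fin n) (f : Fock n R) :
    derX R i f = MvPolynomial.pderiv (Sum.inl i) f := rfl

omit [Algebra ℂ R] in
theorem mulX_comm (i j : Fin n) : mulX R i * mulX R j = mulX R j * mulX R i := by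
  refine LinearMap.ext fun f => ?_
  simp only [Module.End.mul_apply, mulX_apply]
  ring

omit [Algebra ℂ R] in
theorem derX_comm (i j : Fin n) : derX R i * derX R j = derX R j * derX R i := by
  have h : ⁅(MvPolynomial.pderiv (Sum.inl i) : Vect n R),
      (MvPolynomial.pderiv (Sum.inl j) : Vect n R)⁆ = 0 := by
    refine MvPolynomial.derivation_ext fun v => ?_
    rw [Derivation.commutator_apply, MvPolynomial.pderiv_X, MvPolynomial.pderiv_X]
    simp only [Pi.single_apply]
    split_ifs <;> simp
  refine LinearMap.ext fun f => ?_
  have h2 := congrArg (fun D : Vect n R => D f) h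
  simp only [Derivation.commutator_apply] at h2
  exact sub_eq_zero.mp h2

omit [Algebra ℂ R] in
theorem derX_mulX (i j : Fin n) :
    derX R i * mulX R j = mulX R j * derX R i + if i = j then 1 else 0 := by
  refine LinearMap.ext fun f => ?_
  rw [LinearMap.add_apply]
  simp only [Module.End.mul_apply, mulX_apply, derX_apply]
  rw [Derivation.leibniz, smul_eq_mul, smul_eq_mul]
  congr 1
  by_cases hij : i = j
  · subst hij; rw [MvPolynomial.pderiv_X_self, if_pos rfl, mul_one]; rfl
  · rw [MvPolynomial.pderiv_X_of_ne (fun h => hij (Sum.inl_injective h).symm), if_neg hij,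
      mul_zero]; rfl

variable (n R) in
/-- The action of `Diff(n)` on polynomials. -/
def diffRep : Diff n →ₐ[ℂ] Module.End R (Fock n R) :=
  RingQuot.liftAlgHom ℂ ⟨FreeAlgebra.lift ℂ (Sum.elim (mulX R) (derX R)), by
      intro a b hab
      cases hab with
      | xx i j =>
        simp only [map_mul, FreeAlgebra.lift_ι_apply, Sum.elim_inl]
        exact mulX_comm i j
      | dd i j =>
        simp only [map_mul, FreeAlgebra.lift_ι_apply, Sum.elim_inr]
        exact derX_comm i j
      | dx i j =>
        simp only [map_mul, map_add, FreeAlgebra.lift_ι_apply, Sum.elim_inl, Sum.elim_inr]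
        rw [derX_mulX]
        split_ifs <;> simp⟩

theorem diffRep_x (i : Fin n) (f : Fock n R) :
    diffRep n R (x i) f = MvPolynomial.X (Sum.inl i) * f := by
  rw [diffRep, x, RingQuot.liftAlgHom_mkAlgHom_apply, FreeAlgebra.lift_ι_apply]; rfl

theorem diffRep_d (i : Fin n) (f : Fock n R) :
    diffRep n R (d i) f = MvPolynomial.pderiv (Sum.inl i) f := by
  rw [diffRep, d, RingQuot.liftAlgHom_mkAlgHom_apply, FreeAlgebra.lift_ι_apply]; rfl

omit [Algebra ℂ R] in
theorem pderiv_unip (i : Fin n) : (unip n R).map (MvPolynomial.pderiv (Sum.inl i)) = 0 := by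
  ext1 j k
  rw [Matrix.map_apply, unip, Matrix.of_apply]
  split_ifs <;> simp [MvPolynomial.pderiv_X]

theorem pderiv_conj (i : Fin n) (M : Gl n) :
    (conj n R M).map (MvPolynomial.pderiv (Sum.inl i)) = 0 := by
  rw [conj_map_of_derivation _ 0 (by rw [pderiv_unip, zero_mul])]; simp

theorem pderiv_field (i : Fin n) (M : Gl n) (f : Fock n R) :
    MvPolynomial.pderiv (Sum.inl i) (field M f) = field M (MvPolynomial.pderiv (Sum.inl i) f) := by
  have h : ⁅(MvPolynomial.pderiv (Sum.inl i) : Vect n R), (field M : Vect n R)⁆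
      = (0 : Vect n R) := by
    refine MvPolynomial.derivation_ext fun v => ?_
    rcases v with j | p
    · rw [Derivation.commutator_apply, field_inl (R := R), MvPolynomial.pderiv_X]
      simp only [Pi.single_apply]
      split_ifs <;> simp
    · rw [Derivation.commutator_apply, field_inr, MvPolynomial.pderiv_X]
      have h1 := congrFun (congrFun (derivation_map_mul (D := MvPolynomial.pderiv (Sum.inl i))
        (upper (conj n R M)) (unip n R)) p.1.1) p.1.2
      rw [Matrix.map_apply] at h1
      rw [h1, upper_map, pderiv_conj, pderiv_unip]
      simp
  have h2 := congrArg (fun D => D f) h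
  simp only [Derivation.commutator_apply] at h2
  exact sub_eq_zero.mp h2

theorem pderiv_cocycle (i : Fin n) (M : Gl n) :
    MvPolynomial.pderiv (Sum.inl i) (cocycle lam M) = 0 := by
  rw [derivation_cocycle, pderiv_conj]; simp

/-- `gl_n` acts only through the matrix coordinates and `Diff(n)` only through the `xⁱ`; it suffices
to compare generators. -/
theorem diffRep_commute (D : Diff n) (u : Ugl n) :
    Commute (diffRep n R D) (UniversalEnvelopingAlgebra.lift ℂ (glRep lam) u) := by
  have hgen : ∀ (M : Gl n) (D : Diff n), Commute (diffRep n R D) (glRep lam M) := by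
    intro M D
    have hD : D ∈ Algebra.adjoin ℂ (Set.range x ∪ Set.range d : Set (Diff n)) := by
      rw [Diff_adjoin]; trivial
    have := (Algebra.adjoin_le (S := (Subalgebra.centralizer ℂ {glRep lam M}).comap
      (diffRep n R)) ?_) hD
    · exact ((Subalgebra.mem_centralizer_iff ℂ).mp this _ rfl).symm
    · rintro _ (⟨i, rfl⟩ | ⟨i, rfl⟩)
      · refine (Subalgebra.mem_centralizer_iff ℂ).mpr ?_
        rintro _ rfl
        refine LinearMap.ext fun f => ?_
        change glAct lam M (diffRep n R (x i) f) = diffRep n R (x i) (glAct lam M f)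
        rw [diffRep_x, diffRep_x, glAct_apply, glAct_apply, Derivation.leibniz, field_inl,
          smul_zero, smul_eq_mul]
        ring
      · refine (Subalgebra.mem_centralizer_iff ℂ).mpr ?_
        rintro _ rfl
        refine LinearMap.ext fun f => ?_
        change glAct lam M (diffRep n R (d i) f) = diffRep n R (d i) (glAct lam M f)
        rw [diffRep_d, diffRep_d, glAct_apply, glAct_apply, map_add, Derivation.leibniz,
          pderiv_cocycle, smul_zero, smul_eq_mul, pderiv_field, add_zero]
  have hu := Ugl_mem (S := (Subalgebra.centralizer ℂ {diffRep n R D}).comap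
    (UniversalEnvelopingAlgebra.lift ℂ (glRep lam))) (fun i j => by
      refine (Subalgebra.mem_centralizer_iff ℂ).mpr ?_
      rintro _ rfl
      change diffRep n R D * UniversalEnvelopingAlgebra.lift ℂ (glRep lam) (e i j)
        = UniversalEnvelopingAlgebra.lift ℂ (glRep lam) (e i j) * diffRep n R D
      rw [e, UniversalEnvelopingAlgebra.lift_ι_apply]
      exact hgen _ D) u
  exact (Subalgebra.mem_centralizer_iff ℂ).mp hu _ rfl

/-- The action of `𝒜` on polynomials. -/
def repA : A n →ₐ[ℂ] Module.End R (Fock n R) :=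
  Algebra.TensorProduct.lift (diffRep n R) (UniversalEnvelopingAlgebra.lift ℂ (glRep lam))
    (diffRep_commute lam)

theorem repA_tmul_one (D : Diff n) : repA lam (D ⊗ₜ[ℂ] (1 : Ugl n)) = diffRep n R D := by
  rw [repA, Algebra.TensorProduct.lift_tmul, map_one, mul_one]

theorem repA_diagE (i j : Fin n) (f : Fock n R) : repA lam (diagE i j) f
    = MvPolynomial.X (Sum.inl i) * MvPolynomial.pderiv (Sum.inl j) f
      + (field (Matrix.single i j 1) f + cocycle lam (Matrix.single i j 1) * f) := by
  rw [repA, diagE, map_add, Algebra.TensorProduct.lift_tmul, Algebra.TensorProduct.lift_tmul,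
    map_one, map_one, mul_one, one_mul, LinearMap.add_apply, map_mul, Module.End.mul_apply,
    diffRep_x, diffRep_d, e, UniversalEnvelopingAlgebra.lift_ι_apply]
  rfl

/-! ### Weights, the vacuum vector and the vacuum functional -/

theorem cocycle_of_upper {M : Gl n} (hM : ∀ i j, j < i → M i j = 0) :
    cocycle lam M = MvPolynomial.C (∑ k, lam k * algebraMap ℂ R (M k k)) := by
  rw [cocycle_apply, map_sum]
  refine Finset.sum_congr rfl fun k _ => ?_
  rw [conj_lower hM le_rfl, if_pos rfl, map_mul]

theorem single_lower {i j : Fin n} (hij : i ≤ j) (k l : Fin n) (h : l < k) :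
    (Matrix.single i j 1 : Gl n) k l = 0 := by
  rw [Matrix.single_apply, if_neg]
  rintro ⟨rfl, rfl⟩
  exact absurd hij (not_le.mpr h)

theorem cocycle_E_upper {i j : Fin n} (hij : i < j) :
    cocycle lam (Matrix.single i j 1) = 0 := by
  rw [cocycle_of_upper lam (single_lower hij.le)]
  rw [Finset.sum_eq_zero, map_zero]
  intro k _
  rw [Matrix.single_apply, if_neg, map_zero, mul_zero]
  rintro ⟨rfl, h⟩
  exact hij.ne h.symm

theorem cocycle_E_diag (i : Fin n) :
    cocycle lam (Matrix.single i i 1) = MvPolynomial.C (lam i) := by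
  rw [cocycle_of_upper lam (single_lower le_rfl)]
  simp [Matrix.single_apply]

/-- The diagonal matrices act by scaling the variables. -/
theorem field_E_diag (i : Fin n) (p : Pairs n) :
    ∃ k : ℤ, field (Matrix.single i i 1) (MvPolynomial.X (Sum.inr p) : Fock n R)
      = k • MvPolynomial.X (Sum.inr p) := by
  -- Conjugating a diagonal matrix by `u` keeps its diagonal and creates only strictly upper
  -- entries. Hence the vector field is `u e_ii - e_ii u`, which scales each coordinate.
  have h1 : upper (conj n R (Matrix.single i i 1))
      = conj n R (Matrix.single i i 1) - constMat n R (Matrix.single i i 1) := by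
    ext1 k l
    rw [upper_apply, Matrix.sub_apply, constMat_apply]
    split_ifs with h
    · rw [Matrix.single_apply, if_neg, map_zero, map_zero, sub_zero]
      rintro ⟨rfl, rfl⟩
      exact lt_irrefl _ h
    · rw [conj_lower (single_lower le_rfl) (not_lt.mp h)]
      split_ifs with h2
      · rw [h2, sub_self]
      · rw [Matrix.single_apply, if_neg, map_zero, map_zero, sub_zero]
        rintro ⟨rfl, rfl⟩
        exact h2 rfl
  refine ⟨(if i = p.1.2 then 1 else 0) - (if i = p.1.1 then 1 else 0), ?_⟩
  rw [field_inr, h1, sub_mul, conj_mul_unip, Matrix.sub_apply, Matrix.mul_apply, Matrix.mul_apply]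
  have h2 : ∀ k l, constMat n R (Matrix.single i i 1) k l = if k = i ∧ l = i then 1 else 0 := by
    intro k l
    rw [constMat_apply, Matrix.single_apply]
    simp only [eq_comm (a := i)]
    split_ifs <;> simp
  simp only [h2]
  rw [Finset.sum_eq_single i (by intro k _ hk; simp [hk]) (by simp),
    Finset.sum_eq_single i (by intro k _ hk; simp [hk]) (by simp), sub_smul]
  congr 1
  · by_cases h : p.1.2 = i
    · rw [← unip_pair]; simp [h]
    · simp [h, Ne.symm h]
  · by_cases h : p.1.1 = i
    · rw [← unip_pair]; simp [h]
    · simp [h, Ne.symm h]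

omit [Algebra ℂ R] in
theorem derivation_monomial (D : Vect n R)
    (h : ∀ v, ∃ k : ℤ, D (MvPolynomial.X v) = k • MvPolynomial.X v) (s : Fin n ⊕ Pairs n →₀ ℕ) :
    ∃ k : ℤ, D (MvPolynomial.monomial s 1) = k • MvPolynomial.monomial s 1 := by
  induction s using Finsupp.induction_linear with
  | zero =>
    refine ⟨0, ?_⟩
    rw [zero_smul]
    exact Derivation.map_one_eq_zero D
  | add s t hs ht =>
    obtain ⟨a, ha⟩ := hs
    obtain ⟨b, hb⟩ := ht
    refine ⟨a + b, ?_⟩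
    have : (MvPolynomial.monomial (s + t) (1 : R)) = MvPolynomial.monomial s 1
        * MvPolynomial.monomial t 1 := by rw [MvPolynomial.monomial_mul, mul_one]
    rw [this, Derivation.leibniz, ha, hb]
    simp only [zsmul_eq_mul, smul_eq_mul]
    push_cast
    ring
  | single v m =>
    obtain ⟨a, ha⟩ := h v
    refine ⟨m * a, ?_⟩
    have h1 : MvPolynomial.monomial (Finsupp.single v m) (1 : R) = MvPolynomial.X v ^ m := by
      rw [MvPolynomial.X_pow_eq_monomial]
    rw [h1, Derivation.leibniz_pow, ha]
    rcases m with _ | m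
    · simp
    · simp only [zsmul_eq_mul, smul_eq_mul, nsmul_eq_mul, Nat.add_sub_cancel]
      push_cast
      ring

theorem repA_diagE_monomial (i : Fin n) (s : Fin n ⊕ Pairs n →₀ ℕ) :
    ∃ k : ℤ, repA lam (diagE i i) (MvPolynomial.monomial s 1)
      = (lam i + k) • MvPolynomial.monomial s 1 := by
  have h1 : ∀ v, ∃ k : ℤ, ((MvPolynomial.X (Sum.inl i) : Fock n R) •
      MvPolynomial.pderiv (Sum.inl i) : Vect n R) (MvPolynomial.X v)
        = k • MvPolynomial.X v := by
    intro v
    by_cases hv : v = Sum.inl i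
    · subst hv
      exact ⟨1, by rw [Derivation.smul_apply, MvPolynomial.pderiv_X_self]; simp⟩
    · exact ⟨0, by rw [Derivation.smul_apply, MvPolynomial.pderiv_X_of_ne hv]; simp⟩
  have h2 : ∀ v, ∃ k : ℤ, field (Matrix.single i i 1) (MvPolynomial.X v : Fock n R)
        = k • MvPolynomial.X v := by
    rintro (j | p)
    · exact ⟨0, by rw [field_inl, zero_smul]⟩
    · exact field_E_diag i p
  obtain ⟨a, ha⟩ := derivation_monomial _ h1 s
  obtain ⟨b, hb⟩ := derivation_monomial _ h2 s
  rw [Derivation.smul_apply, smul_eq_mul] at ha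
  refine ⟨a + b, ?_⟩
  rw [repA_diagE, ha, hb, cocycle_E_diag, MvPolynomial.smul_eq_C_mul]
  simp only [zsmul_eq_mul, map_add, map_intCast, Int.cast_add]
  ring

/-- Monomials are joint eigenvectors of the diagonal `h_i` with eigenvalues in `lam i + ℤ`. A
denominator is thus diagonal with unit entries, and its inverse is defined on the monomial basis. -/
theorem repA_denoms (hlam : ∀ i j, i ≠ j → ∀ k : ℤ, IsUnit (lam i - lam j + k)) (s : denoms n) :
    IsUnit (repA lam (s : A n)) := by
  obtain ⟨_, i, j, k, hij, rfl⟩ := s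
  have h : ∀ s, ∃ c : R, IsUnit c ∧ repA lam (diagE i i - diagE j j + algebraMap ℂ (A n) k)
      (MvPolynomial.monomial s 1) = c • MvPolynomial.monomial s 1 := by
    intro s
    obtain ⟨a, ha⟩ := repA_diagE_monomial lam i s
    obtain ⟨b, hb⟩ := repA_diagE_monomial lam j s
    refine ⟨_, hlam i j hij (k + a - b), ?_⟩
    rw [map_add, map_sub, AlgHom.commutes, LinearMap.add_apply, LinearMap.sub_apply, ha, hb,
      Module.algebraMap_end_apply, ← algebraMap_smul R (k : ℂ), ← sub_smul, ← add_smul, map_intCast]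
    congr 1
    push_cast
    ring
  choose c hc hs using h
  let b := MvPolynomial.basisMonomials (Fin n ⊕ Pairs n) R
  let g : Module.End R (Fock n R) := b.constr R fun s => Ring.inverse (c s) • b s
  have hb : ∀ s, b s = MvPolynomial.monomial s 1 := fun s => by
    simp [b, MvPolynomial.coe_basisMonomials]
  have hg : ∀ s, g (b s) = Ring.inverse (c s) • b s := fun s => b.constr_basis R _ s
  rw [isUnit_iff_exists]
  refine ⟨g, b.ext fun s => ?_, b.ext fun s => ?_⟩
  · rw [Module.End.mul_apply, hg, map_smul, hb, hs, smul_smul, Ring.inverse_mul_cancel _ (hc s),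
      one_smul]; rfl
  · rw [Module.End.mul_apply, hb, hs, map_smul, ← hb, hg, smul_smul, Ring.mul_inverse_cancel _ (hc s),
      one_smul]; rfl

/-- The action of `𝒜̄` on polynomials. -/
def repAbar (hlam : ∀ i j, i ≠ j → ∀ k : ℤ, IsUnit (lam i - lam j + k)) :
    Abar n →ₐ[ℂ] Module.End R (Fock n R) :=
  locLiftUnit (denoms n) (repA lam) (repA_denoms lam hlam)

theorem repAbar_toAbar (hlam : ∀ i j, i ≠ j → ∀ k : ℤ, IsUnit (lam i - lam j + k)) (a : A n) :
    repAbar lam hlam (toAbar n a) = repA lam a := by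
  rw [repAbar, toAbar, locLiftUnit_locMap]

omit [Algebra ℂ R] in
theorem constantCoeff_derivation (D : Vect n R)
    (h : ∀ v, MvPolynomial.constantCoeff (D (MvPolynomial.X v)) = 0) (f : Fock n R) :
    MvPolynomial.constantCoeff (D f) = 0 := by
  induction f using MvPolynomial.induction_on with
  | C a => rw [MvPolynomial.derivation_C, map_zero]
  | add p q hp hq => rw [map_add, map_add, hp, hq, add_zero]
  | mul_X p v hp =>
    rw [Derivation.leibniz, map_add, smul_eq_mul, smul_eq_mul, map_mul, map_mul, h, hp, mul_zero,
      mul_zero, add_zero]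

omit [Algebra ℂ R] in
theorem unip_constantCoeff :
    (MvPolynomial.constantCoeff (R := R)).mapMatrix (unip n R) = 1 := by
  ext i j
  rw [RingHom.mapMatrix_apply, Matrix.map_apply, unip, Matrix.of_apply, Matrix.one_apply]
  by_cases h : i < j
  · simp [h, h.ne]
  · by_cases h2 : i = j <;> simp [h, h2]

theorem conj_constantCoeff (M : Gl n) :
    (MvPolynomial.constantCoeff (R := R)).mapMatrix (conj n R M) = M.map (algebraMap ℂ R) := by
  have h1 : (MvPolynomial.constantCoeff (R := R)).mapMatrix (unip n R)⁻¹ = 1 := by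
    have := congrArg (MvPolynomial.constantCoeff (R := R)).mapMatrix
      (unip_mul_inv (n := n) (R := R))
    rwa [map_mul, unip_constantCoeff, one_mul, map_one] at this
  rw [conj_apply, map_mul, map_mul, unip_constantCoeff, h1, one_mul, mul_one]
  ext i j
  rw [RingHom.mapMatrix_apply, Matrix.map_apply, constMat_apply, MvPolynomial.constantCoeff_C,
    Matrix.map_apply]

/-- At `u = 1` the conjugate of `M` is `M` itself, with no strictly upper part. The vector field
therefore vanishes there and the cocycle is the weight of the diagonal. -/
theorem constantCoeff_glAct {M : Gl n} (hM : ∀ i j, i < j → M i j = 0) (f : Fock n R) :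
    MvPolynomial.constantCoeff (field M f + cocycle lam M * f)
      = (∑ k, lam k * algebraMap ℂ R (M k k)) * MvPolynomial.constantCoeff f := by
  have h1 : ∀ i j, MvPolynomial.constantCoeff (conj n R M i j) = algebraMap ℂ R (M i j) :=
    fun i j => congrFun (congrFun (conj_constantCoeff M) i) j
  rw [map_add, constantCoeff_derivation, zero_add, map_mul, cocycle_apply, map_sum]
  · congr 1
    refine Finset.sum_congr rfl fun k _ => ?_
    rw [map_mul, h1, MvPolynomial.constantCoeff_C]
  · rintro (i | p)
    · rw [field_inl, map_zero]
    · rw [field_inr, Matrix.mul_apply, map_sum]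
      refine Finset.sum_eq_zero fun k _ => ?_
      rw [map_mul, upper_apply]
      split_ifs with h
      · rw [h1, hM _ _ h, map_zero, zero_mul]
      · rw [map_zero, zero_mul]

theorem constantCoeff_repA_diagE {i j : Fin n} (hij : j ≤ i) (f : Fock n R) :
    MvPolynomial.constantCoeff (repA lam (diagE i j) f)
      = (if i = j then lam i else 0) * MvPolynomial.constantCoeff f := by
  rw [repA_diagE, map_add, map_mul, MvPolynomial.constantCoeff_X, zero_mul, zero_add,
    constantCoeff_glAct]
  · congr 1
    split_ifs with h
    · subst h; simp [Matrix.single_apply]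
    · refine Finset.sum_eq_zero fun k _ => ?_
      rw [Matrix.single_apply, if_neg, map_zero, mul_zero]
      rintro ⟨rfl, rfl⟩
      exact h rfl
  · intro k l hkl
    rw [Matrix.single_apply, if_neg]
    rintro ⟨rfl, rfl⟩
    exact absurd hij (not_le.mpr hkl)

theorem repA_diagE_one {i j : Fin n} (hij : i ≤ j) :
    repA lam (diagE i j) 1 = if i = j then (MvPolynomial.C (lam i) : Fock n R) else 0 := by
  rw [repA_diagE, Derivation.map_one_eq_zero, Derivation.map_one_eq_zero, mul_zero, zero_add,
    zero_add, mul_one]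
  split_ifs with h
  · subst h; exact cocycle_E_diag lam i
  · exact cocycle_E_upper lam (lt_of_le_of_ne hij h)

end DualVerma

/-! ### The vacuum expectation value -/

section Expectation

variable (n) in
/-- `h_i` as an element of `Ū(h)`. -/
def hBar (i : Fin n) : UhBar n := algebraMap (Uh n) (UhBar n) (MvPolynomial.X i)

variable (n) in
/-- The action of `𝒜̄` on polynomials over `Ū(h)`, with the universal highest weight. -/
def rep : Abar n →ₐ[ℂ] Module.End (UhBar n) (Fock n (UhBar n)) :=
  repAbar (hBar n) fun _ _ hij k => isUnit_root hij k

theorem rep_toAbar (a : A n) : rep n (toAbar n a) = repA (hBar n) a :=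
  repAbar_toAbar _ _ _

theorem rep_one (f : Fock n (UhBar n)) : rep n 1 f = f := by rw [map_one (rep n)]; rfl

theorem rep_E (i j : Fin n) : rep n (E i j) = repA (hBar n) (diagE i j) := rep_toAbar _

theorem rep_E_one_of_lt {i j : Fin n} (h : i < j) : rep n (E i j) 1 = 0 := by
  rw [rep_E, repA_diagE_one _ h.le, if_neg h.ne]

theorem rep_db_one (i : Fin n) : rep n (db i) 1 = 0 := by
  have h : rep n (db i) = repA (hBar n) (d i ⊗ₜ[ℂ] (1 : Ugl n)) := rep_toAbar _
  rw [h, repA_tmul_one, diffRep_d,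
    Derivation.map_one_eq_zero]

theorem constantCoeff_rep_xb (i : Fin n) (f : Fock n (UhBar n)) :
    MvPolynomial.constantCoeff (rep n (xb i) f) = 0 := by
  have h : rep n (xb i) = repA (hBar n) (x i ⊗ₜ[ℂ] (1 : Ugl n)) := rep_toAbar _
  rw [h, repA_tmul_one, diffRep_x, map_mul,
    MvPolynomial.constantCoeff_X, zero_mul]

theorem constantCoeff_rep_E_of_lt {i j : Fin n} (h : j < i) (f : Fock n (UhBar n)) :
    MvPolynomial.constantCoeff (rep n (E i j) f) = 0 := by
  rw [rep_E, constantCoeff_repA_diagE _ h.le, if_neg h.ne', zero_mul]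

theorem rep_mul (a b : Abar n) (f : Fock n (UhBar n)) :
    rep n (a * b) f = rep n a (rep n b f) := by
  rw [map_mul, Module.End.mul_apply]

theorem rep_add (a b : Abar n) (f : Fock n (UhBar n)) :
    rep n (a + b) f = rep n a f + rep n b f := by
  rw [map_add, LinearMap.add_apply]

theorem constantCoeff_rep_uhMap (c : UhBar n) : ∀ f : Fock n (UhBar n),
    MvPolynomial.constantCoeff (rep n (uhMap n c) f) = c * MvPolynomial.constantCoeff f := by
  induction c using UhBar_induction with
  | hC c =>
    intro f
    rw [uhMap_C, AlgHom.commutes, Module.algebraMap_end_apply, ← algebraMap_smul (UhBar n) c,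
      MvPolynomial.constantCoeff_smul]
    rfl
  | hX i =>
    intro f
    rw [uhMap_X, rep_E, constantCoeff_repA_diagE _ le_rfl, if_pos rfl]
    rfl
  | hadd a b ha hb => intro f; rw [map_add, rep_add, map_add, ha, hb, add_mul]
  | hmul a b ha hb => intro f; rw [map_mul, rep_mul, ha, hb, mul_assoc]
  | hinv a b hab ha =>
    intro f
    have h := ha (rep n (uhMap n b) f)
    rw [← rep_mul, ← map_mul, hab, map_one, map_one, Module.End.one_apply] at h
    rw [h, ← mul_assoc, mul_comm b, hab, one_mul]

theorem rep_uhMap_one (c : UhBar n) : rep n (uhMap n c) 1 = MvPolynomial.C c := by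
  induction c using UhBar_induction with
  | hC c =>
    rw [uhMap_C, AlgHom.commutes, Module.algebraMap_end_apply, Algebra.smul_def, mul_one]
    rfl
  | hX i => rw [uhMap_X, rep_E, repA_diagE_one _ le_rfl, if_pos rfl]; rfl
  | hadd a b ha hb => rw [map_add, rep_add, ha, hb, map_add]
  | hmul a b ha hb =>
    rw [map_mul, rep_mul, hb, ← mul_one (MvPolynomial.C b), ← MvPolynomial.smul_eq_C_mul, map_smul,
      ha, MvPolynomial.smul_eq_C_mul, ← map_mul, mul_comm]
  | hinv a b hab ha =>
    have h : rep n (uhMap n b) (rep n (uhMap n a) 1) = 1 := by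
      rw [← rep_mul, ← map_mul, mul_comm, hab, map_one (uhMap n), rep_one]
    rw [ha, ← mul_one (MvPolynomial.C a), ← MvPolynomial.smul_eq_C_mul, map_smul] at h
    have h2 := congrArg (fun f => b • f) h
    simp only [smul_smul, mul_comm b, hab, one_smul] at h2
    rw [h2, MvPolynomial.smul_eq_C_mul, mul_one]

variable (n) in
/-- The vacuum expectation value on `𝒜̄`. -/
def vev : Abar n →ₗ[ℂ] UhBar n where
  toFun a := MvPolynomial.constantCoeff (rep n a 1)
  map_add' a b := by rw [rep_add, map_add]
  map_smul' c a := by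
    rw [map_smul, LinearMap.smul_apply, ← algebraMap_smul (UhBar n) c (rep n a 1),
      MvPolynomial.constantCoeff_smul, algebraMap_smul, RingHom.id_apply]

theorem vev_apply (a : Abar n) : vev n a = MvPolynomial.constantCoeff (rep n a 1) := rfl

theorem vev_uhMap_mul (c : UhBar n) (a : Abar n) : vev n (uhMap n c * a) = c * vev n a := by
  rw [vev_apply, rep_mul, constantCoeff_rep_uhMap, vev_apply]

theorem vev_mul_uhMap (c : UhBar n) (a : Abar n) : vev n (a * uhMap n c) = c * vev n a := by
  rw [vev_apply, rep_mul, rep_uhMap_one, ← mul_one (MvPolynomial.C c), ← MvPolynomial.smul_eq_C_mul,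
    map_smul, MvPolynomial.constantCoeff_smul, smul_eq_mul, vev_apply]

/-- Lowering elements are killed by the evaluation at the origin, raising elements by the vacuum
vector `1`. -/
theorem vev_J : Jminus n ⊔ Jplus n ≤ LinearMap.ker (vev n) := by
  refine sup_le (Submodule.span_le.mpr ?_) (Submodule.span_le.mpr ?_)
  · rintro _ ⟨a, i, j, hij, rfl⟩
    exact LinearMap.mem_ker.mpr (by rw [vev_apply, rep_mul, constantCoeff_rep_E_of_lt hij])
  · rintro _ ⟨a, i, j, hij, rfl⟩
    exact LinearMap.mem_ker.mpr (by rw [vev_apply, rep_mul, rep_E_one_of_lt hij, map_zero, map_zero])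

variable (n) in
/-- The vacuum expectation value on `Z̄`. -/
def vevZ : Zbar n →ₗ[ℂ] UhBar n := (Jminus n ⊔ Jplus n).liftQ (vev n) vev_J

theorem vevZ_toZ (a : Abar n) : vevZ n (toZ n a) = vev n a := rfl

theorem vevZ_ofUh (c : UhBar n) : vevZ n (ofUh c) = c := by
  rw [ofUh, vevZ_toZ, ← mul_one (uhMap n c), vev_uhMap_mul, vev_apply, rep_one, map_one, mul_one]

end Expectation

/-! ### Annihilation of the vacuum by the normalizer representatives -/

section Covector

variable {B R : Type*} [Ring B] [CommRing R]

/-- `covNorm` is a sum of terms `η(c) w_i b`, so annihilation properties of the `w_i` pass to it. -/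
theorem covNorm_mem {η : R →+* B} {F : Fin n → Fin n → B} {w : Fin n → B} {t : Fin n → R}
    {G : AddSubgroup B} (hw : ∀ k, w k ∈ G) (hr : ∀ a ∈ G, ∀ b, a * b ∈ G)
    (hl : ∀ a ∈ G, ∀ c, η c * a ∈ G) (k : Fin n) : covNorm η F w t k ∈ G := by
  have h1 : ∀ m k, covPow F w m k ∈ G := by
    intro m
    induction m with
    | zero => exact hw
    | succ m ih => exact fun k => sum_mem fun i _ => hr _ (ih i) _
  have h2 : ∀ l k m, covProd η F w t l k m ∈ G := by
    intro l
    induction l with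
    | zero => exact fun k m => h1 m k
    | succ l ih => exact fun k m => sub_mem (ih k _) (hl _ (ih k m) _)
  exact hl _ (h2 _ _ _) _

end Covector

theorem constantCoeff_rep_xMinus (k : Fin n) (f : Fock n (UhBar n)) :
    MvPolynomial.constantCoeff (rep n (xMinus k) f) = 0 := by
  let G : AddSubgroup (Abar n) :=
    { carrier := {a | ∀ f, MvPolynomial.constantCoeff (rep n a f) = 0}
      add_mem' := fun {a b} ha hb f => by rw [rep_add, map_add, ha, hb, add_zero]
      zero_mem' := fun f => by rw [map_zero, LinearMap.zero_apply, map_zero]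
      neg_mem' := fun {a} ha f => by rw [map_neg, LinearMap.neg_apply, map_neg, ha, neg_zero] }
  exact covNorm_mem (G := G) (fun k f => constantCoeff_rep_xb _ f)
    (fun a ha b f => by rw [rep_mul, ha])
    (fun a ha c f => by rw [rep_mul, constantCoeff_rep_uhMap, ha, mul_zero]) k.rev f

/-- Applying `ε` to the terms `c xⁱ b` of `xMinus k` gives `ε(b) ∂ᵢ c`. Here `c` acts on `1` as a
scalar, and `∂ᵢ` kills `1`. -/
theorem rep_dPlus_one (k : Fin n) : rep n (dPlus k) 1 = 0 := by
  let G : AddSubgroup (Abar n) :=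
    { carrier := {a | rep n (eps n a) 1 = 0}
      add_mem' := fun {a b} ha hb => by
        change rep n (eps n (a + b)) 1 = 0
        rw [map_add, rep_add, ha, hb, add_zero]
      zero_mem' := by
        change rep n (eps n 0) 1 = 0
        rw [map_zero, map_zero, LinearMap.zero_apply]
      neg_mem' := fun {a} ha => by
        change rep n (eps n (-a)) 1 = 0
        rw [map_neg, map_neg, LinearMap.neg_apply, ha, neg_zero] }
  refine covNorm_mem (G := G) (fun k => ?_) (fun a ha b => ?_) (fun a ha c => ?_) k.rev
  · change rep n (eps n _) 1 = 0
    rw [eps_xb, rep_db_one]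
  · change rep n (eps n _) 1 = 0
    rw [eps_mul, rep_mul, ha, map_zero]
  · change rep n (eps n _) 1 = 0
    rw [eps_mul, rep_mul, eps_uhMap, rep_uhMap_one, ← mul_one (MvPolynomial.C c),
      ← MvPolynomial.smul_eq_C_mul, map_smul, ha, smul_zero]

/-! ### The ideals `I_∂` and `I_x` -/

theorem colon_x (i : Fin n) : colon (x i) = toZ n (xb i) := rfl

theorem colon_d (i : Fin n) : colon (d i) = toZ n (db i) := rfl

theorem vevZ_Idel : Idel n ≤ LinearMap.ker (vevZ n) := by
  refine Submodule.span_le.mpr ?_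
  rintro _ ⟨z, i, rfl⟩
  obtain ⟨a, rfl⟩ := toZ_surjective z
  refine LinearMap.mem_ker.mpr ?_
  rw [colon_d, ← toZ_dPlus, dia_of_normPlus a (normPlus_dPlus i), vevZ_toZ, vev_apply, rep_mul,
    rep_dPlus_one, map_zero, map_zero]

theorem vevZ_Ix : Ix n ≤ LinearMap.ker (vevZ n) := by
  refine Submodule.span_le.mpr ?_
  rintro _ ⟨z, i, rfl⟩
  obtain ⟨a, rfl⟩ := toZ_surjective z
  refine LinearMap.mem_ker.mpr ?_
  rw [colon_x, ← toZ_xMinus, dia_of_normMinus (normMinus_xMinus i), vevZ_toZ, vev_apply, rep_mul,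
    constantCoeff_rep_xMinus]

theorem epsZ_Idel {z : Zbar n} (hz : z ∈ Idel n) : epsZ n z ∈ Ix n := by
  have : Idel n ≤ (Ix n).comap (epsZ n) := by
    refine Submodule.span_le.mpr ?_
    rintro _ ⟨z, i, rfl⟩
    refine Submodule.subset_span ⟨epsZ n z, i, ?_⟩
    rw [epsZ_dia, colon_d, colon_x, epsZ_toZ, eps_db]
  exact this hz

theorem epsZ_Ix {z : Zbar n} (hz : z ∈ Ix n) : epsZ n z ∈ Idel n := by
  have : Ix n ≤ (Idel n).comap (epsZ n) := by
    refine Submodule.span_le.mpr ?_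
    rintro _ ⟨z, i, rfl⟩
    refine Submodule.subset_span ⟨epsZ n z, i, ?_⟩
    rw [epsZ_dia, colon_d, colon_x, epsZ_toZ, eps_xb]
  exact this hz

theorem dia_Idel (u : Zbar n) {z : Zbar n} (hz : z ∈ Idel n) : dia u z ∈ Idel n := by
  have : Idel n ≤ (Idel n).comap (diaLin n u) := by
    refine Submodule.span_le.mpr ?_
    rintro _ ⟨z, i, rfl⟩
    exact Submodule.subset_span ⟨dia u z, i, (dia_assoc _ _ _).symm⟩
  exact this hz

theorem Ix_dia {z : Zbar n} (hz : z ∈ Ix n) (u : Zbar n) : dia z u ∈ Ix n := by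
  have : Ix n ≤ (Ix n).comap ((diaLin n).flip u) := by
    refine Submodule.span_le.mpr ?_
    rintro _ ⟨z, i, rfl⟩
    exact Submodule.subset_span ⟨dia z u, i, dia_assoc _ _ _⟩
  exact this hz

theorem uhMap_dia_Ix {z : Zbar n} (hz : z ∈ Ix n) (c : UhBar n) : dia (ofUh c) z ∈ Ix n := by
  have : Ix n ≤ (Ix n).comap (diaLin n (ofUh c)) := by
    refine Submodule.span_le.mpr ?_
    rintro _ ⟨z, i, rfl⟩
    refine Submodule.subset_span ⟨dia (ofUh (shift (Pi.single i 1) c)) z, i, ?_⟩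
    rw [diaLin_apply, ← dia_assoc, ← dia_assoc, colon_x, uhMap_dia, (hasWt_xb i).uhMap_mul, dia_uhMap]
  exact this hz

/-- The class of an ordinary product `xⁱ a` need not be the `⋄`-product of the classes, but the two
differ triangularly: `xMinus k * D` represents a `⋄`-product, and `covPow_mul_mem` with all of `𝒜̄`
as `𝒟` does the rest. -/
theorem toZ_xb_mul (i : Fin n) (a : Abar n) : toZ n (xb i * a) ∈ Ix n := by
  have h := covectorX.covPow_mul_mem (G := ((Ix n).comap (toZ n)).toAddSubgroup)
    (fun a ha => by
      change toZ n a ∈ Ix n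
      rw [toZ_eq_zero.mpr ((le_sup_left : Jminus n ≤ _) ha)]; exact zero_mem _)
    (fun c a ha => by
      change toZ n _ ∈ Ix n
      rw [← uhMap_dia]
      exact uhMap_dia_Ix ha c) Set.univ
    (fun D _ i k _ => ⟨Erev i k * D, trivial, fun b => by rw [sub_self, mul_zero]; exact zero_mem _⟩)
    (fun D _ k => by
      change toZ n _ ∈ Ix n
      refine Submodule.subset_span ⟨toZ n D, k.rev, ?_⟩
      rw [colon_x, ← toZ_xMinus, dia_of_normMinus (normMinus_xMinus _), xMinus, Fin.rev_rev])
    i.rev a trivial 0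
  rw [covPow, Fin.rev_rev] at h
  exact h

theorem toZ_mul_db (i : Fin n) (a : Abar n) : toZ n (a * db i) ∈ Idel n := by
  have h := epsZ_Ix (toZ_xb_mul i (eps n a))
  rwa [epsZ_toZ, eps_mul, eps_eps, eps_xb] at h

/-- Every differential operator is a constant modulo `x Diff(n) + Diff(n) ∂`. -/
theorem gens_pow_normalOrder (m : ℕ) {G : Submodule ℂ (Abar n)} (h1 : 1 ∈ G)
    (hx : ∀ i a, xb i * a ∈ G) (hd : ∀ i a, a * db i ∈ G) : gens n ^ m ≤ G := by
  let W : Submodule ℂ (Abar n) := Submodule.span ℂ {a | ∃ (l : List (Fin n)), a = (l.map xb).prod}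
    ⊔ Submodule.span ℂ {a | ∃ b i, a = b * db i}
  have hdW : ∀ b i, b * db i ∈ W := fun b i =>
    (le_sup_right : Submodule.span ℂ {a | ∃ b i, a = b * db i} ≤ W)
      (Submodule.subset_span ⟨b, i, rfl⟩)
  have hlW : ∀ l : List (Fin n), (l.map xb).prod ∈ W := fun l =>
    (le_sup_left : Submodule.span ℂ {a | ∃ (l : List (Fin n)), a = (l.map xb).prod} ≤ W)
      (Submodule.subset_span ⟨l, rfl⟩)
  have hmul : ∀ g : Abar n, (∀ l : List (Fin n), g * (l.map xb).prod ∈ W) → ∀ a ∈ W, g * a ∈ W := by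
    intro g hg a ha
    have : W ≤ W.comap (LinearMap.mulLeft ℂ g) := by
      refine sup_le (Submodule.span_le.mpr ?_) (Submodule.span_le.mpr ?_)
      · rintro _ ⟨l, rfl⟩; exact hg l
      · rintro _ ⟨b, i, rfl⟩
        change g * (b * db i) ∈ W
        rw [← mul_assoc]; exact hdW _ _
    exact this ha
  have hxW : ∀ i, ∀ a ∈ W, xb i * a ∈ W := fun i => hmul _ fun l => by
    have := hlW (i :: l)
    rwa [List.map_cons, List.prod_cons] at this
  have hdl : ∀ i, ∀ l : List (Fin n), db i * (l.map xb).prod ∈ W := by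
    intro i l
    induction l with
    | nil => rw [List.map_nil, List.prod_nil, mul_one, ← one_mul (db i)]; exact hdW 1 i
    | cons j l ih =>
      rw [List.map_cons, List.prod_cons, ← mul_assoc, db_mul_xb, add_mul, mul_assoc]
      refine add_mem (hxW j _ ih) ?_
      split_ifs
      · rw [one_mul]; exact hlW l
      · rw [zero_mul]; exact zero_mem _
  have hW : gens n ^ m ≤ W := by
    induction m with
    | zero =>
      rw [pow_zero, Submodule.one_le]
      have := hlW []
      rwa [List.map_nil, List.prod_nil] at this
    | succ m ih =>
      exact gens_pow_succ_le (fun i D hD => hxW i D (ih hD)) fun i D hD => hmul _ (hdl i) D (ih hD)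
  refine hW.trans (sup_le (Submodule.span_le.mpr ?_) (Submodule.span_le.mpr ?_))
  · rintro _ ⟨l, rfl⟩
    rcases l with _ | ⟨i, l⟩
    · rw [List.map_nil, List.prod_nil]; exact h1
    · rw [List.map_cons, List.prod_cons]; exact hx i _
  · rintro _ ⟨b, i, rfl⟩; exact hd i b

/-- Modulo the ideals `J̄`, every element is a sum of terms `D c` with `D` a differential operator.
Normal ordering `D` leaves a constant, terms starting with some `xⁱ` and terms ending in some `∂ᵢ`.
-/
theorem exists_vacuum_part (y : Zbar n) : ∃ c, y - ofUh c ∈ Idel n ⊔ Ix n := by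
  obtain ⟨a, rfl⟩ := toZ_surjective y
  let G : Submodule ℂ (Abar n) :=
    { carrier := {a | ∃ c, toZ n a - ofUh c ∈ Idel n ⊔ Ix n}
      add_mem' := by
        rintro a b ⟨c, hc⟩ ⟨c', hc'⟩
        refine ⟨c + c', ?_⟩
        rw [map_add, ofUh, map_add, map_add, add_sub_add_comm]
        exact add_mem hc hc'
      zero_mem' := ⟨0, by rw [ofUh, map_zero, map_zero, map_zero, sub_zero]; exact zero_mem _⟩
      smul_mem' := by
        rintro r a ⟨c, hc⟩
        refine ⟨algebraMap ℂ _ r * c, ?_⟩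
        rw [ofUh, map_mul, uhMap_algebraMap, ← Algebra.smul_def, map_smul, map_smul, ← smul_sub]
        exact Submodule.smul_mem _ _ hc }
  refine mem_of_normalForm (G := G) (fun a ha => ⟨0, ?_⟩) (fun m D hD c => ?_) a
  · rw [toZ_eq_zero.mpr ha, ofUh, map_zero, zero_sub]
    exact neg_mem (by rw [map_zero]; exact zero_mem _)
  · refine gens_pow_normalOrder m (G := G.comap (LinearMap.mulRight ℂ (uhMap n c))) ?_ ?_ ?_ hD
    · refine ⟨c, ?_⟩
      rw [LinearMap.mulRight_apply, one_mul, ofUh, sub_self]; exact zero_mem _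
    · intro i a
      refine ⟨0, ?_⟩
      rw [LinearMap.mulRight_apply, mul_assoc, ofUh, map_zero, map_zero, sub_zero]
      exact (le_sup_right : Ix n ≤ _) (toZ_xb_mul i _)
    · intro i a
      refine ⟨0, ?_⟩
      -- The right coefficient `c` must cross `∂ᵢ` to leave `∂ᵢ` in last place. The shift by `+1`
      -- cancels the one caused by the weight of `∂ᵢ`.
      have h := (hasWt_db i).uhMap_mul (shift (Pi.single i 1) c)
      have h2 : shift (-Pi.single i 1) (shift (Pi.single i 1) c) = c := by
        have : (shift (-Pi.single i 1)).comp (shift (Pi.single i 1)) = RingHom.id (UhBar n) := by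
          refine IsLocalization.ringHom_ext (K n) (MvPolynomial.ringHom_ext (fun c => ?_) fun j => ?_)
          · simp only [RingHom.comp_apply, shift_C, RingHom.id_apply]
          · simp only [RingHom.comp_apply, shift_X, RingHom.id_apply, map_add, map_intCast,
              Pi.neg_apply, Int.cast_neg]
            ring
        exact RingHom.congr_fun this c
      rw [LinearMap.mulRight_apply, ofUh, map_zero, map_zero, sub_zero, mul_assoc]
      rw [h2] at h
      rw [← h, ← mul_assoc]
      exact (le_sup_left : Idel n ≤ _) (toZ_mul_db i _)

/-- The functional vanishes on both ideals and splits `ofUh`. This gives the uniqueness of `y⁽⁰⁾`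
and a way to compute it. -/
theorem vevZ_eq {y : Zbar n} {c : UhBar n} (h : y - ofUh c ∈ Idel n ⊔ Ix n) : vevZ n y = c := by
  have := (sup_le vevZ_Idel vevZ_Ix : Idel n ⊔ Ix n ≤ _) h
  rw [LinearMap.mem_ker, map_sub, vevZ_ofUh] at this
  exact sub_eq_zero.mp this

/-- The form is the vacuum expectation value of `ε(z) ⋄ w`. -/
theorem form_toPh (z w : Zbar n) : form (toPh n z) (toPh n w) = vevZ n (dia (epsZ n z) w) := by
  have hex : ∃ c, IsFormValue (toPh n z) (toPh n w) c := by
    obtain ⟨c, hc⟩ := exists_vacuum_part (dia (epsZ n z) w)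
    exact ⟨c, z, w, rfl, rfl, hc⟩
  rw [form, dif_pos hex]
  obtain ⟨z', w', hz, hw, h⟩ := hex.choose_spec
  rw [← vevZ_eq h]
  have hz' : z' - z ∈ Idel n := (Submodule.Quotient.eq _).mp hz
  have hw' : w' - w ∈ Idel n := (Submodule.Quotient.eq _).mp hw
  -- Other representatives change the product by terms in `I_x` and `I_∂`: `ε` carries `I_∂` into
  -- the right ideal `I_x`, and `I_∂` is a left ideal.
  have e : dia (epsZ n z') w' = dia (epsZ n z) w + (dia (epsZ n (z' - z)) w
      + dia (epsZ n z') (w' - w)) := by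
    simp only [← diaLin_apply, map_sub, LinearMap.sub_apply]
    abel
  have h1 : vevZ n (dia (epsZ n (z' - z)) w) = 0 := vevZ_Ix (Ix_dia (epsZ_Idel hz') w)
  have h2 : vevZ n (dia (epsZ n z') (w' - w)) = 0 := vevZ_Idel (dia_Idel _ hw')
  rw [e, map_add, map_add, h1, h2, add_zero, add_zero]

/-! ### The triangular recursion for the action of `∂_k` on monomials -/

section Recursion

variable {R : Type*} [CommRing R]

/-- The scalars by which the covectors `∂ Eᵐ` act on monomials. -/
def redPow (t s : Fin n → R) : ℕ → Fin n → R
  | 0, _ => 1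
  | m + 1, k => t k * redPow t s m k + ∑ i ∈ Finset.Iio k, s i * redPow t s m i

/-- The scalars by which the covectors `∂ Eᵐ ∏_{j < l} (E - t_j)` act on monomials. -/
def redProd (t s : Fin n → R) : ℕ → Fin n → ℕ → R
  | 0, k, m => redPow t s m k
  | l + 1, k, m => redProd t s l k (m + 1) - extendZero t l * redProd t s l k m

variable (t s : Fin n → R)

theorem redProd_succ (l : ℕ) (q : Fin n) (m : ℕ) : redProd t s l q (m + 1)
    = t q * redProd t s l q m + ∑ i ∈ Finset.Iio q, s i * redProd t s l i m := by
  induction l generalizing m with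
  | zero => rfl
  | succ l ih =>
    simp only [redProd]
    rw [ih (m + 1), ih m]
    simp only [mul_sub, Finset.sum_sub_distrib, mul_add, Finset.mul_sum]
    simp only [mul_left_comm (extendZero t l)]
    ring

/-- The scalar counterpart of `covProd_mem`. -/
theorem redProd_eq_zero (l : ℕ) (q : Fin n) (hq : (q : ℕ) < l) (m : ℕ) :
    redProd t s l q m = 0 := by
  induction l generalizing q m with
  | zero => omega
  | succ l ih =>
    rcases Nat.lt_succ_iff_lt_or_eq.mp hq with h | h
    · rw [redProd, ih q h, ih q h, mul_zero, sub_zero]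
    · rw [redProd, redProd_succ, ← h, extendZero_val, h, add_sub_cancel_left]
      refine Finset.sum_eq_zero fun i hi => ?_
      rw [ih i (by have := Finset.mem_Iio.mp hi; omega), mul_zero]

/-- The recursion multiplies the row `(1, …, 1)` repeatedly by the upper triangular matrix with
diagonal `t_i` and entries `s_i` in row `i` above the diagonal. Since `y` is a column eigenvector
for `θ`, pairing with it replaces the matrix by `θ`. -/
theorem redProd_eigen (θ : R) (y : Fin n → R)
    (hy : ∀ i, t i * y i + s i * ∑ q ∈ Finset.Ioi i, y q = θ * y i) (l : ℕ) :
    ∑ i, redProd t s l i 0 * y i = charProd t θ l * ∑ i, y i := by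
  have h1 : ∀ l m, ∑ i, redProd t s l i (m + 1) * y i = θ * ∑ i, redProd t s l i m * y i := by
    intro l m
    rw [Finset.mul_sum]
    simp only [redProd_succ, add_mul, Finset.sum_add_distrib, Finset.sum_mul]
    rw [Finset.sum_comm' (t' := Finset.univ) (s' := fun i => Finset.Ioi i) (by simp),
      ← Finset.sum_add_distrib]
    refine Finset.sum_congr rfl fun i _ => ?_
    rw [← Finset.mul_sum, mul_left_comm, ← hy]
    ring
  have h2 : ∀ l m, ∑ i, redProd t s l i m * y i = charProd t θ l * ∑ i, redProd t s 0 i m * y i := by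
    intro l
    induction l with
    | zero => intro m; simp [charProd]
    | succ l ih =>
      intro m
      have h3 : charProd t θ (l + 1) = charProd t θ l * (θ - extendZero t l) := by
        rw [charProd, charProd, Finset.prod_range_succ]
      simp only [redProd, sub_mul, Finset.sum_sub_distrib, mul_assoc]
      rw [h1, ← Finset.mul_sum, ih, h3]
      simp only [redProd]
      ring
  rw [h2]
  congr 1
  exact Finset.sum_congr rfl fun i _ => by rw [redProd, redPow, one_mul]

/-- In the expansion of the product, the nonempty subsets of `A` are grouped by their least element
`i`. -/
theorem prod_one_add_eq (r : Fin n → R) (A : Finset (Fin n)) : ∏ i ∈ A, (1 + r i)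
    = 1 + ∑ i ∈ A, r i * ∏ j ∈ A with i < j, (1 + r j) := by
  induction A using Finset.induction_on_min with
  | empty => simp
  | insert a A ha ih =>
    have h0 : a ∉ A := fun h => lt_irrefl a (ha a h)
    have h1 : {j ∈ insert a A | a < j} = A := by
      rw [Finset.filter_insert, if_neg (lt_irrefl a), Finset.filter_true_of_mem ha]
    have h2 : ∀ i ∈ A, {j ∈ insert a A | i < j} = {j ∈ A | i < j} := fun i hi => by
      rw [Finset.filter_insert, if_neg (ha i hi).not_gt]
    rw [Finset.prod_insert h0, Finset.sum_insert h0, h1,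
      Finset.sum_congr rfl fun i hi => by rw [h2 i hi], add_left_comm, ← ih]
    ring

/-- For an eigenvector `y` for `t_k` supported on indices at most `k` with `y_k = 1`, the pairing of
`redProd_eigen` reduces to its `k`-th term, because the components below `k` vanish by
`redProd_eq_zero`. -/
theorem redProd_self (k : Fin n) (r : Fin n → R) (hr : ∀ i, i < k → r i * (t k - t i) = s i) :
    redProd t s k k 0 = charProd t (t k) k * ∏ i ∈ Finset.Iio k, (1 + r i) := by
  -- The eigenvector equation reads `y_i = r_i ∑_{q>i} y_q`. Solved downwards from `y_k = 1`, its
  -- tail sums telescope into products by `prod_one_add_eq`.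
  let y : Fin n → R := fun i => if i < k then r i * ∏ j ∈ Finset.Ioo i k, (1 + r j)
    else if i = k then 1 else 0
  have hyk : y k = 1 := by simp [y]
  have hlt : ∀ i, i < k → y i = r i * ∏ j ∈ Finset.Ioo i k, (1 + r j) := fun i h => by simp [y, h]
  have hgt : ∀ i, k < i → y i = 0 := fun i h => by simp [y, h.not_gt, h.ne']
  have hsum : ∀ A : Finset (Fin n), (∀ i ∈ A, i < k) → (∀ i ∈ A, ∀ j, i < j → j < k → j ∈ A) →
      ∑ i ∈ A, y i + 1 = ∏ i ∈ A, (1 + r i) := by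
    intro A hA hA'
    rw [prod_one_add_eq, add_comm]
    congr 1
    refine Finset.sum_congr rfl fun i hi => ?_
    rw [hlt i (hA i hi)]
    congr 1
    refine Finset.prod_congr ?_ fun _ _ => rfl
    ext j
    simp only [Finset.mem_Ioo, Finset.mem_filter]
    exact ⟨fun h => ⟨hA' i hi j h.1 h.2, h.1⟩, fun h => ⟨h.2, hA j h.1⟩⟩
  have hIoi : ∀ i, i < k → ∑ q ∈ Finset.Ioi i, y q = ∏ j ∈ Finset.Ioo i k, (1 + r j) := by
    intro i hi
    rw [← hsum (Finset.Ioo i k) (fun j hj => (Finset.mem_Ioo.mp hj).2)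
      (fun j hj l hjl hl => Finset.mem_Ioo.mpr ⟨(Finset.mem_Ioo.mp hj).1.trans hjl, hl⟩), ← hyk,
      Finset.sum_Ioo_add_eq_sum_Ioc hi]
    symm
    refine Finset.sum_subset (fun j hj => Finset.mem_Ioi.mpr (Finset.mem_Ioc.mp hj).1)
      fun j hj hj' => hgt j ?_
    simp only [Finset.mem_Ioi, Finset.mem_Ioc, not_and, not_le] at hj hj'
    exact hj' hj
  have htot : ∑ i, y i = ∏ i ∈ Finset.Iio k, (1 + r i) := by
    rw [← hsum (Finset.Iio k) (fun j hj => Finset.mem_Iio.mp hj)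
      (fun j hj l hjl hl => Finset.mem_Iio.mpr hl), ← hyk, Finset.sum_Iio_add_eq_sum_Iic]
    symm
    refine Finset.sum_subset (Finset.subset_univ _) fun j _ hj => hgt j ?_
    simpa using hj
  have h := redProd_eigen t s (t k) y (fun i => by
    rcases lt_trichotomy i k with h | rfl | h
    · rw [hIoi i h, hlt i h, ← hr i h]; ring
    · rw [Finset.sum_eq_zero (fun q hq => hgt q (Finset.mem_Ioi.mp hq)), mul_zero, add_zero]
    · rw [Finset.sum_eq_zero (fun q hq => hgt q (h.trans (Finset.mem_Ioi.mp hq))), hgt i h]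
      ring) k
  rw [htot] at h
  rw [← h, Finset.sum_eq_single k, hyk, mul_one]
  · intro i _ hi
    rcases lt_or_gt_of_ne hi with hi | hi
    · rw [redProd_eq_zero t s k i hi, zero_mul]
    · rw [hgt i hi, mul_zero]
  · simp

end Recursion

/-! ### Monomials -/

/-- One unit is removed at the largest index of the support, so variables are added in increasing
order. This is the order in which left `⋄`-multiplication by `xᵏ` needs no correction. -/
theorem multiIndex_induction {P : (Fin n → ℕ) → Prop} (h0 : P 0)
    (hs : ∀ κ k, (∀ l, k < l → κ l = 0) → P κ → P (κ + Pi.single k 1)) (κ : Fin n → ℕ) : P κ := by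
  generalize hN : ∑ i, κ i = N
  induction N generalizing κ with
  | zero =>
    have : κ = 0 := by
      ext i
      exact (Finset.sum_eq_zero_iff.mp hN) i (Finset.mem_univ i)
    rwa [this]
  | succ N ih =>
    have hne : {i | κ i ≠ 0}.toFinset.Nonempty := by
      by_contra h
      simp [Finset.filter_eq_empty_iff] at h
      simp [h] at hN
    obtain ⟨k, hk, hmax⟩ := Finset.exists_max_image _ id hne
    rw [Set.mem_toFinset, Set.mem_ofPred_eq] at hk
    have h1 : κ - Pi.single k 1 + Pi.single k 1 = κ := by
      ext i
      by_cases hi : i = k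
      · subst hi; simp; omega
      · simp [hi]
    rw [← h1]
    refine hs _ _ (fun l hl => ?_) (ih _ ?_)
    · rw [Pi.sub_apply, Pi.single_eq_of_ne hl.ne', tsub_zero]
      by_contra h
      exact hl.not_ge (hmax l (by simpa using h))
    · have h2 : ∑ i, (κ - Pi.single k 1 + Pi.single k 1 : Fin n → ℕ) i = N + 1 := by rw [h1, hN]
      simp only [Pi.add_apply, Finset.sum_add_distrib] at h2
      simpa using h2

theorem prod_ofFn_succ {M : Type*} [Monoid M] {m : ℕ} (a : Fin m → M)
    (ha : ∀ i j, a i * a j = a j * a i) (κ : Fin m → ℕ) (k : Fin m) :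
    (List.ofFn fun i => a i ^ (κ + Pi.single k 1 : Fin m → ℕ) i).prod
      = a k * (List.ofFn fun i => a i ^ κ i).prod := by
  induction m with
  | zero => exact k.elim0
  | succ m ih =>
    rw [List.ofFn_succ, List.ofFn_succ, List.prod_cons, List.prod_cons]
    refine Fin.cases ?_ (fun k => ?_) k
    · rw [Pi.add_apply, Pi.single_eq_same, pow_succ', mul_assoc]
      simp
    · have h := ih (fun i => a i.succ) (fun i j => ha _ _) (fun i => κ i.succ) k
      have h2 : ∀ i : Fin m, (κ + Pi.single k.succ 1 : Fin (m + 1) → ℕ) i.succ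
          = ((fun i : Fin m => κ i.succ) + Pi.single k 1 : Fin m → ℕ) i := by
        intro i
        by_cases hi : i = k
        · subst hi; simp
        · simp [hi]
      simp only [h2]
      rw [h, ← mul_assoc, ← mul_assoc]
      congr 1
      have h3 : (κ + Pi.single k.succ 1 : Fin (m + 1) → ℕ) 0 = κ 0 := by
        simp [(Fin.succ_ne_zero k).symm]
      rw [h3]
      exact (Commute.pow_left (ha 0 k.succ) _).eq

/-- The monomial `x^κ` in `𝒜̄`. -/
def monoBar (κ : Fin n → ℕ) : Abar n := toAbar n (mono κ ⊗ₜ[ℂ] (1 : Ugl n))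

theorem colon_mono (κ : Fin n → ℕ) : colon (mono κ) = toZ n (monoBar κ) := rfl

theorem monoBar_zero : monoBar (0 : Fin n → ℕ) = 1 := by
  have : mono (0 : Fin n → ℕ) = 1 := by
    simp [mono]
  rw [monoBar, this, ← Algebra.TensorProduct.one_def, map_one]

theorem monoBar_add (κ : Fin n → ℕ) (k : Fin n) :
    monoBar (κ + Pi.single k 1) = xb k * monoBar κ := by
  rw [monoBar, mono, prod_ofFn_succ x x_mul_x, monoBar, xb, ← map_mul,
    Algebra.TensorProduct.tmul_mul_tmul, one_mul, mono]

theorem hasWt_monoBar (κ : Fin n → ℕ) : HasWt (fun i => (κ i : ℤ)) (monoBar κ) := by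
  induction κ using multiIndex_induction with
  | h0 => rw [monoBar_zero]; exact hasWt_one
  | hs κ k _ ih =>
    rw [monoBar_add]
    convert (hasWt_xb k).mul ih using 1
    ext i
    by_cases hi : i = k
    · subst hi; simp [add_comm]
    · simp [hi]

theorem monoBar_sub {κ : Fin n → ℕ} {k : Fin n} (h : κ k ≠ 0) :
    xb k * monoBar (κ - Pi.single k 1) = monoBar κ := by
  rw [← monoBar_add]
  congr 1
  ext i
  by_cases hi : i = k
  · subst hi; simp; omega
  · simp [hi]

theorem sub_single_add {κ : Fin n → ℕ} {j k : Fin n} (h : j ≠ k) :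
    κ + Pi.single k 1 - Pi.single j 1 = κ - Pi.single j 1 + Pi.single k 1 := by
  ext i
  by_cases hi : i = k
  · subst hi; simp [h.symm]
  · simp [hi]

theorem E_mul_monoBar (i j : Fin n) (κ : Fin n → ℕ) : E i j * monoBar κ
    = monoBar κ * E i j + (κ j : Abar n) * (xb i * monoBar (κ - Pi.single j 1)) := by
  induction κ using multiIndex_induction with
  | h0 => simp [monoBar_zero]
  | hs κ k _ ih =>
    rw [monoBar_add, ← mul_assoc, E_mul_xb, add_mul, mul_assoc, ih, mul_add, ← mul_assoc, add_assoc]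
    congr 1
    by_cases hjk : j = k
    · subst hjk
      rw [if_pos rfl, Pi.add_apply, Pi.single_eq_same, add_tsub_cancel_right]
      push_cast
      rw [add_mul, one_mul]
      congr 1
      -- When `κ_j = 0` the truncated subtraction gives a wrong exponent, but its coefficient is
      -- zero.
      by_cases h0 : κ j = 0
      · simp [h0]
      · rw [← mul_assoc, ← (Nat.cast_commute _ (xb j)).eq, mul_assoc, ← mul_assoc (xb j),
          xb_mul_xb, mul_assoc, monoBar_sub h0]
    · rw [if_neg hjk, zero_mul, add_zero, sub_single_add hjk, monoBar_add, Pi.add_apply,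
        Pi.single_eq_of_ne hjk, add_zero, ← mul_assoc, ← (Nat.cast_commute _ (xb k)).eq, mul_assoc,
        ← mul_assoc (xb k), xb_mul_xb, mul_assoc]

theorem db_mul_monoBar (i : Fin n) (κ : Fin n → ℕ) : db i * monoBar κ
    = monoBar κ * db i + (κ i : Abar n) * monoBar (κ - Pi.single i 1) := by
  induction κ using multiIndex_induction with
  | h0 => simp [monoBar_zero]
  | hs κ k _ ih =>
    rw [monoBar_add, ← mul_assoc, db_mul_xb, add_mul, mul_assoc, ih, mul_add, ← mul_assoc, add_assoc]
    congr 1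
    by_cases hjk : i = k
    · subst hjk
      rw [if_pos rfl, Pi.add_apply, Pi.single_eq_same, add_tsub_cancel_right]
      push_cast
      rw [add_mul, one_mul]
      congr 1
      by_cases h0 : κ i = 0
      · simp [h0]
      · rw [← mul_assoc, ← (Nat.cast_commute _ (xb i)).eq, mul_assoc, monoBar_sub h0]
    · rw [if_neg hjk, zero_mul, add_zero, sub_single_add hjk, monoBar_add, Pi.add_apply,
        Pi.single_eq_of_ne hjk, add_zero, ← mul_assoc, ← (Nat.cast_commute _ (xb k)).eq, mul_assoc]

theorem E_mul_monoBar_add (i j : Fin n) (σ : Fin n → ℕ) : E i j * monoBar (σ + Pi.single j 1)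
    = monoBar (σ + Pi.single j 1) * E i j
      + ((σ j + 1 : ℕ) : Abar n) * monoBar (σ + Pi.single i 1) := by
  rw [E_mul_monoBar, add_tsub_cancel_right, ← monoBar_add, Pi.add_apply, Pi.single_eq_same]

/-! ### The action of `x` and `∂` on monomials -/

/-- The corrections in `xMinus k` involve `E_kl` with `l > k`. These commute with `x^σ` because `σ_l
= 0`, and so they land in `J̄₊`. -/
theorem toZ_monoBar_add {σ : Fin n → ℕ} {k : Fin n} (hσ : ∀ l, k < l → σ l = 0) :
    toZ n (monoBar (σ + Pi.single k 1)) = dia (toZ n (xb k)) (toZ n (monoBar σ)) := by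
  have h := covectorX.covNorm_mul_mod (G := (Jminus n ⊔ Jplus n).toAddSubgroup)
    (fun a ha => (le_sup_left : Jminus n ≤ _) ha) (fun c a ha => uhMap_mul_J ha c) (monoBar σ) k.rev
    (fun i hi m => by
      have h1 : k < i.rev := by rw [← Fin.rev_rev k]; exact Fin.rev_lt_rev.mpr hi
      have h2 := E_mul_monoBar k i.rev σ
      rw [hσ _ h1, Nat.cast_zero, zero_mul, add_zero] at h2
      rw [mul_assoc, Erev, Fin.rev_rev, ring_neg_mul, h2, ← ring_mul_neg, ← mul_assoc, ring_mul_neg]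
      exact (le_sup_right : Jplus n ≤ _) (neg_mem (mul_E_mem_Jplus h1 _)))
  rw [Fin.rev_rev] at h
  rw [← toZ_xMinus, dia_of_normMinus (normMinus_xMinus k), monoBar_add]
  exact (toZ_eq.mpr h).symm

/-- The elements whose double coset lies in `I_∂`. -/
def idelPre (n : ℕ) : AddSubgroup (Abar n) := ((Idel n).comap (toZ n)).toAddSubgroup

theorem mem_idelPre {a : Abar n} : a ∈ idelPre n ↔ toZ n a ∈ Idel n := Iff.rfl

theorem uhMap_mul_idelPre (c : UhBar n) {a : Abar n} (ha : a ∈ idelPre n) :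
    uhMap n c * a ∈ idelPre n := by
  rw [mem_idelPre, ← uhMap_dia]
  exact dia_Idel _ ha

theorem J_le_idelPre {a : Abar n} (ha : a ∈ Jminus n ⊔ Jplus n) : a ∈ idelPre n := by
  rw [mem_idelPre, toZ_eq_zero.mpr ha]; exact zero_mem _

/-- The integers `σ_i + 1` as elements of `Ū(h)`. -/
def succBar (σ : Fin n → ℕ) (i : Fin n) : UhBar n := ((σ i + 1 : ℕ) : UhBar n)

/-- Modulo `J̄₊`, the raising element `E_ji` turns `x^{σ+e_i}` into `(σ_i+1) x^{σ+e_j}`. So the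
off-diagonal terms of `covPow_succ_mod` reproduce the same statement for `j < i`, with precisely the
recursion of `redPow`. -/
theorem covPow_mul_monoBar (σ : Fin n → ℕ) (m : ℕ) (i : Fin n) :
    covPow E db m i * monoBar (σ + Pi.single i 1)
      - uhMap n (succBar σ i * redPow cartD (succBar σ) m i) * monoBar σ ∈ idelPre n := by
  induction m generalizing i with
  | zero =>
    have h : covPow E db 0 i * monoBar (σ + Pi.single i 1)
      - uhMap n (succBar σ i * redPow cartD (succBar σ) 0 i) * monoBar σ
      = monoBar (σ + Pi.single i 1) * db i := by
      rw [covPow, db_mul_monoBar, add_tsub_cancel_right, redPow, mul_one, succBar, map_natCast,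
        Pi.add_apply, Pi.single_eq_same, add_sub_cancel_right]
    rw [h]
    exact toZ_mul_db i _
  | succ m ih =>
    have h1 := J_le_idelPre ((le_sup_left : Jminus n ≤ _)
      (Jminus_mul (covectorD.covPow_succ_mod m i) (monoBar (σ + Pi.single i 1))))
    have h2 := uhMap_mul_idelPre (cartD i) (ih i)
    have h3 : ∀ j ∈ Finset.Iio i, covPow E db m j * E j i * monoBar (σ + Pi.single i 1)
        - uhMap n (succBar σ i * (succBar σ j * redPow cartD (succBar σ) m j)) * monoBar σ
          ∈ idelPre n := by
      intro j hj
      have h4 := uhMap_mul_idelPre (succBar σ i) (ih j)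
      have h5 := J_le_idelPre ((le_sup_right : Jplus n ≤ _) (mul_E_mem_Jplus (Finset.mem_Iio.mp hj)
        (covPow E db m j * monoBar (σ + Pi.single i 1))))
      have h6 := add_mem h5 h4
      rw [mul_sub, ← mul_assoc, ← mul_assoc, ← map_mul, ← add_sub_assoc] at h6
      convert h6 using 2
      have h7 : uhMap n (succBar σ i) = ((σ i + 1 : ℕ) : Abar n) := by rw [succBar, map_natCast]
      rw [mul_assoc, E_mul_monoBar_add, mul_add, h7, ← mul_assoc, ← mul_assoc,
        (Nat.cast_commute (σ i + 1) (covPow E db m j)).eq]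
    have h8 := add_mem (add_mem h1 h2) (sum_mem h3)
    convert h8 using 1
    rw [redPow, Finset.sum_sub_distrib, ← Finset.sum_mul, ← Finset.sum_mul, ← map_sum,
      ← Finset.mul_sum, mul_add, map_add, add_mul, mul_left_comm (succBar σ i) (cartD i),
      map_mul (uhMap n) (cartD i)]
    simp only [sub_mul, mul_sub, mul_assoc]
    abel

theorem covProd_mul_monoBar (σ : Fin n → ℕ) (l : ℕ) (i : Fin n) (m : ℕ) :
    covProd (uhMap n) E db cartD l i m * monoBar (σ + Pi.single i 1)
      - uhMap n (succBar σ i * redProd cartD (succBar σ) l i m) * monoBar σ ∈ idelPre n := by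
  induction l generalizing m with
  | zero => exact covPow_mul_monoBar σ m i
  | succ l ih =>
    have h := sub_mem (ih (m + 1)) (uhMap_mul_idelPre (extendZero cartD l) (ih m))
    convert h using 1
    rw [covProd, redProd, mul_sub, map_sub, mul_left_comm, map_mul (uhMap n) (extendZero cartD l)]
    simp only [sub_mul, mul_sub, mul_assoc]
    abel

/-- The coefficient in `∂_k ⋄ :x^{σ + e_k}: ≡ c :x^σ:`. -/
def lowerCoeff (σ : Fin n → ℕ) (k : Fin n) : UhBar n := succBar σ k *
  ∏ i ∈ Finset.Iio k, (1 + succBar σ i * Ring.inverse (cartD k - cartD i))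

/-- The normalizing factor of `dMinus k` cancels the characteristic product in `redProd_self`. -/
theorem db_dia_monoBar (σ : Fin n → ℕ) (k : Fin n) :
    dia (toZ n (db k)) (toZ n (monoBar (σ + Pi.single k 1)))
      - toZ n (uhMap n (lowerCoeff σ k) * monoBar σ) ∈ Idel n := by
  rw [← toZ_dMinus, dia_of_normMinus (normMinus_dMinus k), ← map_sub]
  have h := uhMap_mul_idelPre (Ring.inverse (charProd cartD (cartD k) k))
    (covProd_mul_monoBar σ k k 0)
  rw [redProd_self cartD (succBar σ) k (fun i => succBar σ i * Ring.inverse (cartD k - cartD i))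
    (fun i hi => by
      rw [mul_assoc, Ring.inverse_mul_cancel _ (covectorD.unit i k hi.ne), mul_one]),
    mul_sub, ← mul_assoc, ← mul_assoc, ← map_mul, mul_left_comm (succBar σ k), ← mul_assoc,
    Ring.inverse_mul_cancel _ (covectorD.isUnit_charProd k), one_mul] at h
  exact h

/-! ### The form on monomials -/

theorem vevZ_ofUh_dia (c : UhBar n) (y : Zbar n) : vevZ n (dia (ofUh c) y) = c * vevZ n y := by
  obtain ⟨a, rfl⟩ := toZ_surjective y
  rw [uhMap_dia, vevZ_toZ, vevZ_toZ, vev_uhMap_mul]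

theorem vevZ_dia_ofUh (c : UhBar n) (y : Zbar n) : vevZ n (dia y (ofUh c)) = c * vevZ n y := by
  obtain ⟨a, rfl⟩ := toZ_surjective y
  rw [dia_uhMap, vevZ_toZ, vevZ_toZ, vev_mul_uhMap]

/-- The form on monomials. -/
def monoForm (ν ν' : Fin n → ℕ) : UhBar n :=
  vevZ n (dia (toZ n (eps n (monoBar ν))) (toZ n (monoBar ν')))

theorem form_monoPh (ν ν' : Fin n → ℕ) : form (monoPh ν) (monoPh ν') = monoForm ν ν' := by
  rw [monoPh, monoPh, form_toPh, colon_mono, colon_mono, epsZ_toZ, monoForm]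

/-- Inserting `h_i` between the two factors and moving it out to either side gives `h_i + ν_i` or
`h_i + ν'_i` times the form. The difference is a nonzero complex number. -/
theorem monoForm_of_ne {ν ν' : Fin n → ℕ} (h : ν ≠ ν') : monoForm ν ν' = 0 := by
  obtain ⟨i, hi⟩ := Function.ne_iff.mp h
  have h1 : dia (toZ n (eps n (monoBar ν) * E i i)) (toZ n (monoBar ν'))
      = dia (toZ n (eps n (monoBar ν))) (toZ n (E i i * monoBar ν')) := by
    rw [← uhMap_X, ← dia_uhMap, ← uhMap_dia, dia_assoc]
  have h2 : eps n (monoBar ν) * E i i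
      = uhMap n (shift (fun i => (ν i : ℤ)) (hBar n i)) * eps n (monoBar ν) := by
    rw [← eps_E, ← eps_mul, ← uhMap_X, (hasWt_monoBar ν).uhMap_mul, eps_mul, eps_uhMap]; rfl
  rw [h2, ← uhMap_X, (hasWt_monoBar ν').uhMap_mul, ← dia_uhMap, ← uhMap_dia, dia_assoc,
    ← dia_assoc _ _ (ofUh _)] at h1
  have h3 := congrArg (vevZ n) h1
  rw [vevZ_ofUh_dia, vevZ_dia_ofUh, hBar, shift_X, shift_X, ← sub_eq_zero, ← sub_mul,
    add_sub_add_left_eq_sub] at h3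
  have h4 : ((ν i : ℤ) : UhBar n) - ((ν' i : ℤ) : UhBar n)
      = algebraMap ℂ (UhBar n) ((ν i : ℂ) - (ν' i : ℂ)) := by
    rw [map_sub, map_natCast, map_natCast, Int.cast_natCast, Int.cast_natCast]
  rw [h4, ← Algebra.smul_def, smul_eq_zero] at h3
  rcases h3 with h3 | h3
  · exact absurd (by exact_mod_cast sub_eq_zero.mp h3) hi
  · exact h3

theorem monoForm_zero : monoForm (0 : Fin n → ℕ) 0 = 1 := by
  have h : (1 : Abar n) = uhMap n 1 := (map_one _).symm
  rw [monoForm, monoBar_zero, eps_one, h]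
  change vevZ n (dia (ofUh 1) (ofUh 1)) = 1
  rw [vevZ_dia_ofUh, vevZ_ofUh, one_mul]

/-- The left argument is `xᵏ ⋄ :x^σ:`, so `ε` moves `∂_k` onto the right argument. The coefficient
it produces is shifted by the weight of `x^σ` on its way out to the right. -/
theorem monoForm_add {σ : Fin n → ℕ} {k : Fin n} (hσ : ∀ l, k < l → σ l = 0) :
    monoForm (σ + Pi.single k 1) (σ + Pi.single k 1)
      = shift (fun i => (σ i : ℤ)) (lowerCoeff σ k) * monoForm σ σ := by
  have h1 := congrArg (epsZ n) (toZ_monoBar_add hσ)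
  rw [epsZ_toZ, epsZ_dia, epsZ_toZ, epsZ_toZ, eps_xb] at h1
  have h2 := vevZ_Idel (dia_Idel (toZ n (eps n (monoBar σ))) (db_dia_monoBar σ k))
  rw [LinearMap.mem_ker, ← diaLin_apply, map_sub, map_sub, diaLin_apply, diaLin_apply,
    sub_eq_zero, (hasWt_monoBar σ).uhMap_mul, ← dia_uhMap, ← dia_assoc, ← dia_assoc,
    vevZ_dia_ofUh] at h2
  rw [monoForm, h1, h2, monoForm]

/-! ### The product formula -/

/-- The image of `h̊_ij` in `Ū(h)`. -/
def hringBar (i j : Fin n) : UhBar n := algebraMap (Uh n) (UhBar n) (hring i - hring j)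

theorem hringBar_eq (i j : Fin n) : hringBar i j = algebraMap (Uh n) (UhBar n) (MvPolynomial.X i)
    - algebraMap (Uh n) (UhBar n) (MvPolynomial.X j) + (((j : ℤ) - i : ℤ) : UhBar n) := by
  have h : (hring i - hring j : Uh n)
      = MvPolynomial.X i - MvPolynomial.X j + (((j : ℤ) - i : ℤ) : Uh n) := by
    simp only [hring, map_add, map_natCast, map_one]
    push_cast
    ring
  rw [hringBar, h, map_add, map_sub, map_intCast]

theorem algebraMap_rise (p : Uh n) (m : ℕ) : algebraMap (Uh n) (UhBar n) (rise p m)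
    = (ascPochhammer (UhBar n) m).eval (algebraMap (Uh n) (UhBar n) p) := by
  induction m with
  | zero => simp [rise]
  | succ m ih =>
    rw [rise, ascPochhammer_succ_eval, map_mul, ← rise, ih, ascPochhammer_succ_eval, map_add,
      map_natCast]

theorem factor_mul (ν : Fin n → ℕ) (p : Pairs n) :
    factor ν p * (ascPochhammer (UhBar n) (ν p.1.1 + 1)).eval (hringBar p.1.1 p.1.2)
      = (ascPochhammer (UhBar n) (ν p.1.1 + 1)).eval (hringBar p.1.1 p.1.2 - (ν p.1.2 : UhBar n)) := by
  rw [hringBar, ← map_natCast (algebraMap (Uh n) (UhBar n)) (ν p.1.2), ← map_sub,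
    ← algebraMap_rise, ← algebraMap_rise, factor, Localization.mk_eq_mk']
  exact IsLocalization.mk'_spec (M := K n) _ _ _

theorem isUnit_ascPochhammer_hringBar {i j : Fin n} (hij : i ≠ j) (m : ℕ) :
    IsUnit ((ascPochhammer (UhBar n) m).eval (hringBar i j)) := by
  rw [hringBar, ← algebraMap_rise]
  exact IsLocalization.map_units (M := K n) _ ⟨_, rise_mem_K hij m⟩

theorem factor_eq_one {ν : Fin n → ℕ} {p : Pairs n} (h : ν p.1.2 = 0) : factor ν p = 1 := by
  have h1 := factor_mul ν p
  rw [h, Nat.cast_zero, sub_zero] at h1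
  exact (isUnit_ascPochhammer_hringBar p.2.ne _).mul_right_cancel (h1.trans (one_mul _).symm)

theorem factor_congr {ν ν' : Fin n → ℕ} {p : Pairs n} (h1 : ν p.1.1 = ν' p.1.1)
    (h2 : ν p.1.2 = ν' p.1.2) : factor ν p = factor ν' p := by
  refine (isUnit_ascPochhammer_hringBar p.2.ne (ν p.1.1 + 1)).mul_right_cancel ?_
  rw [factor_mul, h1, h2, factor_mul]

/-- Both sides are the rising factorial of `z - 1` of length `m + 1`. -/
theorem ascPochhammer_eval_sub_one_mul {R : Type*} [CommRing R] (z : R) (m : ℕ) :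
    (ascPochhammer R m).eval (z - 1) * (z - 1 + m) = (z - 1) * (ascPochhammer R m).eval z := by
  rw [← ascPochhammer_succ_eval, ascPochhammer_succ_left]
  simp

theorem factor_add_mul (σ : Fin n → ℕ) (p : Pairs n) :
    factor (σ + Pi.single p.1.2 1) p * (hringBar p.1.1 p.1.2 + σ p.1.1 - σ p.1.2)
      = factor σ p * (hringBar p.1.1 p.1.2 - σ p.1.2 - 1) := by
  have h1 := factor_mul (σ + Pi.single p.1.2 1) p
  have h2 := factor_mul σ p
  have h3 : (σ + Pi.single p.1.2 1 : Fin n → ℕ) p.1.1 = σ p.1.1 := by simp [p.2.ne]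
  rw [Pi.add_apply σ _ p.1.2, Pi.single_eq_same, h3] at h1
  have h4 := ascPochhammer_eval_sub_one_mul (hringBar p.1.1 p.1.2 - (σ p.1.2 : UhBar n))
    (σ p.1.1 + 1)
  push_cast at h1 h4
  rw [← sub_sub] at h1
  rw [← h1, ← h2] at h4
  refine (isUnit_ascPochhammer_hringBar p.2.ne (σ p.1.1 + 1)).mul_right_cancel ?_
  linear_combination h4

theorem shift_cartD_sub (σ : Fin n → ℕ) (i k : Fin n) :
    shift (fun i => (σ i : ℤ)) (cartD k - cartD i) = -(hringBar i k + σ i - σ k) := by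
  rw [cartD_sub, map_add, map_sub, shift_X, shift_X, map_intCast, hringBar_eq]
  push_cast
  ring

/-- Writing `p = (i, k)` and `z = h̊_ik + σ_i - σ_k`, the shifted difference of Cartan elements is
`-z`. The new factor is thus `1 - (σ_i+1)/z = (h̊_ik - σ_k - 1)/z`, the ratio in `factor_add_mul`.
-/
theorem factor_add (σ : Fin n → ℕ) (p : Pairs n) : factor (σ + Pi.single p.1.2 1) p = factor σ p *
    shift (fun i => (σ i : ℤ)) (1 + succBar σ p.1.1 * Ring.inverse (cartD p.1.2 - cartD p.1.1)) := by
  have h1 := congrArg (shift fun i => (σ i : ℤ))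
    (Ring.mul_inverse_cancel _ (covectorD.unit p.1.1 p.1.2 p.2.ne))
  rw [map_mul, shift_cartD_sub, map_one] at h1
  have h2 := factor_add_mul σ p
  rw [map_add, map_one, map_mul, succBar, map_natCast]
  push_cast
  linear_combination (factor σ p - factor (σ + Pi.single p.1.2 1) p) * h1
    - shift (fun i => (σ i : ℤ)) (Ring.inverse (cartD p.1.2 - cartD p.1.1)) * h2

theorem prod_pairs_ite {M : Type*} [CommMonoid M] (k : Fin n) (g : Fin n → M) :
    ∏ p : Pairs n, (if p.1.2 = k then g p.1.1 else 1) = ∏ i ∈ Finset.Iio k, g i := by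
  rw [← Finset.prod_subtype (Finset.univ.filter fun p : Fin n × Fin n => p.1 < p.2) (by simp)
    (fun p : Fin n × Fin n => if p.2 = k then g p.1 else 1), Finset.prod_filter,
    Fintype.prod_prod_type]
  have h : ∀ i : Fin n, ∏ j, (if i < j then if j = k then g i else 1 else 1)
      = if i < k then g i else 1 := by
    intro i
    rw [Finset.prod_eq_single k (fun j _ hj => by simp [hj]) (by simp), if_pos rfl]
  simp only [h]
  rw [← Finset.prod_filter]
  congr 1
  ext i
  simp

/-- The squared norm of the monomial `x^ν`. -/
def normFormula (ν : Fin n → ℕ) : UhBar n :=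
  (∏ k : Fin n, ((ν k).factorial : UhBar n)) * ∏ p : Pairs n, factor ν p

/-- Raising `σ_k` affects only the factorial at `k` and the pairs `(i, k)`, and these are exactly
the factors of `lowerCoeff`. -/
theorem normFormula_add {σ : Fin n → ℕ} {k : Fin n} (hσ : ∀ l, k < l → σ l = 0) :
    normFormula (σ + Pi.single k 1)
      = shift (fun i => (σ i : ℤ)) (lowerCoeff σ k) * normFormula σ := by
  have h1 : ∀ i, (((σ + Pi.single k 1 : Fin n → ℕ) i).factorial : UhBar n)
      = (if i = k then succBar σ k else 1) * (σ i).factorial := by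
    intro i
    by_cases hi : i = k
    · subst hi
      rw [if_pos rfl, Pi.add_apply, Pi.single_eq_same, Nat.factorial_succ, Nat.cast_mul, succBar]
    · simp [hi]
  have h2 : ∀ p : Pairs n, factor (σ + Pi.single k 1) p = factor σ p * (if p.1.2 = k then
      shift (fun i => (σ i : ℤ)) (1 + succBar σ p.1.1 * Ring.inverse (cartD k - cartD p.1.1))
      else 1) := by
    intro p
    split_ifs with hp
    · rw [← hp, factor_add]
    · rw [mul_one]
      -- A pair `(k, j)` also involves `σ_k`, but `σ_j = 0` makes its numerator and denominator
      -- equal.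
      by_cases hk : p.1.1 = k
      · have h3 : σ p.1.2 = 0 := hσ _ (hk ▸ p.2)
        rw [factor_eq_one h3, factor_eq_one]
        simp [hp, h3]
      · exact factor_congr (by simp [hk]) (by simp [hp])
  rw [normFormula, Finset.prod_congr rfl fun i _ => h1 i, Finset.prod_congr rfl fun p _ => h2 p,
    Finset.prod_mul_distrib, Finset.prod_mul_distrib, prod_pairs_ite k fun i =>
      shift (fun i => (σ i : ℤ)) (1 + succBar σ i * Ring.inverse (cartD k - cartD i)),
    Finset.prod_ite_eq' Finset.univ k, if_pos (Finset.mem_univ k), lowerCoeff, map_mul, map_prod,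
    succBar, map_natCast, normFormula]
  ring

theorem monoForm_self (ν : Fin n → ℕ) : monoForm ν ν = normFormula ν := by
  induction ν using multiIndex_induction with
  | h0 =>
    rw [monoForm_zero, normFormula, Finset.prod_eq_one (by simp), one_mul,
      Finset.prod_eq_one fun p _ => factor_eq_one rfl]
  | hs σ k hσ ih => rw [monoForm_add hσ, normFormula_add hσ, ih]

/-! ### Values at generic points -/

theorem evalAt_algebraMap {μ : Fin n → ℂ} (hμ : Generic μ) (p : Uh n) :
    evalAt hμ (algebraMap (Uh n) (UhBar n) p) = MvPolynomial.eval μ p :=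
  IsLocalization.lift_eq _ _

theorem map_ascPochhammer_eval {R S : Type*} [CommRing R] [CommRing S] (f : R →+* S) (m : ℕ)
    (z : R) : f ((ascPochhammer R m).eval z) = (ascPochhammer S m).eval (f z) := by
  rw [← ascPochhammer_map f, Polynomial.eval_map_apply]

/-- As `z` is not an integer, neither `z` nor `z - b` is a pole of `Γ`, and each quotient `Γ(w + a +
1)/Γ(w)` is a rising factorial. -/
theorem Gamma_quotient {z : ℂ} (hz : ∀ k : ℤ, z ≠ k) (a b : ℕ) :
    Complex.Gamma (z - b + a + 1) * Complex.Gamma z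
        / (Complex.Gamma (z - b) * Complex.Gamma (z + a + 1))
      = (ascPochhammer ℂ (a + 1)).eval (z - b) / (ascPochhammer ℂ (a + 1)).eval z := by
  have h1 := Complex.Gamma_add_nat_div_Gamma_eq (n := a + 1) (z - b) fun k h =>
    hz (b - k) (by push_cast; linear_combination h)
  have h2 := Complex.Gamma_add_nat_div_Gamma_eq (n := a + 1) z fun k h =>
    hz (-k) (by push_cast; exact h)
  push_cast at h1 h2
  rw [← h1, ← h2, ← add_assoc, ← add_assoc, div_div_div_eq]

theorem eval_hring_sub_ne {μ : Fin n → ℂ} (hμ : Generic μ) {i j : Fin n} (hij : i ≠ j) (k : ℤ) :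
    MvPolynomial.eval μ (hring i - hring j) ≠ k := by
  intro h
  refine hμ i j hij (k + i - j) ?_
  simp only [hring, map_sub, MvPolynomial.eval_X, MvPolynomial.eval_C] at h
  push_cast
  linear_combination h

theorem evalAt_factor {μ : Fin n → ℂ} (hμ : Generic μ) (ν : Fin n → ℕ) (p : Pairs n) :
    evalAt hμ (factor ν p)
      = (Complex.Gamma (MvPolynomial.eval μ (hring p.1.1 - hring p.1.2)
              - (ν p.1.2 : ℂ) + (ν p.1.1 : ℂ) + 1)
          * Complex.Gamma (MvPolynomial.eval μ (hring p.1.1 - hring p.1.2)))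
        / (Complex.Gamma (MvPolynomial.eval μ (hring p.1.1 - hring p.1.2) - (ν p.1.2 : ℂ))
          * Complex.Gamma (MvPolynomial.eval μ (hring p.1.1 - hring p.1.2)
              + (ν p.1.1 : ℂ) + 1)) := by
  have h1 := congrArg (evalAt hμ) (factor_mul ν p)
  have h2 := ((isUnit_ascPochhammer_hringBar p.2.ne (ν p.1.1 + 1)).map (evalAt hμ)).ne_zero
  rw [map_mul, map_ascPochhammer_eval, map_ascPochhammer_eval, map_sub, map_natCast, hringBar,
    evalAt_algebraMap] at h1
  rw [map_ascPochhammer_eval, hringBar, evalAt_algebraMap] at h2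
  rw [Gamma_quotient (eval_hring_sub_ne hμ p.2.ne), eq_div_iff h2, h1]

end HDiff

end

theorem proposition3p3 (n : ℕ) (ν ν' : Fin n → ℕ) :
    HDiff.form (HDiff.monoPh ν) (HDiff.monoPh ν')
        = (if ν = ν' then
            (∏ k : Fin n, ((ν k).factorial : HDiff.UhBar n))
              * ∏ p : HDiff.Pairs n, HDiff.factor ν p
          else 0) ∧
    ∀ (μ : Fin n → ℂ) (hμ : HDiff.Generic μ),
      HDiff.evalAt hμ (HDiff.form (HDiff.monoPh ν) (HDiff.monoPh ν'))
        = (if ν = ν' then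
            (∏ k : Fin n, ((ν k).factorial : ℂ)) *
              ∏ p : HDiff.Pairs n,
                (Complex.Gamma (MvPolynomial.eval μ (HDiff.hring p.1.1 - HDiff.hring p.1.2)
                      - (ν p.1.2 : ℂ) + (ν p.1.1 : ℂ) + 1)
                  * Complex.Gamma (MvPolynomial.eval μ (HDiff.hring p.1.1 - HDiff.hring p.1.2)))
                / (Complex.Gamma (MvPolynomial.eval μ (HDiff.hring p.1.1 - HDiff.hring p.1.2)
                      - (ν p.1.2 : ℂ))
                  * Complex.Gamma (MvPolynomial.eval μ (HDiff.hring p.1.1 - HDiff.hring p.1.2)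
                      + (ν p.1.1 : ℂ) + 1))
          else 0) := by
  rw [HDiff.form_monoPh]
  by_cases h : ν = ν'
  · subst h
    rw [if_pos rfl, HDiff.monoForm_self]
    refine ⟨rfl, fun μ hμ => ?_⟩
    rw [if_pos rfl, HDiff.normFormula, map_mul, map_prod, map_prod]
    simp only [map_natCast, HDiff.evalAt_factor]
  · rw [if_neg h, HDiff.monoForm_of_ne h]
    refine ⟨rfl, fun μ hμ => ?_⟩
    rw [if_neg h, map_zero]
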